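/- **Conventions.** Operads are symmetric graded operads of abelian groups, with right actions $x\mapsto x^\sigma$ of the symmetric groups and partial compositions $\circ_a$ satisfying the Koszul sign rule: $(x\circ_a y)\circ_{b+\#y-1} z=(-1)^{\deg y\deg z}(x\circ_b z)\circ_a y$ for $a<b$. Here $\#x$ denotes the arity of $x$. Write $\langle n\rangle=\{1,\dots,n\}$. **Extensions.** For $a\in\langle m\rangle$ let $\alpha:\langle n\rangle\to\langle n+m-1\rangle$, $\alpha(j)=j+a-1$, and let $\beta:\langle n+m-1\rangle\to\langle m\rangle$ be the weakly increasing surjection (for $n\ge1$) that is constant equal to $a$ on the image of $\alpha$ and injective elsewhere. **Words.** For $n\ge1$, $\mathsf{Word}(n)$ is the set of finite words $W$ over $\langle n\rangle$ in which every letter occurs, with no subword $uu$ and no subsequence $u\,v\,u\,v$ ($u\ne v$); $\deg W=|W|-n$. - *Faces.* An occurrence of $u$ in $W$ is a *caesura* if $u$ occurs again later; number the caesurae $1,2,\dots$ from left to right. To the $k$-th caesura attach the number $k$; to the last occurrence of a repeated letter whose previous occurrence is the $k$-th caesura attach $k+1$. Then $\partial W=\sum(-1)^{\text{number}}(W\text{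 with that occurrence deleted})$, summed over all occurrences of repeated letters. - *Extensions.* An extension of $V\in\mathsf{Word}(m)$ by $W\in\mathsf{Word}(n)$ at $a$ is $X\in\mathsf{Word}(n+m-1)$ such that: deleting from $X$ the letters outside the image of $\alpha$ and eliminating consecutive repetitions gives $\alpha(W)$; whenever a nonempty block of letters between two letters of the image is deleted, these two letters are equal; and applying $\beta$ to $X$ and eliminating consecutive repetitions gives $V$. - *Signs.* A letter $v$ is *interposed* in $W$ if $W=\dots uv\dots u\dots$ for some $u$. Identify an interposed $v\ne a$ of $V$ with $\beta^{-1}(v)$, an interposed $a$ of $V$ with $\alpha$ of the first letter of $W$, and an interposed $w$ of $W$ with $\alpha(w)$. The sign of $X$ is the sign of the shuffle from (interposed letters of $V$, then interposed letters of $W$, each in order of first occurrence) to the interposed letters of $X$ in order of first occurrence. **Trees.** $\mathsf{Tree}(n)$ is the set of planar rooted trees $T$ with vertex set $\langle n\rangle$; $u\le_T v$ means that $v$ is $u$ or a descendant of $u$, and $u\vartriangleleft_T v$ means that $u$ and $v$ are $\le_T$-incomparable and $u$ is to the left of $v$. An extension of $S\in\mathsf{Tree}(m)$ by $T\in\mathsf{Tree}(n)$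 at $a$ is a tree $U\in\mathsf{Tree}(n+m-1)$ such that $\alpha$ identifies $T$ (edges and $\vartriangleleft$) with its image in $U$, every edge of $U$ is mapped by $\beta$ to an edge of $S$ or to the pair $(a,a)$, and $\beta u\vartriangleleft_S\beta w$ implies $u\vartriangleleft_U w$. **Quilts.** A quilt of arity $n$ is $Q=(W,T)\in\mathsf{Word}(n)\times\mathsf{Tree}(n)$ such that $W=\dots u\dots v\dots$ implies $u\not>_T v$, and $W=\dots u\dots v\dots u\dots$ implies $v=u$ or $v\vartriangleleft_T u$. $\mathit{Quilt}(n)$ is the free abelian group on the quilts of arity $n$, graded by $\deg(W,T)=\deg W$, with boundary $\partial(W,T)=(\partial W,T)$. The group $\mathbb S_n$ acts by relabelling, $Q^\sigma$ being $Q$ with every $u$ replaced by $\sigma^{-1}(u)$. The partial composition $(V,S)\circ_a(W,T)$ is the sum of $\pm(X,U)$ over the extensions $X$ of $V$ by $W$ and $U$ of $S$ by $T$ at $a$, with the sign of $X$. Let $(1\to2)$ denote the quilt with word $12$ and the tree with root $1$ and one further vertex $2$. **mQuilt.** Let $\mathit{mQuilt}$ be the graded operad generated by the graded operad $\mathit{Quilt}$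 and one additional generator $\mathsf m$ of arity $0$ and degree $-1$, subject to the following relations, for all quilts $Q=(W_Q,T_Q)$ and $P=(W_P,T_P)$ of the same arity and vertices $u$ of $Q$: 1. $(1\to2)\circ(\mathsf m,\mathsf m)=0$; 2. $Q\circ_u\mathsf m=0$ if $u$ has more than two children in $T_Q$; 3. $Q\circ_u\mathsf m=0$ if $u$ is repeated in $W_Q$; 4. $Q\circ_u\mathsf m=0$ if $W_Q=\dots vuv\dots$ for some $v$; 5. $Q\circ_u\mathsf m=P\circ_u\mathsf m$ if $T_Q=T_P$ and $W_Q$, $W_P$ are equal except for the position of $u$. Put $\Delta:=(1\to2)\circ_1\mathsf m-(1\to2)\circ_2\mathsf m\in\mathit{mQuilt}(1)$, an element of degree $-1$, and $$\mathrm{ad}_\Delta B:=\Delta\circ_1B-(-1)^{\deg B}\sum_{a=1}^{\#B}B\circ_a\Delta .$$ **Theorem.** The boundary operator of $\mathit{Quilt}$ extends uniquely to an equivariant derivation $\partial$ of degree $-1$ of the graded operad $\mathit{mQuilt}$ with $\partial\mathsf m=0$. The operator $\partial':=\partial+\mathrm{ad}_\Delta$ satisfies $(\partial')^2=0$ and makes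 $\mathit{mQuilt}$ a differential graded operad; that is, $\partial'$ has degree $-1$, commutes with the symmetric group actions, and satisfies $\partial'(x\circ_a y)=\partial'x\circ_a y+(-1)^{\deg x}x\circ_a\partial'y$ for all homogeneous $x,y$. -/

import Mathlib

open scoped BigOperators

/-! ### Extensions of finite ordinals

Vertices are labelled by `Fin n`, i.e. by `0, …, n - 1` instead of `1, …, n`.  For `l + 1 = m + n`,
the extension of `Fin m` by `Fin n` at `a` is `Fin n → Fin l → Fin m`. -/

/-- The injection `Fin n → Fin l` of the extension at `a`. -/
def blockIncl {m n l : ℕ} (h : l + 1 = m + n) (a : Fin m) (j : Fin n) : Fin l :=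
  ⟨a + j, by have := a.2; have := j.2; omega⟩

/-- The map `Fin l → Fin m` of the extension at `a`, collapsing the image of `blockIncl` to `a`. -/
def blockProj {m n l : ℕ} (h : l + 1 = m + n) (a : Fin m) (k : Fin l) : Fin m :=
  if h₁ : (k : ℕ) < a then ⟨k, by have := a.2; omega⟩
  else if h₂ : (k : ℕ) < a + n then a
  else ⟨k + 1 - n, by have := k.2; have := a.2; omega⟩

/-! ### Words -/

/-- `SWord n`: words over `Fin n` (`n ≥ 1`) in which every vertex occurs, without consecutive
repetition and without interlacing. -/
@[ext] structure SWord (n : ℕ) where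
  letters : List (Fin n)
  nonempty : letters ≠ []
  surjective : ∀ u, u ∈ letters
  nondegenerate : letters.IsChain (· ≠ ·)
  noninterlacing : ∀ u v, u ≠ v → ¬ [u, v, u, v].Sublist letters

namespace SWord

variable {n : ℕ}

/-- The degree of a word: its length minus its arity. -/
def deg (W : SWord n) : ℤ := (W.letters.length : ℤ) - n

/-- The first letter. -/
def first (W : SWord n) : Fin n := W.letters.head W.nonempty

/-- `u` occurs more than once. -/
def Repeated (W : SWord n) (u : Fin n) : Prop := 2 ≤ W.letters.count u

/-- `v` is interposed: `W = … u v … u …` for some `u`. -/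
def Interposed (W : SWord n) (v : Fin n) : Prop :=
  ∃ (u : Fin n) (p s : List (Fin n)), W.letters = p ++ u :: v :: s ∧ u ∈ s

/-- The letter at position `i` is a caesura: the same vertex occurs again later. -/
def IsCaesura (W : SWord n) (i : ℕ) : Prop :=
  ∃ u ∈ W.letters.drop (i + 1), W.letters[i]? = some u

open Classical in
/-- The number of caesurae among the letters at positions `≤ i`; so if the letter at position `i`
is the `k`-th caesura (counting from `1`), this is `k`. -/
noncomputable def caesuraNumber (W : SWord n) (i : ℕ) : ℕ :=
  ((Finset.range (i + 1)).filter fun j => W.IsCaesura j).card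

/-- The position of the previous occurrence of the vertex at position `i` (if there is one). -/
def prevOcc (W : SWord n) (i : ℕ) : ℕ :=
  ((Finset.range i).filter fun j => W.letters[j]? = W.letters[i]?).sup id

open Classical in
/-- The number attached to a letter of a repeated vertex: `k` for the `k`-th caesura, and `k + 1`
for a last occurrence whose previous occurrence is the `k`-th caesura. -/
noncomputable def faceNumber (W : SWord n) (i : ℕ) : ℕ :=
  if W.IsCaesura i then W.caesuraNumber i else W.caesuraNumber (W.prevOcc i) + 1

theorem face_aux (W : SWord n) (i : Fin W.letters.length)
    (hi : W.Repeated (W.letters.get i)) :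
    W.letters.get i ∈ W.letters.eraseIdx i ∧ (W.letters.eraseIdx i).IsChain (· ≠ ·) := by
  obtain ⟨i, hil⟩ := i
  have hW : W.letters = W.letters.take i ++ W.letters[i] :: W.letters.drop (i + 1) := by simp
  have hnd := W.nondegenerate
  have hni := W.noninterlacing
  unfold Repeated at hi
  simp only [List.get_eq_getElem] at hi ⊢
  rw [List.eraseIdx_eq_take_drop_succ]
  generalize W.letters[i] = a at *
  generalize W.letters.take i = p at *
  generalize W.letters.drop (i + 1) = s at *
  rw [hW] at hi hnd hni
  have hmem : a ∈ p ∨ a ∈ s := by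
    by_contra! hcon
    rw [List.count_append, List.count_cons_self, List.count_eq_zero_of_not_mem hcon.1,
      List.count_eq_zero_of_not_mem hcon.2] at hi
    omega
  refine ⟨List.mem_append.2 hmem, ?_⟩
  rw [List.isChain_append] at hnd ⊢
  obtain ⟨h1, h2, h3⟩ := hnd
  refine ⟨h1, h2.tail, ?_⟩
  intro x hx y hy hxy
  subst hxy
  have hxa : x ≠ a := h3 x hx a (by simp)
  obtain ⟨p', rfl⟩ : ∃ p', p = p' ++ [x] := ⟨_, (List.dropLast_append_getLast? x hx).symm⟩
  obtain ⟨s', rfl⟩ : ∃ s', s = x :: s' := by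
    cases s with
    | nil => simp at hy
    | cons z s' => simp at hy; exact ⟨s', by rw [hy]⟩
  rcases hmem with hm | hm
  · have hm' : a ∈ p' := by
      rcases List.mem_append.1 hm with h | h
      · exact h
      · exact absurd (List.mem_singleton.1 h).symm hxa
    refine hni a x hxa.symm ?_
    rw [List.append_assoc]
    refine List.Sublist.append (l₁ := [a]) (List.singleton_sublist.2 hm') ?_
    exact ((List.nil_sublist s').cons_cons x).cons_cons a |>.cons_cons x
  · have hm' : a ∈ s' := by
      rcases List.mem_cons.1 hm with h | h
      · exact absurd h.symm hxa
      · exact h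
    refine hni x a hxa ?_
    rw [List.append_assoc]
    refine List.Sublist.trans ?_ (List.sublist_append_right p' _)
    exact (((List.singleton_sublist.2 hm').cons_cons x).cons_cons a).cons_cons x

/-- The face of `W` at the letter in position `i`, whose vertex is repeated: delete this letter. -/
def face (W : SWord n) (i : Fin W.letters.length) (hi : W.Repeated (W.letters.get i)) :
    SWord n where
  letters := W.letters.eraseIdx i
  nonempty := by
    intro h0
    have h1 : (W.letters.eraseIdx i).length = 0 := by rw [h0]; rfl
    have h2 := List.count_le_length (a := W.letters.get i) (l := W.letters)
    have h3 := i.2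
    unfold Repeated at hi
    rw [List.length_eraseIdx_of_lt h3] at h1
    omega
  surjective := fun u => by
    obtain ⟨h1, h2⟩ := W.face_aux i hi
    by_cases hu : u = W.letters.get i
    · rw [hu]
      exact h1
    · obtain ⟨j, hj⟩ := List.mem_iff_get.1 (W.surjective u)
      refine List.mem_eraseIdx_iff_getElem.2 ⟨j, j.2, ?_, hj⟩
      intro e
      exact hu (by rw [← hj]; congr 1; exact Fin.ext e)
  nondegenerate := (W.face_aux i hi).2
  noninterlacing := fun u v huv h =>
    W.noninterlacing u v huv (h.trans (List.eraseIdx_sublist ..))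

theorem deg_face (W : SWord n) (i : Fin W.letters.length) (hi : W.Repeated (W.letters.get i)) :
    (W.face i hi).deg = W.deg - 1 := by
  have h3 := i.2
  simp only [deg, face, List.length_eraseIdx_of_lt h3]
  omega

/-- The right action of permutations: replace every `u` by `σ⁻¹ u`. -/
def act (σ : Equiv.Perm (Fin n)) (W : SWord n) : SWord n where
  letters := W.letters.map ⇑σ.symm
  nonempty := by simpa using W.nonempty
  surjective := fun u => List.mem_map.2 ⟨σ u, W.surjective _, by simp⟩
  nondegenerate := by
    rw [List.isChain_map]
    exact W.nondegenerate.imp fun a b hab h => hab (σ.symm.injective h)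
  noninterlacing := fun u v huv h => by
    have h' := h.map ⇑σ
    simp only [List.map_map, List.map_cons, List.map_nil] at h'
    rw [show (⇑σ ∘ ⇑σ.symm) = id by ext; simp, List.map_id] at h'
    exact W.noninterlacing (σ u) (σ v) (fun e => huv (σ.injective e)) h'

theorem deg_act (σ : Equiv.Perm (Fin n)) (W : SWord n) : (W.act σ).deg = W.deg := by
  simp [deg, act]

variable {m l : ℕ}

/-- `X` is an extension of `V` by `W` at `a`:
deleting from `X` the vertices outside the image of `blockIncl` and eliminating consecutive
repetitions gives `W` (relabelled); these repetitions occur wherever letters have been deleted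
between vertices of the image; relabelling `X` by `blockProj` and eliminating consecutive
repetitions gives `V`. -/
def IsExt (h : l + 1 = m + n) (a : Fin m) (V : SWord m) (W : SWord n) (X : SWord l) : Prop :=
  (X.letters.filter fun k => decide (∃ j, blockIncl h a j = k)).destutter (· ≠ ·) =
      W.letters.map (blockIncl h a) ∧
    (∀ (p mid s : List (Fin l)) (j j' : Fin n),
      X.letters = p ++ blockIncl h a j :: (mid ++ blockIncl h a j' :: s) → mid ≠ [] →
      (∀ k ∈ mid, ∀ i, blockIncl h a i ≠ k) → j = j') ∧
    (X.letters.map (blockProj h a)).destutter (· ≠ ·) = V.letters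

/-- The identification of vertices of `V` with vertices of an extension of `V` by `W` at `a`:
`v ≠ a` corresponds to its unique preimage under `blockProj`, and `a` to the first letter of `W`. -/
def liftVertex (h : l + 1 = m + n) (a : Fin m) (W : SWord n) (v : Fin m) : Fin l :=
  if h₁ : v < a then ⟨v, by have := a.2; have : (v : ℕ) < a := h₁; omega⟩
  else if h₂ : a < v then
    ⟨v + n - 1, by have := v.2; have : (a : ℕ) < v := h₂; omega⟩
  else blockIncl h a W.first

open Classical in
/-- The sign of the shuffle taking the interposed vertices of `V` followed by those of `W` (each in
order of first occurrence) to the interposed vertices of `X` in order of first occurrence: the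
inversions of this shuffle are the pairs `(v, w)` such that `w` occurs in `X` before `v`. -/
noncomputable def extSign (h : l + 1 = m + n) (a : Fin m) (V : SWord m) (W : SWord n)
    (X : SWord l) : ℤ :=
  (-1) ^ ((Finset.univ : Finset (Fin m × Fin n)).filter fun vw =>
    V.Interposed vw.1 ∧ W.Interposed vw.2 ∧
      X.letters.idxOf (blockIncl h a vw.2) < X.letters.idxOf (liftVertex h a W vw.1)).card

end SWord

/-! ### Planar rooted trees -/

/-- Planar rooted trees with vertex set `Fin n`: edges `(parent, child)`, and the strict
left-to-right order `left`.  The vertical order is the reflexive transitive closure of `edge`. -/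
@[ext] structure PlanarTree (n : ℕ) where
  edge : Fin n → Fin n → Prop
  left : Fin n → Fin n → Prop
  edge_irrefl : ∀ u, ¬ edge u u
  antisymm : ∀ u v, Relation.ReflTransGen edge u v → Relation.ReflTransGen edge v u → u = v
  existsUnique_root : ∃! r, ∀ v, Relation.ReflTransGen edge v r → v = r
  minimal : ∀ u v, edge u v → ¬ ∃ t, t ≠ u ∧ t ≠ v ∧
    Relation.ReflTransGen edge u t ∧ Relation.ReflTransGen edge t v
  left_irrefl : ∀ u, ¬ left u u
  left_trans : ∀ u v w, left u v → left v w → left u w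
  comparable : ∀ u v, (left u v ∨ left v u) ↔
    (¬ Relation.ReflTransGen edge u v ∧ ¬ Relation.ReflTransGen edge v u)
  inherit : ∀ u v u' v', left u v → Relation.ReflTransGen edge u u' →
    Relation.ReflTransGen edge v v' → left u' v'

namespace PlanarTree

variable {m n l : ℕ}

/-- The vertical order `u ≤ v` (`u` is above `v`; the root is the least element). -/
def le (T : PlanarTree n) (u v : Fin n) : Prop := Relation.ReflTransGen T.edge u v

/-- The strict vertical order. -/
def lt (T : PlanarTree n) (u v : Fin n) : Prop := T.le u v ∧ u ≠ v

theorem reflTransGen_comap (T : PlanarTree n) (σ : Equiv.Perm (Fin n)) (u v : Fin n) :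
    Relation.ReflTransGen (fun x y => T.edge (σ x) (σ y)) u v ↔ T.le (σ u) (σ v) := by
  constructor
  · intro h
    induction h with
    | refl => exact Relation.ReflTransGen.refl
    | tail _ h ih => exact Relation.ReflTransGen.tail ih h
  · intro h
    have key : ∀ y, T.le (σ u) y →
        Relation.ReflTransGen (fun x y => T.edge (σ x) (σ y)) u (σ.symm y) := by
      intro y hy
      induction hy with
      | refl => simpa using Relation.ReflTransGen.refl
      | tail _ h ih => exact Relation.ReflTransGen.tail ih (by simpa using h)
    simpa using key _ h

/-- The right action of permutations: replace every `u` by `σ⁻¹ u`. -/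
def act (σ : Equiv.Perm (Fin n)) (T : PlanarTree n) : PlanarTree n where
  edge u v := T.edge (σ u) (σ v)
  left u v := T.left (σ u) (σ v)
  edge_irrefl u := T.edge_irrefl _
  antisymm u v h₁ h₂ := σ.injective
    (T.antisymm _ _ ((T.reflTransGen_comap σ u v).1 h₁) ((T.reflTransGen_comap σ v u).1 h₂))
  existsUnique_root := by
    obtain ⟨r, hr, hu⟩ := T.existsUnique_root
    refine ⟨σ.symm r, fun v hv => ?_, fun r' hr' => ?_⟩
    · have := hr (σ v) (by simpa [le] using (T.reflTransGen_comap σ v _).1 hv)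
      rw [← this]; simp
    · have := hu (σ r') fun v hv => by
        have := hr' (σ.symm v) ((T.reflTransGen_comap σ _ _).2 (by simpa [le] using hv))
        rw [← this]; simp
      rw [← this]; simp
  minimal u v huv := by
    rintro ⟨t, h₁, h₂, h₃, h₄⟩
    exact T.minimal _ _ huv ⟨σ t, fun e => h₁ (σ.injective e), fun e => h₂ (σ.injective e),
      (T.reflTransGen_comap σ _ _).1 h₃, (T.reflTransGen_comap σ _ _).1 h₄⟩
  left_irrefl u := T.left_irrefl _
  left_trans u v w := T.left_trans _ _ _
  comparable u v := by
    rw [T.reflTransGen_comap, T.reflTransGen_comap]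
    exact T.comparable _ _
  inherit u v u' v' h h₁ h₂ := T.inherit _ _ _ _ h ((T.reflTransGen_comap σ _ _).1 h₁)
    ((T.reflTransGen_comap σ _ _).1 h₂)

/-- `U` is an extension of `S` by `T` at `a`: `T` is a subtree of `U`, with quotient `S`. -/
def IsExt (h : l + 1 = m + n) (a : Fin m) (S : PlanarTree m) (T : PlanarTree n)
    (U : PlanarTree l) : Prop :=
  (∀ r s, T.edge r s ↔ U.edge (blockIncl h a r) (blockIncl h a s)) ∧
  (∀ r s, T.left r s ↔ U.left (blockIncl h a r) (blockIncl h a s)) ∧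
  (∀ u w, U.edge u w → S.edge (blockProj h a u) (blockProj h a w) ∨
    (blockProj h a u = a ∧ blockProj h a w = a)) ∧
  (∀ u w, S.left (blockProj h a u) (blockProj h a w) → U.left u w)

/-- The tree with one vertex. -/
def single : PlanarTree 1 where
  edge _ _ := False
  left _ _ := False
  edge_irrefl _ h := h
  antisymm _ _ _ _ := Subsingleton.elim _ _
  existsUnique_root := ⟨0, fun _ _ => Subsingleton.elim _ _, fun _ _ => Subsingleton.elim _ _⟩
  minimal _ _ h := h.elim
  left_irrefl _ h := h
  left_trans _ _ _ h := h.elim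
  comparable u v := by
    constructor
    · rintro (h | h) <;> exact h.elim
    · rintro ⟨h, -⟩
      exact (h (by rw [Subsingleton.elim u v])).elim
  inherit _ _ _ _ h := h.elim

theorem reflTransGen_two {u v : Fin 2} :
    Relation.ReflTransGen (fun x y : Fin 2 => x = 0 ∧ y = 1) u v ↔ u ≤ v := by
  constructor
  · intro h
    induction h with
    | refl => exact le_refl _
    | tail _ h ih => obtain ⟨rfl, rfl⟩ := h; exact ih.trans (by decide)
  · intro h
    rcases h.eq_or_lt with rfl | h
    · exact Relation.ReflTransGen.refl
    · exact Relation.ReflTransGen.single (by omega)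

/-- The tree `1 → 2` with two vertices, the root `0` and its child `1`. -/
def two : PlanarTree 2 where
  edge u v := u = 0 ∧ v = 1
  left _ _ := False
  edge_irrefl u h := by omega
  antisymm u v h₁ h₂ := le_antisymm (reflTransGen_two.1 h₁) (reflTransGen_two.1 h₂)
  existsUnique_root := ⟨0, fun v hv => by have := reflTransGen_two.1 hv; omega,
    fun r hr => (hr 0 (reflTransGen_two.2 (by omega))).symm⟩
  minimal u v h := by
    rintro ⟨t, h₁, h₂, -⟩
    omega
  left_irrefl _ h := h
  left_trans _ _ _ h := h.elim
  comparable u v := by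
    rw [reflTransGen_two, reflTransGen_two]
    constructor
    · rintro (h | h) <;> exact h.elim
    · rintro ⟨h₁, h₂⟩; omega
  inherit _ _ _ _ h := h.elim

end PlanarTree

/-! ### Quilts -/

/-- A quilt of arity `n`: a word `W` and a tree `T` such that
`W = … u … v …` implies that `u` is not below `v`, and `W = … u … v … u …` implies that `v` is
equal to or to the left of `u`. -/
@[ext] structure Quilt (n : ℕ) where
  word : SWord n
  tree : PlanarTree n
  not_below : ∀ u v, [u, v].Sublist word.letters → ¬ tree.lt v u
  left_of : ∀ u v, [u, v, u].Sublist word.letters → v = u ∨ tree.left v u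

namespace Quilt

variable {m n l : ℕ}

/-- The degree of a quilt. -/
def deg (Q : Quilt n) : ℤ := Q.word.deg

/-- The right action of permutations on quilts. -/
def act (σ : Equiv.Perm (Fin n)) (Q : Quilt n) : Quilt n where
  word := Q.word.act σ
  tree := Q.tree.act σ
  not_below u v h := by
    have h' := h.map ⇑σ
    simp only [SWord.act, List.map_map, List.map_cons, List.map_nil] at h'
    rw [show (⇑σ ∘ ⇑σ.symm) = id by ext; simp, List.map_id] at h'
    rintro ⟨h₁, h₂⟩
    exact Q.not_below _ _ h' ⟨(Q.tree.reflTransGen_comap σ _ _).1 h₁,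
      fun e => h₂ (σ.injective e)⟩
  left_of u v h := by
    have h' := h.map ⇑σ
    simp only [SWord.act, List.map_map, List.map_cons, List.map_nil] at h'
    rw [show (⇑σ ∘ ⇑σ.symm) = id by ext; simp, List.map_id] at h'
    exact (Q.left_of _ _ h').imp (fun e => σ.injective e) id

/-- The face of a quilt. -/
def face (Q : Quilt n) (i : Fin Q.word.letters.length)
    (hi : Q.word.Repeated (Q.word.letters.get i)) : Quilt n where
  word := Q.word.face i hi
  tree := Q.tree
  not_below u v h := Q.not_below u v (h.trans (List.eraseIdx_sublist ..))
  left_of u v h := Q.left_of u v (h.trans (List.eraseIdx_sublist ..))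

/-- The quilt with one vertex. -/
def one : Quilt 1 where
  word :=
    { letters := [0]
      nonempty := by simp
      surjective := fun u => by simp [Subsingleton.elim u 0]
      nondegenerate := by simp
      noninterlacing := fun u v h => (h (Subsingleton.elim _ _)).elim }
  tree := PlanarTree.single
  not_below u v _ h := h.2 (Subsingleton.elim _ _)
  left_of u v _ := Or.inl (Subsingleton.elim _ _)

/-- The quilt `(12, 1 → 2)`. -/
def two : Quilt 2 where
  word :=
    { letters := [0, 1]
      nonempty := by simp
      surjective := by decide
      nondegenerate := by simp
      noninterlacing := fun u v _ h => by simpa using h.length_le }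
  tree := PlanarTree.two
  not_below u v h := by
    rintro ⟨h₁, h₂⟩
    have h₁ := PlanarTree.reflTransGen_two.1 h₁
    have h₃ : [u, v] = [0, 1] := h.eq_of_length rfl
    simp only [List.cons.injEq, and_true] at h₃
    omega
  left_of u v h := by simpa using h.length_le

/-- The basis of the degree `d` part of the abelian group `Quilt(n)`. -/
abbrev OfDeg (n : ℕ) (d : ℤ) : Type := {Q : Quilt n // Q.deg = d}

instance finite_ofDeg (n : ℕ) (d : ℤ) : Finite (OfDeg n d) := by
  have hlen : ∀ Q : OfDeg n d, Q.1.word.letters.length = (n + d).toNat := fun Q => by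
    have := Q.2
    simp only [deg, SWord.deg] at this
    omega
  refine Finite.of_injective (β := List.Vector (Fin n) (n + d).toNat ×
    (Fin n → Fin n → Prop) × (Fin n → Fin n → Prop))
    (fun Q => (⟨Q.1.word.letters, hlen Q⟩, Q.1.tree.edge, Q.1.tree.left)) ?_
  rintro ⟨P, hP⟩ ⟨Q, hQ⟩ h
  obtain ⟨h₁, h₂⟩ := Prod.mk.inj h
  obtain ⟨h₂, h₃⟩ := Prod.mk.inj h₂
  exact Subtype.ext (Quilt.ext (SWord.ext (congrArg Subtype.val h₁)) (PlanarTree.ext h₂ h₃))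

noncomputable instance fintype_ofDeg (n : ℕ) (d : ℤ) : Fintype (OfDeg n d) := Fintype.ofFinite _

/-- The degree `d` part of `Quilt(n)`: the free abelian group on quilts. -/
abbrev Mod (n : ℕ) (d : ℤ) : Type := OfDeg n d →₀ ℤ

open Classical in
/-- The boundary of a quilt: the signed sum of its faces. -/
noncomputable def boundary {d : ℤ} (Q : OfDeg n d) : Mod n (d - 1) :=
  ∑ i : Fin Q.1.word.letters.length,
    if hi : Q.1.word.Repeated (Q.1.word.letters.get i) then
      Finsupp.single ⟨Q.1.face i hi, (SWord.deg_face _ i hi).trans (congrArg (· - 1) Q.2)⟩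
        ((-1) ^ Q.1.word.faceNumber i)
    else 0

open Classical in
/-- The partial composition of two quilts: the signed sum of the extensions. -/
noncomputable def partialComp (h : l + 1 = m + n) {p q r : ℤ} (_hd : r = p + q) (a : Fin m)
    (P : OfDeg m p) (Q : OfDeg n q) : Mod l r :=
  ∑ X : OfDeg l r,
    if P.1.word.IsExt h a Q.1.word X.1.word ∧ P.1.tree.IsExt h a Q.1.tree X.1.tree then
      Finsupp.single X (P.1.word.extSign h a Q.1.word X.1.word)
    else 0

end Quilt

/-! ### Graded operads -/

/-- A (symmetric) graded operad of abelian groups, in terms of partial compositions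
`x ∘ₐ y` (`comp`) and the right action of the symmetric groups, `xᵠ = act σ x`.  The vertex `u` of
`act σ x` corresponds to the vertex `σ u` of `x`. -/
structure GradedOperad where
  obj : ℕ → ℤ → Type
  [addCommGroup : ∀ n d, AddCommGroup (obj n d)]
  one : obj 1 0
  act : ∀ {n : ℕ} {d : ℤ}, Equiv.Perm (Fin n) → obj n d →+ obj n d
  comp : ∀ {m n l : ℕ} (_ : l + 1 = m + n) {p q r : ℤ} (_ : r = p + q) (_ : Fin m),
    obj m p →+ obj n q →+ obj l r
  act_one : ∀ {n d} (x : obj n d), act 1 x = x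
  act_mul : ∀ {n d} (σ τ : Equiv.Perm (Fin n)) (x : obj n d), act (σ * τ) x = act τ (act σ x)
  one_comp : ∀ {n d} (h : n + 1 = 1 + n) (hd : d = 0 + d) (y : obj n d),
    comp h hd 0 one y = y
  comp_one : ∀ {n d} (h : n + 1 = n + 1) (hd : d = d + 0) (a : Fin n) (x : obj n d),
    comp h hd a x one = x
  comp_assoc : ∀ {m n k l₁ l₂ l : ℕ} {p q t s₁ s₂ r : ℤ}
    (h₁ : l₁ + 1 = m + n) (h₂ : l + 1 = l₁ + k) (h₃ : l₂ + 1 = n + k) (h₄ : l + 1 = m + l₂)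
    (d₁ : s₁ = p + q) (d₂ : r = s₁ + t) (d₃ : s₂ = q + t) (d₄ : r = p + s₂)
    (a : Fin m) (b : Fin n) (x : obj m p) (y : obj n q) (z : obj k t),
    comp h₂ d₂ (blockIncl h₁ a b) (comp h₁ d₁ a x y) z =
      comp h₄ d₄ a x (comp h₃ d₃ b y z)
  comp_comm : ∀ {m n k l₁ l₂ l : ℕ} {p q t s₁ s₂ r : ℤ}
    (h₁ : l₁ + 1 = m + n) (h₂ : l + 1 = l₁ + k) (h₃ : l₂ + 1 = m + k) (h₄ : l + 1 = l₂ + n)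
    (d₁ : s₁ = p + q) (d₂ : r = s₁ + t) (d₃ : s₂ = p + t) (d₄ : r = s₂ + q)
    (a b : Fin m) (_ : a < b) (b' : Fin l₁) (_ : (b' : ℕ) + 1 = b + n)
    (a' : Fin l₂) (_ : (a' : ℕ) = a) (x : obj m p) (y : obj n q) (z : obj k t),
    comp h₂ d₂ b' (comp h₁ d₁ a x y) z =
      ((q * t).negOnePow : ℤ) • comp h₄ d₄ a' (comp h₃ d₃ b x z) y
  act_comp : ∀ {m n l : ℕ} (h : l + 1 = m + n) {p q r : ℤ} (hd : r = p + q) (a : Fin m)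
    (σ : Equiv.Perm (Fin m)) (τ : Equiv.Perm (Fin n)) (π : Equiv.Perm (Fin l))
    (_ : ∀ j, π (blockIncl h a j) = blockIncl h (σ a) (τ j))
    (_ : ∀ k, blockProj h (σ a) (π k) = σ (blockProj h a k)) (x : obj m p) (y : obj n q),
    comp h hd a (act σ x) (act τ y) = act π (comp h hd (σ a) x y)

namespace GradedOperad

attribute [instance] GradedOperad.addCommGroup

variable (O : GradedOperad)

/-- Families of additive maps of degree `-1`. -/
abbrev DegMap : Type := ∀ (n : ℕ) (d : ℤ), O.obj n d →+ O.obj n (d - 1)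

variable {O}

/-- `D` is a derivation of degree `-1` of the graded operad `O`. -/
structure IsDerivation (D : O.DegMap) : Prop where
  map_act : ∀ {n d} (σ : Equiv.Perm (Fin n)) (x : O.obj n d), D n d (O.act σ x) = O.act σ (D n d x)
  leibniz : ∀ {m n l : ℕ} (h : l + 1 = m + n) {p q r : ℤ} (hd : r = p + q)
    (h₁ : r - 1 = (p - 1) + q) (h₂ : r - 1 = p + (q - 1)) (a : Fin m)
    (x : O.obj m p) (y : O.obj n q),
    D l r (O.comp h hd a x y) =
      O.comp h h₁ a (D m p x) y + (p.negOnePow : ℤ) • O.comp h h₂ a x (D n q y)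

/-- `D` is a differential making the graded operad `O` a differential graded operad. -/
structure IsDifferential (D : O.DegMap) : Prop extends IsDerivation D where
  sq_zero : ∀ {n d} (x : O.obj n d), D n (d - 1) (D n d x) = 0

/-- The adjoint action of an element `A` of arity `1` and degree `-1`:
`ad_A B = A ∘₁ B - (-1)^(deg B) ∑ₐ B ∘ₐ A`. -/
def ad (A : O.obj 1 (-1)) : O.DegMap := fun n d =>
  O.comp (show n + 1 = 1 + n by omega) (show d - 1 = -1 + d by omega) 0 A -
    (d.negOnePow : ℤ) • ∑ a : Fin n, (O.comp (show n + 1 = n + 1 from rfl)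
      (show d - 1 = d + -1 by omega) a).flip A

end GradedOperad

/-! ### The operad `mQuilt` -/

namespace MQuilt

/-- Formal operadic expressions in elements of `Quilt` and a generator `m` of arity `0` and
degree `-1`. -/
inductive Pre : ℕ → ℤ → Type
  | gen {n : ℕ} {d : ℤ} (x : Quilt.Mod n d) : Pre n d
  | m : Pre 0 (-1)
  | one : Pre 1 0
  | zero {n : ℕ} {d : ℤ} : Pre n d
  | neg {n : ℕ} {d : ℤ} (x : Pre n d) : Pre n d
  | add {n : ℕ} {d : ℤ} (x y : Pre n d) : Pre n d
  | act {n : ℕ} {d : ℤ} (σ : Equiv.Perm (Fin n)) (x : Pre n d) : Pre n d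
  | comp {m n l : ℕ} (h : l + 1 = m + n) {p q r : ℤ} (hd : r = p + q) (a : Fin m)
      (x : Pre m p) (y : Pre n q) : Pre l r

namespace Pre

/-- A single quilt as a formal expression. -/
noncomputable def ofQuilt {n : ℕ} {d : ℤ} (Q : Quilt.OfDeg n d) : Pre n d :=
  gen (Finsupp.single Q 1)

/-- `(-1) ^ k` times an expression. -/
def signed {n : ℕ} {d : ℤ} (k : ℤ) (x : Pre n d) : Pre n d := if Even k then x else neg x

end Pre

open Pre

/-- The quilt with one vertex, in degree `0`. -/
def quiltOne : Quilt.OfDeg 1 0 := ⟨Quilt.one, rfl⟩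

/-- The quilt `(12, 1 → 2)`, in degree `0`. -/
def quiltTwo : Quilt.OfDeg 2 0 := ⟨Quilt.two, rfl⟩

/-- The action of a permutation on quilts of a given degree. -/
def quiltAct {n : ℕ} {d : ℤ} (σ : Equiv.Perm (Fin n)) (Q : Quilt.OfDeg n d) : Quilt.OfDeg n d :=
  ⟨Q.1.act σ, (SWord.deg_act σ _).trans Q.2⟩

/-- The congruence on formal expressions defining `mQuilt`. -/
inductive Rel : ∀ {n : ℕ} {d : ℤ}, Pre n d → Pre n d → Prop
  -- congruence
  | refl {n d} (x : Pre n d) : Rel x x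
  | symm {n d} {x y : Pre n d} : Rel x y → Rel y x
  | trans {n d} {x y z : Pre n d} : Rel x y → Rel y z → Rel x z
  | neg {n d} {x x' : Pre n d} : Rel x x' → Rel (neg x) (neg x')
  | add {n d} {x x' y y' : Pre n d} : Rel x x' → Rel y y' → Rel (add x y) (add x' y')
  | act {n d} (σ : Equiv.Perm (Fin n)) {x x' : Pre n d} : Rel x x' → Rel (act σ x) (act σ x')
  | comp {m n l : ℕ} (h : l + 1 = m + n) {p q r : ℤ} (hd : r = p + q) (a : Fin m)
      {x x' : Pre m p} {y y' : Pre n q} :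
      Rel x x' → Rel y y' → Rel (comp h hd a x y) (comp h hd a x' y')
  -- abelian groups
  | add_assoc {n d} (x y z : Pre n d) : Rel (add (add x y) z) (add x (add y z))
  | add_comm {n d} (x y : Pre n d) : Rel (add x y) (add y x)
  | zero_add {n d} (x : Pre n d) : Rel (add zero x) x
  | neg_add {n d} (x : Pre n d) : Rel (add (neg x) x) zero
  -- additivity of the operations
  | act_add {n d} (σ : Equiv.Perm (Fin n)) (x y : Pre n d) :
      Rel (act σ (add x y)) (add (act σ x) (act σ y))
  | comp_add_left {m n l : ℕ} (h : l + 1 = m + n) {p q r : ℤ} (hd : r = p + q) (a : Fin m)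
      (x x' : Pre m p) (y : Pre n q) :
      Rel (comp h hd a (add x x') y) (add (comp h hd a x y) (comp h hd a x' y))
  | comp_add_right {m n l : ℕ} (h : l + 1 = m + n) {p q r : ℤ} (hd : r = p + q) (a : Fin m)
      (x : Pre m p) (y y' : Pre n q) :
      Rel (comp h hd a x (add y y')) (add (comp h hd a x y) (comp h hd a x y'))
  -- graded operad axioms
  | act_one {n d} (x : Pre n d) : Rel (act 1 x) x
  | act_mul {n d} (σ τ : Equiv.Perm (Fin n)) (x : Pre n d) :
      Rel (act (σ * τ) x) (act τ (act σ x))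
  | one_comp {n d} (h : n + 1 = 1 + n) (hd : d = 0 + d) (y : Pre n d) : Rel (comp h hd 0 one y) y
  | comp_one {n d} (h : n + 1 = n + 1) (hd : d = d + 0) (a : Fin n) (x : Pre n d) :
      Rel (comp h hd a x one) x
  | comp_assoc {m n k l₁ l₂ l : ℕ} {p q t s₁ s₂ r : ℤ}
      (h₁ : l₁ + 1 = m + n) (h₂ : l + 1 = l₁ + k) (h₃ : l₂ + 1 = n + k) (h₄ : l + 1 = m + l₂)
      (d₁ : s₁ = p + q) (d₂ : r = s₁ + t) (d₃ : s₂ = q + t) (d₄ : r = p + s₂)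
      (a : Fin m) (b : Fin n) (x : Pre m p) (y : Pre n q) (z : Pre k t) :
      Rel (comp h₂ d₂ (blockIncl h₁ a b) (comp h₁ d₁ a x y) z)
        (comp h₄ d₄ a x (comp h₃ d₃ b y z))
  | comp_comm {m n k l₁ l₂ l : ℕ} {p q t s₁ s₂ r : ℤ}
      (h₁ : l₁ + 1 = m + n) (h₂ : l + 1 = l₁ + k) (h₃ : l₂ + 1 = m + k) (h₄ : l + 1 = l₂ + n)
      (d₁ : s₁ = p + q) (d₂ : r = s₁ + t) (d₃ : s₂ = p + t) (d₄ : r = s₂ + q)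
      (a b : Fin m) (hab : a < b) (b' : Fin l₁) (hb : (b' : ℕ) + 1 = b + n)
      (a' : Fin l₂) (ha : (a' : ℕ) = a) (x : Pre m p) (y : Pre n q) (z : Pre k t) :
      Rel (comp h₂ d₂ b' (comp h₁ d₁ a x y) z)
        (signed (q * t) (comp h₄ d₄ a' (comp h₃ d₃ b x z) y))
  | act_comp {m n l : ℕ} (h : l + 1 = m + n) {p q r : ℤ} (hd : r = p + q) (a : Fin m)
      (σ : Equiv.Perm (Fin m)) (τ : Equiv.Perm (Fin n)) (π : Equiv.Perm (Fin l))
      (hπ₁ : ∀ j, π (blockIncl h a j) = blockIncl h (σ a) (τ j))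
      (hπ₂ : ∀ k, blockProj h (σ a) (π k) = σ (blockProj h a k)) (x : Pre m p) (y : Pre n q) :
      Rel (comp h hd a (act σ x) (act τ y)) (act π (comp h hd (σ a) x y))
  -- `Quilt → mQuilt` is a morphism of graded operads
  | gen_add {n d} (x y : Quilt.Mod n d) : Rel (gen (x + y)) (add (gen x) (gen y))
  | gen_one : Rel (ofQuilt quiltOne) one
  | gen_act {n d} (σ : Equiv.Perm (Fin n)) (Q : Quilt.OfDeg n d) :
      Rel (ofQuilt (quiltAct σ Q)) (act σ (ofQuilt Q))
  | gen_comp {m n l : ℕ} (h : l + 1 = m + n) {p q r : ℤ} (hd : r = p + q) (a : Fin m)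
      (P : Quilt.OfDeg m p) (Q : Quilt.OfDeg n q) :
      Rel (gen (Quilt.partialComp h hd a P Q)) (comp h hd a (ofQuilt P) (ofQuilt Q))
  -- the relations satisfied by `m`:
  -- `(12, 1 → 2) ∘ (m, m) = 0`
  | m_assoc : Rel (comp (show 0 + 1 = 1 + 0 from rfl) (show (-2 : ℤ) = -1 + -1 from rfl) 0
      (comp (show 1 + 1 = 2 + 0 from rfl) (show (-1 : ℤ) = 0 + -1 from rfl) 1
        (ofQuilt quiltTwo) m) m) zero
  -- `Q ∘ᵤ m = 0` if `u` has more than two children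
  | m_binary {n l : ℕ} (h : l + 1 = n + 0) {d r : ℤ} (hd : r = d + -1) (Q : Quilt.OfDeg n d)
      (u : Fin n) (hu : 2 < {v | Q.1.tree.edge u v}.ncard) :
      Rel (comp h hd u (ofQuilt Q) m) zero
  -- `Q ∘ᵤ m = 0` if `u` is repeated
  | m_repeated {n l : ℕ} (h : l + 1 = n + 0) {d r : ℤ} (hd : r = d + -1) (Q : Quilt.OfDeg n d)
      (u : Fin n) (hu : Q.1.word.Repeated u) :
      Rel (comp h hd u (ofQuilt Q) m) zero
  -- `Q ∘ᵤ m = 0` if the word of `Q` is `… v u v …`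
  | m_between {n l : ℕ} (h : l + 1 = n + 0) {d r : ℤ} (hd : r = d + -1) (Q : Quilt.OfDeg n d)
      (u v : Fin n) (hu : [v, u, v] <:+: Q.1.word.letters) :
      Rel (comp h hd u (ofQuilt Q) m) zero
  -- `Q ∘ᵤ m = P ∘ᵤ m` if `P` and `Q` have the same tree and their words (of equal length) only
  -- differ in the position of `u`
  | m_move {n l : ℕ} (h : l + 1 = n + 0) {d r : ℤ} (hd : r = d + -1) (P Q : Quilt.OfDeg n d)
      (u : Fin n) (ht : Q.1.tree = P.1.tree)
      (hw : Q.1.word.letters.filter (fun v => decide (v ≠ u)) =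
        P.1.word.letters.filter (fun v => decide (v ≠ u))) :
      Rel (comp h hd u (ofQuilt Q) m) (comp h hd u (ofQuilt P) m)

/-- The congruence as a setoid. -/
def setoid (n : ℕ) (d : ℤ) : Setoid (Pre n d) := ⟨Rel, Rel.refl, Rel.symm, Rel.trans⟩

/-- The underlying sets of `mQuilt`. -/
def Obj (n : ℕ) (d : ℤ) : Type := Quotient (setoid n d)

/-- The class of a formal expression. -/
def mk {n : ℕ} {d : ℤ} (x : Pre n d) : Obj n d := Quotient.mk (setoid n d) x

theorem mk_eq {n : ℕ} {d : ℤ} {x y : Pre n d} (h : Rel x y) : mk x = mk y :=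
  Quotient.sound (s := setoid n d) h

instance (n : ℕ) (d : ℤ) : Zero (Obj n d) := ⟨mk Pre.zero⟩

instance (n : ℕ) (d : ℤ) : Add (Obj n d) :=
  ⟨Quotient.map₂ Pre.add fun _ _ h₁ _ _ h₂ => Rel.add h₁ h₂⟩

instance (n : ℕ) (d : ℤ) : Neg (Obj n d) := ⟨Quotient.map Pre.neg fun _ _ h => Rel.neg h⟩

instance (n : ℕ) (d : ℤ) : AddCommGroup (Obj n d) where
  nsmul := nsmulRec
  zsmul := zsmulRec
  add_assoc := by rintro ⟨x⟩ ⟨y⟩ ⟨z⟩; exact mk_eq (Rel.add_assoc x y z)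
  zero_add := by rintro ⟨x⟩; exact mk_eq (Rel.zero_add x)
  add_zero := by
    rintro ⟨x⟩; exact mk_eq ((Rel.add_comm x Pre.zero).trans (Rel.zero_add x))
  neg_add_cancel := by rintro ⟨x⟩; exact mk_eq (Rel.neg_add x)
  add_comm := by rintro ⟨x⟩ ⟨y⟩; exact mk_eq (Rel.add_comm x y)

/-- The symmetric group action on `mQuilt`. -/
def actHom {n : ℕ} {d : ℤ} (σ : Equiv.Perm (Fin n)) : Obj n d →+ Obj n d :=
  AddMonoidHom.mk' (Quotient.map (Pre.act σ) fun _ _ h => Rel.act σ h)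
    (by rintro ⟨x⟩ ⟨y⟩; exact mk_eq (Rel.act_add σ x y))

/-- The partial compositions of `mQuilt`. -/
def compHom {m n l : ℕ} (h : l + 1 = m + n) {p q r : ℤ} (hd : r = p + q) (a : Fin m) :
    Obj m p →+ Obj n q →+ Obj l r :=
  AddMonoidHom.mk' (fun x => AddMonoidHom.mk'
      (fun y => Quotient.map₂ (Pre.comp h hd a) (fun _ _ h₁ _ _ h₂ => Rel.comp h hd a h₁ h₂) x y)
      (by
        obtain ⟨x⟩ := x
        rintro ⟨y⟩ ⟨y'⟩
        exact mk_eq (Rel.comp_add_right h hd a x y y')))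
    (by
      rintro ⟨x⟩ ⟨x'⟩
      refine AddMonoidHom.ext ?_
      rintro ⟨y⟩
      exact mk_eq (Rel.comp_add_left h hd a x x' y))

theorem mk_signed {n : ℕ} {d : ℤ} (k : ℤ) (x : Pre n d) :
    mk (Pre.signed k x) = (k.negOnePow : ℤ) • mk x := by
  unfold Pre.signed
  split_ifs with hk
  · rw [Int.negOnePow_even k hk]; simp
  · rw [Int.negOnePow_odd k (Int.not_even_iff_odd.1 hk)]
    simp only [Units.val_neg, Units.val_one, neg_smul, one_smul]
    rfl

end MQuilt

open MQuilt in
/-- The graded operad `mQuilt`, generated by `Quilt` and the generator `m`, subject to the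
relations. -/
def mQuilt : GradedOperad where
  obj := Obj
  one := mk Pre.one
  act := actHom
  comp := compHom
  act_one := by rintro n d ⟨x⟩; exact mk_eq (Rel.act_one x)
  act_mul := by rintro n d σ τ ⟨x⟩; exact mk_eq (Rel.act_mul σ τ x)
  one_comp := by rintro n d h hd ⟨y⟩; exact mk_eq (Rel.one_comp h hd y)
  comp_one := by rintro n d h hd a ⟨x⟩; exact mk_eq (Rel.comp_one h hd a x)
  comp_assoc := by
    rintro m n k l₁ l₂ l p q t s₁ s₂ r h₁ h₂ h₃ h₄ d₁ d₂ d₃ d₄ a b ⟨x⟩ ⟨y⟩ ⟨z⟩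
    exact mk_eq (Rel.comp_assoc h₁ h₂ h₃ h₄ d₁ d₂ d₃ d₄ a b x y z)
  comp_comm := by
    rintro m n k l₁ l₂ l p q t s₁ s₂ r h₁ h₂ h₃ h₄ d₁ d₂ d₃ d₄ a b hab b' hb a' ha ⟨x⟩ ⟨y⟩ ⟨z⟩
    exact (mk_eq (Rel.comp_comm h₁ h₂ h₃ h₄ d₁ d₂ d₃ d₄ a b hab b' hb a' ha x y z)).trans
      (mk_signed _ _)
  act_comp := by
    rintro m n l h p q r hd a σ τ π h₁ h₂ ⟨x⟩ ⟨y⟩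
    exact mk_eq (Rel.act_comp h hd a σ τ π h₁ h₂ x y)

namespace MQuilt

/-- The map `Quilt → mQuilt`. -/
noncomputable def ι {n : ℕ} {d : ℤ} : Quilt.Mod n d →+ mQuilt.obj n d :=
  AddMonoidHom.mk' (fun x => mk (Pre.gen x)) fun x y => mk_eq (Rel.gen_add x y)

/-- The generator `m` of `mQuilt`. -/
def gm : mQuilt.obj 0 (-1) := mk Pre.m

/-- `Δ = (1 → 2) ∘₁ m - (1 → 2) ∘₂ m`. -/
noncomputable def Δ : mQuilt.obj 1 (-1) :=
  mQuilt.comp (show 1 + 1 = 2 + 0 from rfl) (show (-1 : ℤ) = 0 + -1 from rfl) 0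
      (ι (Finsupp.single quiltTwo 1)) gm -
    mQuilt.comp (show 1 + 1 = 2 + 0 from rfl) (show (-1 : ℤ) = 0 + -1 from rfl) 1
      (ι (Finsupp.single quiltTwo 1)) gm

/-- `D` is the extension to `mQuilt` of the boundary operator of `Quilt` with `D m = 0`: a
derivation with the given values on the generators. -/
structure IsBoundary (D : mQuilt.DegMap) : Prop extends GradedOperad.IsDerivation D where
  map_quilt : ∀ {n : ℕ} {d : ℤ} (Q : Quilt.OfDeg n d),
    D n d (ι (Finsupp.single Q 1)) = ι (Quilt.boundary Q)
  map_m : D 0 (-1) gm = 0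

end MQuilt

/-!
An element of `mQuilt` is represented by a formal expression in the quilts and `m`, and the Leibniz
rule, together with `∂ m = 0`, determines the boundary of an expression (`MQuilt.preBoundary`).
Uniqueness is therefore an induction on expressions (`MQuilt.IsBoundary.unique`), and existence
means that every relation between expressions is respected (`MQuilt.preBoundary_eq`).  The operad
axioms are respected by any derivation (`GradedOperad.leib_assoc`, `GradedOperad.leib_comm`,
`GradedOperad.leib_act`); there remain the composition of quilts and the relations of `m`.

*Composition of quilts.*  A word of length `p` is treated as a function on the positions
`0, …, p - 1`.  The extensions of `V` by `W` at `a` are the words read along staircase paths through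
the grid of positions of `V` and `W`: a path takes every column in turn and goes up only in columns
with letter `a`; a point contributes a letter of `W` in such columns, and a letter of `V` in all
other ones (`FunWord.exists_path_of_isExt`, `FunWord.isExt_of_path`, `FunWord.path_injective`).  The
sign of an extension counts the pairs of a caesura of `V` and a caesura of `W` that the path meets
in inverted order (`FunWord.extSign_eq`).  A face of the word along a path deletes a point of a
repeated letter.  If that point is a full column or a full row of the path, deleting it gives a path
for a face of `V` or of `W`, and every such path arises once.  Any other point is the top of a
column of a caesura `a` or the bottom of the column of a later occurrence of `a`; shortening one of
two consecutive columns `a` and lengthening the other exchanges these two kinds of points, keeps the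
resulting word and changes the sign.  This gives `FunWord.sum_faceTerm`, and hence that the boundary
of `Quilt` is a derivation (`FunWord.bd_partialComp`).

*Relations of `m`.*  Substituting `m` for `u` forgets the position of `u` in the word.  If `u` is
repeated, or enclosed as in `… v u v …`, then the faces of the word vanish under this substitution,
except for at most two of them, which become equal and have opposite signs
(`MQuilt.boundaryComp_repeated`, `MQuilt.boundaryComp_between`).  If `u` occurs once, deleting `u`
does not change the numbers attached to the other letters, so that the boundary depends only on the
word without `u` (`MQuilt.boundaryComp_move`).

*The differential.*  The boundary has square zero, because deleting two letters in either order
gives opposite signs (`FunWord.fnum_add_fnum`, `FunWord.bd_boundary`).  In any graded operad, if a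
derivation `D` of degree `-1` and an element `A` of arity `1` and degree `-1` satisfy `D² = 0`,
`D A = 0` and `A ∘ A = 0`, then `D + ad A` is a differential
(`GradedOperad.IsDerivation.isDifferential_add_ad`).  Here `∂ Δ = 0` since the word `12` has no
repeated letters.  For `Δ ∘ Δ = 0`, the composites `(1 → 2) ∘₁ (1 → 2)` and `(1 → 2) ∘₂ (1 → 2)` are
sums of trees with word `123`.  The second sum consists of the chain `1 → 2 → 3`; the first one
contains moreover the two trees with root `1` and children `2`, `3`, which are exchanged by a
transposition.  As `m` may be moved freely in the word, inserting `m` in one leaf or in the other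
gives the same sum over these two trees, and inserting it in both leaves gives `0` because `m` is
odd.  Together with `(1 → 2) ∘ (m, m) = 0`, this makes the four terms of `Δ ∘ Δ` cancel
(`MQuilt.Δ_comp_Δ`).
-/

/-! ### Caesurae and faces of words given as functions -/

namespace FunWord

/-- The increasing injection `ℕ → ℕ` that misses `j`; deleting the letter at position `j` from a
word `V : ℕ → α` gives `V ∘ skip j`. -/
def skip (j k : ℕ) : ℕ := if k < j then k else k + 1

theorem skip_ne (j k : ℕ) : skip j k ≠ j := by unfold skip; split_ifs <;> omega

theorem skip_lt {p j k : ℕ} (hk : k < p - 1) : skip j k < p := by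
  unfold skip; split_ifs <;> omega

theorem skip_lt_skip {j k l : ℕ} : skip j k < skip j l ↔ k < l := by
  unfold skip; split_ifs <;> omega

theorem exists_skip {p j x : ℕ} (hj : j < p) (hx : x < p) (h : x ≠ j) :
    ∃ k, k < p - 1 ∧ skip j k = x := by
  by_cases hxj : x < j
  · exact ⟨x, by omega, by unfold skip; rw [if_pos hxj]⟩
  · exact ⟨x - 1, by omega, by unfold skip; rw [if_neg (by omega)]; omega⟩

/-- Deleting two letters in either order: the letter at position `k` after the deletion of position
`i ≤ k` is originally at position `k + 1`. -/
theorem skip_skip {i k : ℕ} (h : i ≤ k) (x : ℕ) :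
    skip i (skip k x) = skip (k + 1) (skip i x) := by
  unfold skip; split_ifs <;> omega

variable {α : Type*}

/-- Position `x` of the word `V 0, …, V (p - 1)` is a caesura. -/
def Caes (p : ℕ) (V : ℕ → α) (x : ℕ) : Prop := ∃ y, x < y ∧ y < p ∧ V y = V x

/-- The letter at position `x` occurs more than once in the word `V 0, …, V (p - 1)`. -/
def Rep (p : ℕ) (V : ℕ → α) (x : ℕ) : Prop := ∃ y, y ≠ x ∧ y < p ∧ V y = V x

open Classical in
/-- The number of caesurae at positions `< x`. -/
noncomputable def cnum (p : ℕ) (V : ℕ → α) (x : ℕ) : ℕ := Nat.count (Caes p V) x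

open Classical in
/-- The position of the previous occurrence of the letter at position `x`; it is `0` for a first
occurrence, where it has no meaning. -/
noncomputable def prv (V : ℕ → α) (x : ℕ) : ℕ :=
  ((Finset.range x).filter fun y => V y = V x).sup id

open Classical in
/-- The caesura that disappears when the letter at position `x` is deleted: `x` itself if it is a
caesura, and the previous occurrence if `x` is a last occurrence. -/
noncomputable def mark (p : ℕ) (V : ℕ → α) (x : ℕ) : ℕ := if Caes p V x then x else prv V x

open Classical in
/-- The number attached to the position `x` of a repeated letter in the definition of the faces. -/
noncomputable def fnum (p : ℕ) (V : ℕ → α) (x : ℕ) : ℕ :=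
  cnum p V (mark p V x + 1) + if Caes p V x then 0 else 1

variable {p : ℕ} {V : ℕ → α} {x y : ℕ}

theorem Caes.rep (h : Caes p V x) : Rep p V x := by
  obtain ⟨y, h1, h2, h3⟩ := h
  exact ⟨y, by omega, h2, h3⟩

theorem Caes.lt (h : Caes p V x) : x + 1 < p := by
  obtain ⟨y, h1, h2, h3⟩ := h; omega

theorem cnum_zero : cnum p V 0 = 0 := by simp [cnum]

open Classical in
theorem cnum_succ : cnum p V (x + 1) = cnum p V x + if Caes p V x then 1 else 0 := by
  unfold cnum; rw [Nat.count_succ]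

theorem cnum_succ_of (h : Caes p V x) : cnum p V (x + 1) = cnum p V x + 1 := by
  rw [cnum_succ, if_pos h]

theorem cnum_succ_of_not (h : ¬ Caes p V x) : cnum p V (x + 1) = cnum p V x := by
  rw [cnum_succ, if_neg h]; rfl

theorem cnum_mono : Monotone (cnum p V) := by
  classical
  intro a b h; unfold cnum; exact Nat.count_monotone _ h

theorem prv_eq (h1 : y < x) (h2 : V y = V x) (h3 : ∀ z, y < z → z < x → V z ≠ V x) :
    prv V x = y := by
  unfold prv
  apply le_antisymm
  · apply Finset.sup_le
    intro z hz
    simp only [Finset.mem_filter, Finset.mem_range] at hz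
    by_contra hc
    exact h3 z (by simpa using hc) hz.1 hz.2
  · exact Finset.le_sup (f := id) (by simp [h1, h2])

theorem exists_prev (h : ∃ y, y < x ∧ V y = V x) :
    ∃ y, y < x ∧ V y = V x ∧ ∀ z, y < z → z < x → V z ≠ V x := by
  classical
  obtain ⟨y, h1, h2⟩ := h
  have hne : ((Finset.range x).filter fun y => V y = V x).Nonempty := ⟨y, by simp [h1, h2]⟩
  obtain ⟨w, hw, hmax⟩ := Finset.exists_max_image _ id hne
  simp only [Finset.mem_filter, Finset.mem_range, id] at hw hmax
  refine ⟨w, hw.1, hw.2, fun z hz hzx he => ?_⟩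
  have := hmax z ⟨hzx, he⟩
  omega

theorem mark_of_caes (h : Caes p V x) : mark p V x = x := by unfold mark; rw [if_pos h]

theorem mark_eq (h : ¬ Caes p V x) (h1 : y < x) (h2 : V y = V x)
    (h3 : ∀ z, y < z → z < x → V z ≠ V x) : mark p V x = y := by
  unfold mark; rw [if_neg h]; exact prv_eq h1 h2 h3

theorem mark_spec (hr : Rep p V x) (h : ¬ Caes p V x) :
    mark p V x < x ∧ V (mark p V x) = V x ∧ ∀ z, mark p V x < z → z < p → z ≠ x → V z ≠ V x := by
  obtain ⟨y, h1, h2, h3⟩ := hr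
  have hlast : ∀ z, x < z → z < p → V z ≠ V x := fun z hz hzp he => h ⟨z, hz, hzp, he⟩
  have hyx : y < x := by
    rcases lt_or_gt_of_ne h1 with h' | h'
    · exact h'
    · exact absurd h3 (hlast y h' h2)
  obtain ⟨w, hw1, hw2, hw3⟩ := exists_prev ⟨y, hyx, h3⟩
  rw [mark_eq h hw1 hw2 hw3]
  refine ⟨hw1, hw2, fun z hz hzp hzx => ?_⟩
  rcases lt_or_gt_of_ne hzx with h' | h'
  · exact hw3 z hz h'
  · exact hlast z h' hzp

theorem caes_mark (hr : Rep p V x) (hx : x < p) : Caes p V (mark p V x) := by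
  by_cases h : Caes p V x
  · rwa [mark_of_caes h]
  · obtain ⟨h1, h2, -⟩ := mark_spec hr h
    exact ⟨x, h1, hx, h2.symm⟩

theorem mark_le (hr : Rep p V x) : mark p V x ≤ x := by
  by_cases h : Caes p V x
  · rw [mark_of_caes h]
  · exact (mark_spec hr h).1.le

theorem letter_mark (hr : Rep p V x) : V (mark p V x) = V x := by
  by_cases h : Caes p V x
  · rw [mark_of_caes h]
  · exact (mark_spec hr h).2.1

open Classical in
theorem fnum_eq (hr : Rep p V x) (hx : x < p) :
    fnum p V x = cnum p V (mark p V x) + 1 + if Caes p V x then 0 else 1 := by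
  unfold fnum; rw [cnum_succ_of (caes_mark hr hx)]

theorem fnum_of_caes (h : Caes p V x) : fnum p V x = cnum p V x + 1 := by
  unfold fnum; rw [mark_of_caes h, if_pos h, cnum_succ_of h]

theorem fnum_of_not_caes (hx : x < p) (h : ¬ Caes p V x) (h1 : y < x) (h2 : V y = V x)
    (h3 : ∀ z, y < z → z < x → V z ≠ V x) : fnum p V x = cnum p V y + 2 := by
  rw [fnum_eq ⟨y, by omega, by omega, h2⟩ hx, mark_eq h h1 h2 h3, if_neg h]

theorem rep_skip {j k : ℕ} (hj : j < p) :
    Rep (p - 1) (V ∘ skip j) k ↔ ∃ z, z ≠ j ∧ z ≠ skip j k ∧ z < p ∧ V z = V (skip j k) := by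
  constructor
  · rintro ⟨y, h1, h2, h3⟩
    refine ⟨skip j y, skip_ne _ _, ?_, skip_lt h2, h3⟩
    intro e
    apply h1
    have h4 := skip_lt_skip (j := j) (k := k) (l := y)
    have h5 := skip_lt_skip (j := j) (k := y) (l := k)
    omega
  · rintro ⟨z, h1, h2, h3, h4⟩
    obtain ⟨y, hy, rfl⟩ := exists_skip hj h3 h1
    exact ⟨y, fun e => h2 (by rw [e]), hy, h4⟩

/-- Deleting the letter at position `j` removes exactly the caesura `mark j`. -/
theorem caes_skip {j k : ℕ} (hj : j < p) (hr : Rep p V j) :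
    Caes (p - 1) (V ∘ skip j) k ↔ Caes p V (skip j k) ∧ skip j k ≠ mark p V j := by
  constructor
  · rintro ⟨y, h1, h2, h3⟩
    have h1' := skip_lt_skip (j := j).2 h1
    refine ⟨⟨skip j y, h1', skip_lt h2, h3⟩, fun e => ?_⟩
    by_cases hc : Caes p V j
    · rw [mark_of_caes hc] at e
      exact skip_ne _ _ e
    · refine (mark_spec hr hc).2.2 (skip j y) (e ▸ h1') (skip_lt h2) (skip_ne _ _) ?_
      rw [← letter_mark hr, ← e]; exact h3
  · rintro ⟨⟨y, h1, h2, h3⟩, h4⟩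
    have key : ∃ y, skip j k < y ∧ y < p ∧ y ≠ j ∧ V y = V (skip j k) := by
      by_cases hy : y = j
      · subst hy
        by_cases hc : Caes p V y
        · obtain ⟨z, hz1, hz2, hz3⟩ := hc
          exact ⟨z, by omega, hz2, by omega, hz3.trans h3⟩
        · obtain ⟨m1, m2, m3⟩ := mark_spec hr hc
          refine ⟨mark p V y, ?_, by omega, by omega, m2.trans h3⟩
          by_contra hcon
          exact m3 (skip y k) (by omega) (by omega) (skip_ne _ _) h3.symm
      · exact ⟨y, h1, h2, hy, h3⟩
    obtain ⟨y, h1, h2, h3, h4⟩ := key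
    obtain ⟨z, hz, rfl⟩ := exists_skip hj h2 h3
    exact ⟨z, skip_lt_skip.1 h1, hz, h4⟩

open Classical in
theorem cnum_skip_of_le {j : ℕ} (hj : j < p) (hr : Rep p V j) {k : ℕ} (hk : k ≤ j) :
    cnum (p - 1) (V ∘ skip j) k + (if mark p V j < k then 1 else 0) = cnum p V k := by
  induction k with
  | zero => simp [cnum_zero]
  | succ k ih =>
    have hs : skip j k = k := by unfold skip; rw [if_pos (by omega)]
    have ih := ih (by omega)
    have hc := caes_skip (k := k) hj hr
    rw [hs] at hc
    have hm := caes_mark hr hj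
    rw [cnum_succ, cnum_succ, ← ih]
    by_cases e : k = mark p V j
    · have : ¬ Caes (p - 1) (V ∘ skip j) k := fun h => (hc.1 h).2 e
      rw [if_neg this, if_pos (by omega : mark p V j < k + 1), if_neg (by omega), if_pos (e ▸ hm)]
    · have : Caes (p - 1) (V ∘ skip j) k ↔ Caes p V k := by rw [hc]; simp [e]
      have h2 : mark p V j < k + 1 ↔ mark p V j < k := by omega
      simp only [this, h2]; omega

theorem cnum_skip_of_ge {j : ℕ} (hj : j < p) (hr : Rep p V j) {k : ℕ} (hk : j ≤ k) :
    cnum (p - 1) (V ∘ skip j) k + 1 = cnum p V (k + 1) := by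
  classical
  induction k, hk using Nat.le_induction with
  | base =>
    have := cnum_skip_of_le hj hr (le_refl j)
    rw [cnum_succ, ← this]
    by_cases hc : Caes p V j
    · rw [mark_of_caes hc]; simp [hc]
    · have := (mark_spec hr hc).1
      simp [hc, this]
  | succ k hk ih =>
    have hs : skip j k = k + 1 := by unfold skip; rw [if_neg (by omega)]
    have hc := caes_skip (k := k) hj hr
    have hm := mark_le hr
    rw [hs] at hc
    have : Caes (p - 1) (V ∘ skip j) k ↔ Caes p V (k + 1) := by
      rw [hc]; exact ⟨fun h => h.1, fun h => ⟨h, by omega⟩⟩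
    rw [cnum_succ, cnum_succ (x := k + 1), ← ih]
    simp only [this]; omega

open Classical in
theorem cnum_skip {j : ℕ} (hj : j < p) (hr : Rep p V j) (k : ℕ) :
    cnum (p - 1) (V ∘ skip j) k + (if mark p V j < skip j k then 1 else 0) =
      cnum p V (skip j k) := by
  by_cases hk : k < j
  · have := cnum_skip_of_le hj hr hk.le
    unfold skip; simp only [if_pos hk]; exact this
  · have := cnum_skip_of_ge hj hr (Nat.le_of_not_lt hk)
    have hm := mark_le hr
    have hs : skip j k = k + 1 := if_neg hk
    rw [hs, if_pos (by omega)]; exact this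

/-- The caesura removed from `V ∘ skip j` on deleting position `k`, as a position of `V`: the
previous occurrence is looked for among the positions other than `j`. -/
theorem exists_skip_mark {j k : ℕ} (hk : k < p - 1) (hr' : Rep (p - 1) (V ∘ skip j) k) {w : ℕ}
    (hw : Caes (p - 1) (V ∘ skip j) k ∧ w = skip j k ∨
      ¬ Caes (p - 1) (V ∘ skip j) k ∧ w ≠ j ∧ w < skip j k ∧ V w = V (skip j k) ∧
        ∀ z, w < z → z < skip j k → z ≠ j → V z ≠ V (skip j k)) :
    w = skip j (mark (p - 1) (V ∘ skip j) k) := by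
  rcases hw with ⟨h, rfl⟩ | ⟨h, h0, h1, h2, h3⟩
  · rw [mark_of_caes h]
  · have hp := skip_lt (j := j) hk
    obtain ⟨m1, m2, m3⟩ := mark_spec hr' h
    set M := mark (p - 1) (V ∘ skip j) k
    have m1' := skip_lt_skip (j := j).2 m1
    by_contra hne
    rcases lt_or_gt_of_ne hne with hlt | hgt
    · exact h3 _ hlt m1' (skip_ne _ _) m2
    · have : ∃ u, skip j u = w := by
        by_cases hwj : w < j
        · exact ⟨w, by unfold skip; rw [if_pos hwj]⟩
        · exact ⟨w - 1, by unfold skip; rw [if_neg (by omega)]; omega⟩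
      obtain ⟨u, rfl⟩ := this
      rw [skip_lt_skip] at hgt h1
      exact m3 u hgt (by omega) (by omega) h2

/-- Deleting two letters in either order: the signs are opposite. This is the reason why the
boundary has square zero. -/
theorem fnum_add_fnum {x k : ℕ} (hxk : x ≤ k) (hk : k < p - 1) (hr : Rep p V x)
    (hr' : Rep (p - 1) (V ∘ skip x) k) :
    Rep p V (k + 1) ∧ Rep (p - 1) (V ∘ skip (k + 1)) x ∧
      Odd (fnum p V x + fnum (p - 1) (V ∘ skip x) k +
        (fnum p V (k + 1) + fnum (p - 1) (V ∘ skip (k + 1)) x)) := by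
  classical
  have hsk : skip x k = k + 1 := if_neg (by omega)
  have hsx : skip (k + 1) x = x := if_pos (by omega)
  have hx : x < p := by omega
  have hy : k + 1 < p := by omega
  obtain ⟨z, z1, z2, z3, z4⟩ := (rep_skip hx).1 hr'
  rw [hsk] at z2 z4
  have hry : Rep p V (k + 1) := ⟨z, z2, z3, z4⟩
  have hrx : Rep (p - 1) (V ∘ skip (k + 1)) x := by
    rw [rep_skip hy, hsx]
    by_cases he : V x = V (k + 1)
    · exact ⟨z, z2, z1, z3, z4.trans he.symm⟩
    · obtain ⟨w, w1, w2, w3⟩ := hr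
      exact ⟨w, fun e => he (by rw [← w3, e]), w1, w2, w3⟩
  refine ⟨hry, hrx, ?_⟩
  have c1 := caes_skip (k := k) hx hr
  have c2 := caes_skip (k := x) hy hry
  rw [hsk] at c1
  rw [hsx] at c2
  rw [fnum_eq hr hx, fnum_eq hry hy, fnum_eq hr' hk, fnum_eq hrx (by omega)]
  have n1 := cnum_skip hx hr (mark (p - 1) (V ∘ skip x) k)
  have n2 := cnum_skip hy hry (mark (p - 1) (V ∘ skip (k + 1)) x)
  have e1 := fun w => exists_skip_mark (j := x) (V := V) hk hr' (w := w)
  have e2 := fun w => exists_skip_mark (j := k + 1) (V := V) (by omega) hrx (w := w)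
  rw [hsk] at e1
  rw [hsx] at e2
  have ml1 := mark_le hr
  have ml2 := mark_le hry
  have hcm2 := letter_mark hry
  by_cases he : V x = V (k + 1)
  · have hcx : Caes p V x := ⟨k + 1, by omega, hy, he.symm⟩
    have hmx := mark_of_caes hcx
    by_cases hcy : Caes p V (k + 1)
    · have hmy := mark_of_caes hcy
      have hc1 : Caes (p - 1) (V ∘ skip x) k := c1.2 ⟨hcy, by omega⟩
      have hc2 : Caes (p - 1) (V ∘ skip (k + 1)) x := c2.2 ⟨hcx, by omega⟩
      have E1 := e1 _ (Or.inl ⟨hc1, rfl⟩)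
      have E2 := e2 _ (Or.inl ⟨hc2, rfl⟩)
      rw [← E1, hmx, if_pos (by omega)] at n1
      rw [← E2, hmy, if_neg (by omega)] at n2
      rw [if_pos hcx, if_pos hcy, if_pos hc1, if_pos hc2, hmx, hmy, ← n1, ← n2]
      grind
    · have hc1 : ¬ Caes (p - 1) (V ∘ skip x) k := fun h => hcy (c1.1 h).1
      obtain ⟨m1, m2, m3⟩ := mark_spec hry hcy
      have hxm : x ≤ mark p V (k + 1) := by
        by_contra hlt
        exact m3 x (by omega) hx (by omega) he
      by_cases hm : mark p V (k + 1) = x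
      · have hc2 : ¬ Caes (p - 1) (V ∘ skip (k + 1)) x := fun h => (c2.1 h).2 hm.symm
        have hzx : z < x := by
          by_contra hlt
          exact m3 z (by omega) z3 z2 z4
        obtain ⟨w, w1, w2, w3⟩ := exists_prev (x := x) (V := V) ⟨z, hzx, z4.trans he.symm⟩
        have E1 := e1 w (Or.inr ⟨hc1, by omega, by omega, w2.trans he, fun u hu1 hu2 hu3 => by
          rcases lt_or_gt_of_ne hu3 with h | h
          · rw [← he]; exact w3 u hu1 h
          · exact m3 u (by omega) (by omega) (by omega)⟩)
        have E2 := e2 w (Or.inr ⟨hc2, by omega, w1, w2, fun u hu1 hu2 _ => w3 u hu1 hu2⟩)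
        rw [← E1, hmx, if_neg (by omega)] at n1
        rw [← E2, hm, if_neg (by omega)] at n2
        rw [if_pos hcx, if_neg hcy, if_neg hc1, if_neg hc2, hmx, hm]
        have : cnum (p - 1) (V ∘ skip (k + 1)) (mark (p - 1) (V ∘ skip (k + 1)) x) =
          cnum (p - 1) (V ∘ skip x) (mark (p - 1) (V ∘ skip x) k) := by omega
        rw [this]
        grind
      · have hc2 : Caes (p - 1) (V ∘ skip (k + 1)) x := c2.2 ⟨hcx, fun h => hm h.symm⟩
        have E1 := e1 (mark p V (k + 1)) (Or.inr ⟨hc1, hm, m1, m2, fun u hu1 hu2 hu3 =>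
          m3 u hu1 (by omega) (by omega)⟩)
        have E2 := e2 _ (Or.inl ⟨hc2, rfl⟩)
        rw [← E1, hmx, if_pos (by omega)] at n1
        rw [← E2, if_neg (by omega)] at n2
        rw [if_pos hcx, if_neg hcy, if_neg hc1, if_pos hc2, hmx, ← n1, ← n2]
        grind
  · have hmx : V (mark p V x) = V x := letter_mark hr
    have hne : mark p V x ≠ mark p V (k + 1) := fun e => he (by rw [← hmx, e, hcm2])
    have hc1 : Caes (p - 1) (V ∘ skip x) k ↔ Caes p V (k + 1) := by
      rw [c1]; exact ⟨fun h => h.1, fun h => ⟨h, fun e => he (by rw [← hmx, ← e])⟩⟩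
    have hc2 : Caes (p - 1) (V ∘ skip (k + 1)) x ↔ Caes p V x := by
      rw [c2]; exact ⟨fun h => h.1, fun h => ⟨h, fun e => he (by rw [← hcm2, ← e])⟩⟩
    have E1 := e1 (mark p V (k + 1)) (by
      by_cases h : Caes p V (k + 1)
      · exact Or.inl ⟨hc1.2 h, mark_of_caes h⟩
      · obtain ⟨m1, m2, m3⟩ := mark_spec hry h
        exact Or.inr ⟨fun h' => h (hc1.1 h'), fun e => he (by rw [← m2, e]), m1, m2,
          fun u hu1 hu2 _ => m3 u hu1 (by omega) (by omega)⟩)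
    have E2 := e2 (mark p V x) (by
      by_cases h : Caes p V x
      · exact Or.inl ⟨hc2.2 h, mark_of_caes h⟩
      · obtain ⟨m1, m2, m3⟩ := mark_spec hr h
        exact Or.inr ⟨fun h' => h (hc2.1 h'), fun e => by omega, m1, m2,
          fun u hu1 hu2 _ => m3 u hu1 (by omega) (by omega)⟩)
    rw [← E1] at n1
    rw [← E2] at n2
    simp only [hc1, hc2]
    rw [← n1, ← n2]
    rcases lt_or_gt_of_ne hne with h | h
    · rw [if_pos h, if_neg (by omega)]; grind
    · rw [if_pos h, if_neg h.not_gt]; grind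

end FunWord

/-! ### Staircase paths -/

namespace FunWord

variable {α β : Type*}

/-- A staircase path through the grid of positions of a word `V` of length `p` and a word of length
`q`, going up only in the columns `x` with `V x = a`: the value `H x` is the height at which the
path enters column `x`, so that the path consists of the points `(x, y)` with `x < p` and
`H x ≤ y ≤ H (x + 1)`.  Beyond the last column, `H` has the constant value `q - 1`. -/
structure IsPath (a : α) (p q : ℕ) (V : ℕ → α) (H : ℕ → ℕ) : Prop where
  zero : H 0 = 0
  mono : Monotone H
  const : ∀ x, x < p → V x ≠ a → H (x + 1) = H x
  last : ∀ x, p ≤ x → H x = q - 1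

/-- The point `(x, y)` lies on the path. -/
structure IsPt (p : ℕ) (H : ℕ → ℕ) (x y : ℕ) : Prop where
  lt : x < p
  ge : H x ≤ y
  le : y ≤ H (x + 1)

/-- The column of the `k`-th point of the path. -/
def col (p : ℕ) (H : ℕ → ℕ) (k : ℕ) : ℕ := Nat.findGreatest (fun x => x + H x ≤ k) (p - 1)

open Classical in
/-- The letter at the point `(x, y)`: it comes from `W` if the letter of `V` is `a`, and from `V`
otherwise. -/
noncomputable def letter (a : α) (V : ℕ → α) (W : ℕ → β) (x y : ℕ) : α ⊕ β :=
  if V x = a then Sum.inr (W y) else Sum.inl (V x)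

/-- The word read along a path. -/
noncomputable def pword (a : α) (p : ℕ) (V : ℕ → α) (W : ℕ → β) (H : ℕ → ℕ) (k : ℕ) : α ⊕ β :=
  letter a V W (col p H k) (k - col p H k)

open Classical in
/-- The number of inversions of a path: of pairs of a caesura of `V` and a caesura of `W` such that
the path leaves the row of the latter before it leaves the column of the former. -/
noncomputable def inv (p q : ℕ) (V : ℕ → α) (W : ℕ → β) (H : ℕ → ℕ) : ℕ :=
  ∑ x ∈ Finset.range p, if Caes p V x then cnum q W (H (x + 1)) else 0

variable {a : α} {p q : ℕ} {V : ℕ → α} {W : ℕ → β} {H : ℕ → ℕ} {x y x' y' : ℕ}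

theorem letter_of_eq (h : V x = a) : letter a V W x y = Sum.inr (W y) := if_pos h

theorem letter_of_ne (h : V x ≠ a) : letter a V W x y = Sum.inl (V x) := if_neg h

theorem letter_eq_iff {W' : ℕ → β} : letter a V W x y = letter a V W' x' y' ↔
    V x = V x' ∧ (V x = a → W y = W' y') := by
  unfold letter
  split_ifs with h1 h2 h2
  · simp [h1, h2]
  · simp only [false_iff]; rintro ⟨e, -⟩; exact h2 (e ▸ h1)
  · simp only [false_iff]; rintro ⟨e, -⟩; exact h1 (e ▸ h2)
  · simp [h1]

theorem exists_next (h : ∃ y, x < y ∧ y < p ∧ V y = a) :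
    ∃ y, x < y ∧ y < p ∧ V y = a ∧ ∀ z, x < z → z < y → V z ≠ a := by
  classical
  refine ⟨Nat.find h, (Nat.find_spec h).1, (Nat.find_spec h).2.1, (Nat.find_spec h).2.2,
    fun z h1 h2 h3 => Nat.find_min h h2 ⟨h1, ?_, h3⟩⟩
  have := (Nat.find_spec h).2.1
  omega

namespace IsPath

variable (hH : IsPath a p q V H)
include hH

theorem le_last (x : ℕ) : H x ≤ q - 1 := by
  rcases le_total p x with h | h
  · exact (hH.last x h).le
  · exact (hH.mono h).trans (hH.last p le_rfl).le

/-- A path is horizontal between two columns with letter `a`. -/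
theorem const_of (hx : x ≤ y) (hy : y ≤ p) (h : ∀ z, x ≤ z → z < y → V z ≠ a) : H y = H x := by
  induction y, hx using Nat.le_induction with
  | base => rfl
  | succ y hy' ih =>
    rw [hH.const y (by omega) (h y hy' (by omega))]
    exact ih (by omega) fun z h1 h2 => h z h1 (by omega)

theorem eq_of_lt (hx : x < p) (h : H x < H (x + 1)) : V x = a := by
  by_contra hne
  have := hH.const x hx hne
  omega

/-- A path runs upwards and to the right, so that the points are ordered by `x + y`. -/
theorem pt_order (h : IsPt p H x y) (h' : IsPt p H x' y') (hlt : x + y < x' + y') :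
    x ≤ x' ∧ y ≤ y' ∧ (x = x' → y < y') := by
  have hx : x ≤ x' := by
    by_contra hc
    have h1 : H (x' + 1) ≤ H x := hH.mono (by omega)
    have := h.ge; have := h'.le
    omega
  refine ⟨hx, ?_, fun e => by omega⟩
  rcases hx.eq_or_lt with e | hlt'
  · omega
  · have h1 : H (x + 1) ≤ H x' := hH.mono (by omega)
    have := h.le; have := h'.ge
    omega

/-- The sum `x + y` is the number of the point `(x, y)` along the path. -/
theorem pt_unique (h : IsPt p H x y) (h' : IsPt p H x' y') (he : x + y = x' + y') :
    x = x' ∧ y = y' := by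
  suffices x = x' by omega
  rcases lt_trichotomy x x' with hlt | e | hlt
  · have h1 : H (x + 1) ≤ H x' := hH.mono (by omega)
    have := h.le; have := h'.ge
    omega
  · exact e
  · have h1 : H (x' + 1) ≤ H x := hH.mono (by omega)
    have := h'.le; have := h.ge
    omega

theorem col_eq (h : IsPt p H x y) : col p H (x + y) = x := by
  have h0 := h.lt
  have h1 := h.ge
  unfold col
  rw [Nat.findGreatest_eq_iff]
  refine ⟨by omega, fun _ => by omega, fun n hn _ => ?_⟩
  have h2 : H (x + 1) ≤ H n := hH.mono (by omega)
  have := h.le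
  omega

theorem pword_eq (W : ℕ → β) (h : IsPt p H x y) : pword a p V W H (x + y) = letter a V W x y := by
  unfold pword; rw [hH.col_eq h, Nat.add_sub_cancel_left]

theorem pt_lt (hq : 1 ≤ q) (h : IsPt p H x y) : x + y < p + q - 1 ∧ y < q := by
  have := h.le; have := hH.le_last (x + 1); have := h.lt
  omega

theorem exists_pt {k : ℕ} (hk : k < p + q - 1) :
    ∃ x y, IsPt p H x y ∧ x + y = k := by
  have key : ∀ n, n ≤ p → k < n + H n → ∃ x y, IsPt p H x y ∧ x + y = k := by
    intro n
    induction n with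
    | zero => intro _ h; rw [hH.zero] at h; omega
    | succ n ih =>
      intro hn h
      by_cases hlt : k < n + H n
      · exact ih (by omega) hlt
      · exact ⟨n, k - n, ⟨by omega, by omega, by omega⟩, by omega⟩
  exact key p le_rfl (by rw [hH.last p le_rfl]; omega)

/-- A path crosses from every row to the next one, in a column with letter `a`. -/
theorem exists_rise (hy : y + 1 < q) : ∃ x, x < p ∧ H x ≤ y ∧ y < H (x + 1) ∧ V x = a := by
  have key : ∀ n, n ≤ p → y < H n → ∃ x, x < p ∧ H x ≤ y ∧ y < H (x + 1) := by
    intro n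
    induction n with
    | zero => intro _ h; rw [hH.zero] at h; omega
    | succ n ih =>
      intro hn h
      by_cases hlt : y < H n
      · exact ih (by omega) hlt
      · exact ⟨n, by omega, by omega, h⟩
  obtain ⟨x, h1, h2, h3⟩ := key p le_rfl (by rw [hH.last p le_rfl]; omega)
  exact ⟨x, h1, h2, h3, hH.eq_of_lt h1 (by omega)⟩

/-- The caesurae of the word read along a path: the last points of the columns of caesurae of `V`,
and the last points of the rows of caesurae of `W`. -/
theorem caes_iff (hq : 1 ≤ q) (h : IsPt p H x y) :
    Caes (p + q - 1) (pword a p V W H) (x + y) ↔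
      (y = H (x + 1) ∧ Caes p V x) ∨ (y < H (x + 1) ∧ Caes q W y) := by
  have hle := h.le
  have hge := h.ge
  constructor
  · rintro ⟨k, h1, h2, h3⟩
    obtain ⟨x', y', h', rfl⟩ := hH.exists_pt h2
    have := hH.pt_lt hq h'
    obtain ⟨o1, o2, o3⟩ := hH.pt_order h h' h1
    rw [hH.pword_eq W h, hH.pword_eq W h', letter_eq_iff] at h3
    have hle' := h'.le
    have hge' := h'.ge
    obtain ⟨e1, e2⟩ := h3
    by_cases ha : V x = a
    · rcases hle.eq_or_lt with e | hlt
      · refine Or.inl ⟨e, x', ?_, h'.lt, e1⟩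
        rcases o1.eq_or_lt with rfl | h5
        · have := o3 rfl; omega
        · exact h5
      · refine Or.inr ⟨hlt, y', ?_, by omega, e2 (e1.trans ha)⟩
        rcases o1.eq_or_lt with rfl | h5
        · exact o3 rfl
        · have : H (x + 1) ≤ H x' := hH.mono (by omega)
          omega
    · have hc := hH.const x h.lt ha
      refine Or.inl ⟨by omega, x', ?_, h'.lt, e1⟩
      rcases o1.eq_or_lt with rfl | h5
      · have := o3 rfl; omega
      · exact h5
  · rintro (⟨e, x', h1, h2, h3⟩ | ⟨hlt, y', h1, h2, h3⟩)
    · by_cases ha : V x = a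
      · obtain ⟨z, z1, z2, z3, z4⟩ := exists_next (a := a) ⟨x', h1, h2, h3.trans ha⟩
        have hz : H z = H (x + 1) := hH.const_of (by omega) z2.le fun w w1 w2 =>
          z4 w (by omega) w2
        have hpt : IsPt p H z y := ⟨z2, by omega, by rw [e, ← hz]; exact hH.mono (by omega)⟩
        refine ⟨z + y, by omega, (hH.pt_lt hq hpt).1, ?_⟩
        rw [hH.pword_eq W h, hH.pword_eq W hpt, letter_eq_iff]
        exact ⟨z3.trans ha.symm, fun _ => rfl⟩
      · have hpt : IsPt p H x' (H x') := ⟨h2, le_rfl, hH.mono (by omega)⟩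
        have : H (x + 1) ≤ H x' := hH.mono (by omega)
        refine ⟨x' + H x', by omega, (hH.pt_lt hq hpt).1, ?_⟩
        rw [hH.pword_eq W h, hH.pword_eq W hpt, letter_eq_iff]
        exact ⟨h3, fun e => (ha (h3.symm.trans e)).elim⟩
    · have ha : V x = a := hH.eq_of_lt h.lt (by omega)
      obtain ⟨x', x1, x2, x3, x4⟩ := hH.exists_rise (y := y' - 1) (by omega)
      have hpt : IsPt p H x' y' := ⟨x1, by omega, by omega⟩
      have hxx : x ≤ x' := by
        by_contra hc
        have : H (x' + 1) ≤ H x := hH.mono (by omega)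
        omega
      refine ⟨x' + y', by omega, (hH.pt_lt hq hpt).1, ?_⟩
      rw [hH.pword_eq W h, hH.pword_eq W hpt, letter_eq_iff]
      exact ⟨x4.trans ha.symm, fun _ => h3⟩

/-- The caesurae before a point of the path are those of the columns and those of the rows left
before. -/
theorem cnum_eq (hq : 1 ≤ q) (h : IsPt p H x y) :
    cnum (p + q - 1) (pword a p V W H) (x + y) = cnum p V x + cnum q W y := by
  classical
  generalize hk : x + y = k
  induction k generalizing x y with
  | zero =>
    obtain ⟨rfl, rfl⟩ : x = 0 ∧ y = 0 := by omega
    simp [cnum_zero]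
  | succ k ih =>
    have hle := h.le
    have hge := h.ge
    have hlt := h.lt
    by_cases hy : H x < y
    · have hpt : IsPt p H x (y - 1) := ⟨h.lt, by omega, by omega⟩
      have e : x + (y - 1) = k := by omega
      have hc := hH.caes_iff (W := W) hq hpt
      rw [e] at hc
      obtain ⟨y, rfl⟩ : ∃ z, y = z + 1 := ⟨y - 1, by omega⟩
      rw [Nat.add_sub_cancel] at *
      rw [cnum_succ, ih hpt e, cnum_succ (x := y), hc, add_assoc]
      simp [show y ≠ H (x + 1) by omega, show y < H (x + 1) by omega]
    · have hy' : y = H x := by omega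
      obtain ⟨x, rfl⟩ : ∃ z, x = z + 1 := by
        refine ⟨x - 1, ?_⟩
        have : x ≠ 0 := by rintro rfl; rw [hH.zero] at hy'; omega
        omega
      have hpt : IsPt p H x y := ⟨by omega, by rw [hy']; exact hH.mono (by omega), by omega⟩
      have e : x + y = k := by omega
      have hc := hH.caes_iff (W := W) hq hpt
      rw [e] at hc
      rw [cnum_succ, ih hpt e, cnum_succ (x := x), hc]
      simp only [hy', true_and, lt_irrefl, false_and, or_false]
      omega

theorem rep_iff (hq : 1 ≤ q) (h : IsPt p H x y) :
    Rep (p + q - 1) (pword a p V W H) (x + y) ↔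
      ∃ x' y', IsPt p H x' y' ∧ (x' ≠ x ∨ y' ≠ y) ∧ V x' = V x ∧ (V x = a → W y' = W y) := by
  constructor
  · rintro ⟨k, h1, h2, h3⟩
    obtain ⟨x', y', h', rfl⟩ := hH.exists_pt h2
    rw [hH.pword_eq W h, hH.pword_eq W h', letter_eq_iff] at h3
    refine ⟨x', y', h', ?_, h3.1, fun e => h3.2 (h3.1.trans e)⟩
    by_contra hc; push Not at hc; obtain ⟨rfl, rfl⟩ := hc; exact h1 rfl
  · rintro ⟨x', y', h', h1, h2, h3⟩
    refine ⟨x' + y', fun e => ?_, (hH.pt_lt hq h').1, ?_⟩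
    · obtain ⟨rfl, rfl⟩ := hH.pt_unique h' h e
      simp at h1
    · rw [hH.pword_eq W h, hH.pword_eq W h', letter_eq_iff]
      exact ⟨h2, fun e => h3 (h2.symm.trans e)⟩

/-- The number attached to a point whose previous occurrence is the point `(x', y')`. -/
theorem fnum_pword (hq : 1 ≤ q) (h : IsPt p H x y) (h' : IsPt p H x' y')
    (hc : ¬ Caes (p + q - 1) (pword a p V W H) (x + y)) (hlt : x' + y' < x + y)
    (h1 : V x' = V x) (h2 : V x = a → W y' = W y)
    (h3 : ∀ u v, IsPt p H u v → x' + y' < u + v → u + v < x + y → V u = V x →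
      (V x = a → W v = W y) → False) :
    fnum (p + q - 1) (pword a p V W H) (x + y) = cnum p V x' + cnum q W y' + 2 := by
  rw [← hH.cnum_eq hq h']
  have hN := (hH.pt_lt hq h).1
  refine fnum_of_not_caes hN hc hlt ?_ fun z z1 z2 z3 => ?_
  · rw [hH.pword_eq W h, hH.pword_eq W h', letter_eq_iff]
    exact ⟨h1, fun e => h2 (h1.symm.trans e)⟩
  · obtain ⟨u, v, huv, rfl⟩ := hH.exists_pt (k := z) (by omega)
    rw [hH.pword_eq W h, hH.pword_eq W huv, letter_eq_iff] at z3
    exact h3 u v huv z1 z2 z3.1 fun e => z3.2 (z3.1.trans e)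

end IsPath

end FunWord

/-! ### Deleting and inserting columns and rows of a path -/

namespace FunWord

variable {α β : Type*}

/-- Delete column `j`. -/
def delCol (j : ℕ) (H : ℕ → ℕ) (x : ℕ) : ℕ := if x ≤ j then H x else H (x + 1)

/-- Insert a column with a single point. -/
def insCol (j : ℕ) (H : ℕ → ℕ) (x : ℕ) : ℕ := if x ≤ j then H x else H (x - 1)

/-- Delete a row in which column `j` has a point. -/
def delRow (j : ℕ) (H : ℕ → ℕ) (x : ℕ) : ℕ := if x ≤ j then H x else H x - 1

/-- Insert a row, lengthening column `j`. -/
def insRow (j : ℕ) (H : ℕ → ℕ) (x : ℕ) : ℕ := if x ≤ j then H x else H x + 1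

/-- Shorten column `j` by one point and lengthen column `j'`. -/
def lower (j j' : ℕ) (H : ℕ → ℕ) (x : ℕ) : ℕ := if j < x ∧ x ≤ j' then H x - 1 else H x

/-- Lengthen column `j` by one point and shorten column `j'`. -/
def raise (j j' : ℕ) (H : ℕ → ℕ) (x : ℕ) : ℕ := if j < x ∧ x ≤ j' then H x + 1 else H x

variable {a : α} {p q : ℕ} {V : ℕ → α} {W : ℕ → β} {H : ℕ → ℕ} {j j' t : ℕ}

theorem isPath_delCol (hH : IsPath a p q V H) (hj : j < p) (he : H (j + 1) = H j) :
    IsPath a (p - 1) q (V ∘ skip j) (delCol j H) where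
  zero := by simp [delCol, hH.zero]
  mono := by
    intro x y hxy
    unfold delCol
    split_ifs <;> first | omega | exact hH.mono (by omega)
  const x hx hV := by
    unfold delCol
    simp only [Function.comp, skip] at hV
    have h1 := hH.const x (by omega)
    have h2 := hH.const (x + 1) (by omega)
    rcases lt_trichotomy x j with h | rfl | h
    · rw [if_pos h] at hV
      rw [if_pos (by omega), if_pos (by omega), h1 hV]
    · rw [if_neg (by omega)] at hV
      rw [if_neg (by omega), if_pos le_rfl, h2 hV, he]
    · rw [if_neg (by omega)] at hV
      rw [if_neg (by omega), if_neg (by omega), h2 hV]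
  last x hx := by
    unfold delCol
    split_ifs with h
    · obtain rfl : x = j := by omega
      rw [← he]; exact hH.last _ (by omega)
    · exact hH.last _ (by omega)

theorem isPath_insCol (hH : IsPath a (p - 1) q (V ∘ skip j) H) (hj : j < p) :
    IsPath a p q V (insCol j H) where
  zero := by simp [insCol, hH.zero]
  mono := by
    intro x y hxy
    unfold insCol
    split_ifs <;> first | omega | exact hH.mono (by omega)
  const x hx hV := by
    unfold insCol
    have h1 := hH.const x
    have h2 := hH.const (x - 1)
    simp only [Function.comp, skip] at h1 h2
    rcases lt_trichotomy x j with h | rfl | h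
    · rw [if_pos (by omega), if_pos (by omega)]
      exact h1 (by omega) (by rwa [if_pos h])
    · simp
    · rw [if_neg (by omega), if_neg (by omega)]
      have e : x - 1 + 1 = x := by omega
      rw [e, if_neg (by omega)] at h2
      exact h2 (by omega) hV
  last x hx := by
    unfold insCol
    rw [if_neg (by omega)]; exact hH.last _ (by omega)

theorem insCol_succ : insCol j H (j + 1) = insCol j H j := by simp [insCol]

theorem insCol_self : insCol j H j = H j := by simp [insCol]

theorem delCol_insCol : delCol j (insCol j H) = H := by
  funext x; simp only [delCol, insCol]; split_ifs <;> first | rfl | omega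

theorem insCol_delCol (he : H (j + 1) = H j) : insCol j (delCol j H) = H := by
  funext x; simp only [delCol, insCol]
  split_ifs with h1 h2
  · rfl
  · rw [show x = j + 1 by omega, he, Nat.add_sub_cancel]
  · rw [show x - 1 + 1 = x by omega]

theorem isPath_delRow (hH : IsPath a p q V H) (hj : j < p) (hV : V j = a)
    (hlt : H j < H (j + 1)) : IsPath a p (q - 1) V (delRow j H) where
  zero := by simp [delRow, hH.zero]
  mono := by
    intro x y hxy
    unfold delRow
    have h0 := hH.mono hxy
    split_ifs
    · exact h0
    · have h1 : H x ≤ H j := hH.mono (by omega)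
      have h2 : H (j + 1) ≤ H y := hH.mono (by omega)
      omega
    · omega
    · omega
  const x hx hVx := by
    unfold delRow
    have hne : x ≠ j := by rintro rfl; exact hVx hV
    rw [hH.const x hx hVx]
    split_ifs <;> omega
  last x hx := by
    unfold delRow
    rw [if_neg (by omega), hH.last x hx]

theorem isPath_insRow (hH : IsPath a p (q - 1) V H) (hj : j < p) (hV : V j = a)
    (hq : 2 ≤ q) : IsPath a p q V (insRow j H) where
  zero := by simp [insRow, hH.zero]
  mono := by
    intro x y hxy
    unfold insRow
    have h0 := hH.mono hxy
    split_ifs <;> omega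
  const x hx hVx := by
    unfold insRow
    have hne : x ≠ j := by rintro rfl; exact hVx hV
    rw [hH.const x hx hVx]
    split_ifs <;> omega
  last x hx := by
    unfold insRow
    rw [if_neg (by omega), hH.last x hx]; omega

theorem delRow_insRow : delRow j (insRow j H) = H := by
  funext x; simp only [delRow, insRow]; split_ifs <;> simp

theorem insRow_delRow (hH : IsPath a p q V H) (hlt : H j < H (j + 1)) :
    insRow j (delRow j H) = H := by
  funext x; simp only [delRow, insRow]
  split_ifs with h
  · rfl
  · have h2 : H (j + 1) ≤ H x := hH.mono (by omega)
    omega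

theorem isPath_lower (hH : IsPath a p q V H) (hjj : j < j') (hj' : j' < p)
    (hV : V j = a) (hV' : V j' = a) (hlt : H j < H (j + 1)) :
    IsPath a p q V (lower j j' H) where
  zero := by simp [lower, hH.zero]
  mono := by
    intro x y hxy
    unfold lower
    have h0 := hH.mono hxy
    split_ifs with h1 h2 h2
    · omega
    · omega
    · have h1 : H x ≤ H j := hH.mono (by omega)
      have h2 : H (j + 1) ≤ H y := hH.mono (by omega)
      omega
    · omega
  const x hx hVx := by
    unfold lower
    have hne : x ≠ j := by rintro rfl; exact hVx hV
    have hne' : x ≠ j' := by rintro rfl; exact hVx hV'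
    rw [hH.const x hx hVx]
    split_ifs <;> omega
  last x hx := by
    unfold lower
    rw [if_neg (by omega), hH.last x hx]

theorem isPath_raise (hH : IsPath a p q V H) (hj' : j' < p)
    (hV : V j = a) (hV' : V j' = a) (hlt : H j' < H (j' + 1)) :
    IsPath a p q V (raise j j' H) where
  zero := by simp [raise, hH.zero]
  mono := by
    intro x y hxy
    unfold raise
    have h0 := hH.mono hxy
    split_ifs with h1 h2 h2
    · omega
    · have h1 : H x ≤ H j' := hH.mono (by omega)
      have h2 : H (j' + 1) ≤ H y := hH.mono (by omega)
      omega
    · omega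
    · omega
  const x hx hVx := by
    unfold raise
    have hne : x ≠ j := by rintro rfl; exact hVx hV
    have hne' : x ≠ j' := by rintro rfl; exact hVx hV'
    rw [hH.const x hx hVx]
    split_ifs <;> omega
  last x hx := by
    unfold raise
    rw [if_neg (by omega), hH.last x hx]

theorem lower_raise : lower j j' (raise j j' H) = H := by
  funext x; simp only [lower, raise]; split_ifs <;> simp

theorem raise_lower (hH : IsPath a p q V H) (hlt : H j < H (j + 1)) :
    raise j j' (lower j j' H) = H := by
  funext x; simp only [lower, raise]
  split_ifs with h
  · have h2 : H (j + 1) ≤ H x := hH.mono (by omega)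
    omega
  · rfl

theorem pword_delCol (hH : IsPath a p q V H) (hj : j < p) (he : H (j + 1) = H j) {k : ℕ}
    (hk : k < p + q - 1 - 1) :
    pword a p V W H (skip (j + H j) k) = pword a (p - 1) (V ∘ skip j) W (delCol j H) k := by
  have hH' := isPath_delCol hH hj he
  obtain ⟨x, y, h, rfl⟩ := hH'.exists_pt (k := k) (by omega)
  obtain ⟨h1, h2, h3⟩ := h
  have key : IsPt p H (skip j x) y ∧ skip (j + H j) (x + y) = skip j x + y := by
    by_cases hx : x < j
    · rw [show skip j x = x from if_pos hx]
      rw [delCol, if_pos (by omega)] at h2 h3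
      have : H (x + 1) ≤ H j := hH.mono (by omega)
      exact ⟨⟨by omega, h2, h3⟩, if_pos (by omega)⟩
    · rw [show skip j x = x + 1 from if_neg hx]
      have h2' : H (x + 1) ≤ y := by
        unfold delCol at h2
        split_ifs at h2 with h
        · rw [show x + 1 = j + 1 by omega, he]
          rwa [show x = j by omega] at h2
        · exact h2
      rw [delCol, if_neg (by omega)] at h3
      have : H j ≤ H (x + 1) := hH.mono (by omega)
      refine ⟨⟨by omega, h2', h3⟩, ?_⟩
      rw [show skip (j + H j) (x + y) = x + y + 1 from if_neg (by omega)]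
      omega
  obtain ⟨hpt, hs⟩ := key
  rw [hs, hH.pword_eq W hpt, hH'.pword_eq W ⟨h1, h2, h3⟩]
  rfl

/-- The point `(j, t)` is the only point of its row at which a letter of `W` is read, and not the
only point of its column. -/
structure IsRow (a : α) (p : ℕ) (V : ℕ → α) (H : ℕ → ℕ) (j t : ℕ) : Prop where
  letter : V j = a
  lt : H j < H (j + 1)
  right : t < H (j + 1) ∨ ¬ Caes p V j
  left : H j < t ∨ ∀ z, z < j → V z ≠ a

theorem pword_delRow (hH : IsPath a p q V H) (hpt : IsPt p H j t) (hr : IsRow a p V H j t)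
    {k : ℕ} (hk : k < p + q - 1 - 1) (hq : 2 ≤ q) :
    pword a p V W H (skip (j + t) k) = pword a p V (W ∘ skip t) (delRow j H) k := by
  have hH' := isPath_delRow hH hpt.lt hr.letter hr.lt
  obtain ⟨x, y, h, rfl⟩ := hH'.exists_pt (k := k) (by omega)
  obtain ⟨hj, t1, t2⟩ := hpt
  obtain ⟨r1, r2, r3, r4⟩ := hr
  rw [hH'.pword_eq _ h]
  obtain ⟨h1, h2, h3⟩ := h
  unfold delRow at h2 h3
  rcases lt_trichotomy x j with hx | rfl | hx
  · rw [if_pos (by omega)] at h2 h3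
    have hle : H (x + 1) ≤ H j := hH.mono (by omega)
    have hs : skip (j + t) (x + y) = x + y := if_pos (by omega)
    rw [hs, hH.pword_eq W ⟨h1, h2, h3⟩, letter_eq_iff]
    refine ⟨rfl, fun hV => ?_⟩
    have : y < t := by
      rcases r4 with r4 | r4
      · omega
      · exact absurd hV (r4 x hx)
    simp only [Function.comp, skip, if_pos this]
  · rw [if_pos le_rfl] at h2
    rw [if_neg (by omega)] at h3
    have hpt : IsPt p H x (skip t y) := ⟨h1, by unfold skip; split_ifs <;> omega,
      by unfold skip; split_ifs <;> omega⟩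
    have hs : skip (x + t) (x + y) = x + skip t y := by unfold skip; split_ifs <;> omega
    rw [hs, hH.pword_eq W hpt]; rfl
  · rw [if_neg (by omega)] at h2 h3
    have hle : H (j + 1) ≤ H x := hH.mono (by omega)
    have hle' : H x ≤ H (x + 1) := hH.mono (by omega)
    have hs : skip (j + t) (x + y) = x + (y + 1) := if_neg (by omega)
    rw [hs, hH.pword_eq W ⟨h1, by omega, by omega⟩, letter_eq_iff]
    refine ⟨rfl, fun hV => ?_⟩
    have : t ≤ y := by
      rcases r3 with r3 | r3
      · omega
      · exact absurd ⟨x, hx, h1, hV.trans r1.symm⟩ r3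
    simp only [Function.comp, skip, if_neg (not_lt.2 this)]

theorem pword_lower (hH : IsPath a p q V H) (hjj : j < j') (hj' : j' < p)
    (hV : V j = a) (hV' : V j' = a) (hb : ∀ z, j < z → z < j' → V z ≠ a)
    (hlt : H j < H (j + 1)) {k : ℕ} (hk : k < p + q - 1 - 1) :
    pword a p V W H (skip (j + H (j + 1)) k) =
      pword a p V W (lower j j' H) (skip (j' + (H (j + 1) - 1)) k) := by
  have hH' := isPath_lower hH hjj hj' hV hV' hlt
  have hc : ∀ z, j < z → z ≤ j' → H z = H (j + 1) := fun z z1 z2 =>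
    hH.const_of (by omega) (by omega) fun w w1 w2 => hb w (by omega) (by omega)
  by_cases k1 : k < j + H (j + 1)
  · have e1 : skip (j + H (j + 1)) k = k := if_pos k1
    have e2 : skip (j' + (H (j + 1) - 1)) k = k := if_pos (by omega)
    rw [e1, e2]
    obtain ⟨x, y, h, rfl⟩ := hH.exists_pt (k := k) (by omega)
    have hpt : IsPt p (lower j j' H) x y := by
      obtain ⟨h1, h2, h3⟩ := h
      have hxj : x ≤ j := by
        by_contra hcon
        have : H (j + 1) ≤ H x := hH.mono (by omega)
        omega
      refine ⟨h1, ?_, ?_⟩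
      · unfold lower; rw [if_neg (by omega)]; exact h2
      · unfold lower
        split_ifs with hi
        · obtain rfl : x = j := by omega
          omega
        · exact h3
    rw [hH.pword_eq W h, hH'.pword_eq W hpt]
  · have e1 : skip (j + H (j + 1)) k = k + 1 := if_neg k1
    rw [e1]
    by_cases k2 : k < j' + (H (j + 1) - 1)
    · have e2 : skip (j' + (H (j + 1) - 1)) k = k := if_pos k2
      rw [e2]
      obtain ⟨x, rfl⟩ : ∃ x, k = x + (H (j + 1) - 1) := ⟨k - (H (j + 1) - 1), by omega⟩
      have c1 := hc x (by omega) (by omega)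
      have c2 := hc (x + 1) (by omega) (by omega)
      have p1 : IsPt p H x (H (j + 1)) := ⟨by omega, by omega, by omega⟩
      have p2 : IsPt p (lower j j' H) x (H (j + 1) - 1) := by
        refine ⟨by omega, ?_, ?_⟩
        · unfold lower; rw [if_pos (by omega)]; omega
        · unfold lower; rw [if_pos (by omega)]; omega
      rw [hH'.pword_eq W p2, show x + (H (j + 1) - 1) + 1 = x + H (j + 1) by omega,
        hH.pword_eq W p1, letter_eq_iff]
      exact ⟨rfl, fun e => absurd e (hb x (by omega) (by omega))⟩
    · have e2 : skip (j' + (H (j + 1) - 1)) k = k + 1 := if_neg k2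
      rw [e2]
      obtain ⟨x, y, h, e⟩ := hH.exists_pt (k := k + 1) (by omega)
      have hpt : IsPt p (lower j j' H) x y := by
        obtain ⟨h1, h2, h3⟩ := h
        have hxj : j' ≤ x := by
          by_contra hcon
          have : H (x + 1) ≤ H j' := hH.mono (by omega)
          have := hc j' hjj le_rfl
          omega
        refine ⟨h1, ?_, ?_⟩
        · unfold lower; split_ifs <;> omega
        · unfold lower; rw [if_neg (by omega)]; exact h3
      rw [← e, hH.pword_eq W h, hH'.pword_eq W hpt]

end FunWord

/-! ### Signs of the faces along a path -/

namespace FunWord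

variable {α β : Type*} {a : α} {p q : ℕ} {V : ℕ → α} {W : ℕ → β} {H : ℕ → ℕ} {j j' t : ℕ}

theorem sum_range_skip {M : Type*} [AddCommMonoid M] (F : ℕ → M) (hj : j < p) :
    ∑ x ∈ Finset.range p, F x = ∑ k ∈ Finset.range (p - 1), F (skip j k) + F j := by
  rw [← Finset.sum_erase_add _ _ (Finset.mem_range.2 hj)]
  congr 1
  symm
  refine Finset.sum_nbij (skip j) (fun k hk => ?_) (fun k _ l _ e => ?_) (fun x hx => ?_)
    fun _ _ => rfl
  · simp only [Finset.mem_range, Finset.mem_erase] at hk ⊢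
    exact ⟨skip_ne _ _, skip_lt hk⟩
  · have h1 := skip_lt_skip (j := j) (k := k) (l := l)
    have h2 := skip_lt_skip (j := j) (k := l) (l := k)
    omega
  · simp only [Finset.coe_erase, Finset.coe_range, Set.mem_sdiff, Set.mem_Iio,
      Set.mem_singleton_iff] at hx
    obtain ⟨k, hk, e⟩ := exists_skip hj hx.1 hx.2
    exact ⟨k, by simpa using hk, e⟩

open Classical in
theorem cnum_eq_sum {n : ℕ} (hn : n ≤ p) :
    cnum p V n = ∑ x ∈ Finset.range p, if Caes p V x ∧ x < n then 1 else 0 := by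
  have h1 : ∀ n, cnum p V n = ∑ x ∈ Finset.range n, if Caes p V x then 1 else 0 := by
    intro n
    induction n with
    | zero => simp [cnum_zero]
    | succ n ih => rw [cnum_succ, Finset.sum_range_succ, ih]
  rw [h1, ← Finset.sum_subset (Finset.range_mono hn)]
  · exact Finset.sum_congr rfl fun x hx => by simp [Finset.mem_range.1 hx]
  · intro x _ hx
    rw [if_neg]
    rintro ⟨-, h⟩
    exact hx (Finset.mem_range.2 h)

/-- Deleting a column with a single point: the caesura `mark p V j` no longer contributes to the
number of inversions. -/
theorem inv_delCol (hj : j < p) (hr : Rep p V j) :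
    inv p q V W H =
      inv (p - 1) q (V ∘ skip j) W (delCol j H) + cnum q W (H (mark p V j + 1)) := by
  classical
  set m := mark p V j with hm
  have hmc : Caes p V m := caes_mark hr hj
  have hmp : m < p := by have := mark_le hr; omega
  have h1 : inv p q V W H =
      (∑ x ∈ Finset.range p, if Caes p V x ∧ x ≠ m then cnum q W (H (x + 1)) else 0) +
        cnum q W (H (m + 1)) := by
    unfold inv
    rw [← Finset.sum_erase_add _ _ (Finset.mem_range.2 hmp),
      ← Finset.sum_erase_add (Finset.range p) (fun x => if Caes p V x ∧ x ≠ m then _ else _)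
        (Finset.mem_range.2 hmp), if_pos hmc]
    simp only [ne_eq, not_true_eq_false, and_false, if_false, add_zero]
    congr 1
    refine Finset.sum_congr rfl fun x hx => ?_
    simp [Finset.ne_of_mem_erase hx]
  rw [h1, sum_range_skip _ hj]
  congr 1
  rw [if_neg, add_zero]
  · refine Finset.sum_congr rfl fun k hk => ?_
    rw [caes_skip hj hr]
    have : delCol j H (k + 1) = H (skip j k + 1) := by
      unfold delCol skip
      split_ifs <;> first | rfl | omega
    rw [this, ← hm]
    congr
  · rintro ⟨hc, hne⟩
    exact hne (mark_of_caes hc).symm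

/-- Deleting a column with a single point: the sign of the face of the word along the path is the
sign of the face of `V` times the sign of the shortened path. -/
theorem fnum_col (hq : 1 ≤ q) (hH : IsPath a p q V H) (hj : j < p) (he : H (j + 1) = H j)
    (hr : Rep p V j) :
    inv p q V W H + fnum (p + q - 1) (pword a p V W H) (j + H j) =
      fnum p V j + inv (p - 1) q (V ∘ skip j) W (delCol j H) +
        2 * cnum q W (H (mark p V j + 1)) := by
  have hpt : IsPt p H j (H j) := ⟨hj, le_rfl, he.ge⟩
  have hc := hH.caes_iff (W := W) hq hpt
  rw [he] at hc
  simp only [true_and, lt_irrefl, false_and, or_false] at hc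
  rw [inv_delCol hj hr]
  by_cases h : Caes p V j
  · rw [fnum_of_caes (hc.2 h), fnum_of_caes h, hH.cnum_eq hq hpt, mark_of_caes h, he]
    omega
  · obtain ⟨m1, m2, m3⟩ := mark_spec hr h
    set m := mark p V j
    have hpt' : IsPt p H m (H (m + 1)) := ⟨by omega, hH.mono (by omega), le_rfl⟩
    have hle : H (m + 1) ≤ H j := hH.mono (by omega)
    have key : V j = a → H (m + 1) = H j := fun ha =>
      (hH.const_of (by omega) hj.le fun z z1 z2 hz =>
        m3 z (by omega) (by omega) (by omega) (hz.trans ha.symm)).symm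
    rw [hH.fnum_pword hq hpt hpt' (fun h' => h (hc.1 h')) (by omega) m2
      (fun ha => by rw [key ha]) ?_, fnum_of_not_caes hj h m1 m2
        fun z z1 z2 => m3 z z1 (by omega) (by omega)]
    · omega
    · intro u v huv l1 l2 e1 _
      obtain ⟨o1, o2, o3⟩ := hH.pt_order hpt' huv l1
      obtain ⟨o4, o5, o6⟩ := hH.pt_order huv hpt l2
      have hle' := huv.le
      rcases o1.eq_or_lt with rfl | h1
      · have := o3 rfl; omega
      rcases o4.eq_or_lt with rfl | h2
      · have := huv.ge; have := o6 rfl; omega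
      · exact m3 u h1 huv.lt (by omega) e1

/-- Deleting a row: comparison of the numbers of inversions. -/
theorem inv_delRow (hH : IsPath a p q V H) (hpt : IsPt p H j t) (hrow : IsRow a p V H j t)
    (htq : t < q) (hr : Rep q W t) {j0 : ℕ} (hj0 : j0 < p) (h1 : H j0 ≤ mark q W t)
    (h2 : mark q W t < H (j0 + 1)) :
    inv p q V W H + cnum p V j0 =
      inv p (q - 1) V (W ∘ skip t) (delRow j H) + cnum p V p := by
  classical
  rw [cnum_eq_sum hj0.le, cnum_eq_sum le_rfl, inv, inv, ← Finset.sum_add_distrib,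
    ← Finset.sum_add_distrib]
  refine Finset.sum_congr rfl fun x hx => ?_
  have hx : x < p := Finset.mem_range.1 hx
  by_cases hc : Caes p V x
  swap
  · simp [hc]
  simp only [hc, hx, true_and, if_true, and_self]
  have e1 : x < j0 ↔ ¬ mark q W t < H (x + 1) := by
    constructor
    · intro h
      have : H (x + 1) ≤ H j0 := hH.mono (by omega)
      omega
    · intro h
      by_contra hcon
      have : H (j0 + 1) ≤ H (x + 1) := hH.mono (by omega)
      omega
  have hml := mark_le hr
  have hge := hpt.ge
  have hle := hpt.le
  by_cases hxj : x + 1 ≤ j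
  · have h3 : H (x + 1) ≤ H j := hH.mono hxj
    have := cnum_skip_of_le htq hr (k := H (x + 1)) (by omega)
    rw [show delRow j H (x + 1) = H (x + 1) from if_pos hxj, ← this]
    simp only [e1]
    split_ifs <;> omega
  · rw [show delRow j H (x + 1) = H (x + 1) - 1 from if_neg hxj]
    have h3 : H (j + 1) ≤ H (x + 1) := hH.mono (by omega)
    have hlt := hrow.lt
    by_cases h4 : t < H (x + 1)
    · have := cnum_skip_of_ge htq hr (k := H (x + 1) - 1) (by omega)
      rw [show H (x + 1) - 1 + 1 = H (x + 1) by omega] at this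
      rw [← this, if_neg (by rw [e1]; omega)]
    · have h5 : H (x + 1) = t := by omega
      have h6 : t = q - 1 := by
        rcases hrow.right with h | h
        · omega
        · have : H p = H (j + 1) := hH.const_of (by have := hpt.lt; omega) le_rfl
            fun z z1 z2 hz => h ⟨z, by omega, z2, hz.trans hrow.letter.symm⟩
          rw [hH.last p le_rfl] at this
          omega
      have h7 := cnum_skip_of_le htq hr le_rfl
      have h8 : cnum (q - 1) (W ∘ skip t) t = cnum (q - 1) (W ∘ skip t) (t - 1) := by
        obtain ⟨s, rfl⟩ : ∃ s, t = s + 1 := ⟨t - 1, by omega⟩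
        rw [cnum_succ_of_not fun h => by have := h.lt; omega, Nat.add_sub_cancel]
      rw [h5, ← h8, ← h7]
      simp only [e1, h5]
      split_ifs <;> omega

/-- Deleting a row: the sign of the face of the word along the path is the sign of the face of `W`,
times the sign of the shortened path and the Koszul sign of passing all caesurae of `V`. -/
theorem fnum_row (hH : IsPath a p q V H) (hpt : IsPt p H j t) (hrow : IsRow a p V H j t)
    (htq : t < q) (hr : Rep q W t) :
    inv p q V W H + fnum (p + q - 1) (pword a p V W H) (j + t) =
      cnum p V p + fnum q W t + inv p (q - 1) V (W ∘ skip t) (delRow j H) := by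
  have hq : 1 ≤ q := by omega
  have hj := hpt.lt
  have hle := hpt.le
  have hlast : t = H (j + 1) → ¬ Caes p V j ∧ ¬ Caes q W t := by
    intro h
    rcases hrow.right with h' | h'
    · omega
    · refine ⟨h', fun hc => ?_⟩
      have : H p = H (j + 1) := hH.const_of (by omega) le_rfl
        fun z z1 z2 hz => h' ⟨z, by omega, z2, hz.trans hrow.letter.symm⟩
      rw [hH.last p le_rfl] at this
      have := hc.lt
      omega
  have hc : Caes (p + q - 1) (pword a p V W H) (j + t) ↔ Caes q W t := by
    rw [hH.caes_iff hq hpt]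
    rcases hle.eq_or_lt with h | h
    · obtain ⟨n1, n2⟩ := hlast h
      simp [n1, n2]
    · simp [h, h.ne]
  have hcm := cnum_mono (p := p) (V := V)
  by_cases h : Caes q W t
  · have hlt : t < H (j + 1) := by
      rcases hle.eq_or_lt with h' | h'
      · exact absurd h (hlast h').2
      · exact h'
    have hi := inv_delRow hH hpt hrow htq hr hj (by rw [mark_of_caes h]; exact hpt.ge)
      (by rwa [mark_of_caes h])
    rw [fnum_of_caes (hc.2 h), fnum_of_caes h, hH.cnum_eq hq hpt]
    omega
  · obtain ⟨m1, m2, m3⟩ := mark_spec hr h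
    obtain ⟨j0, r1, r2, r3, r4⟩ := hH.exists_rise (y := mark q W t) (by omega)
    have hi := inv_delRow hH hpt hrow htq hr r1 r2 r3
    set m := mark q W t
    have hpt' : IsPt p H j0 m := ⟨r1, r2, r3.le⟩
    have hjj : j0 ≤ j := by
      by_contra hcon
      have : H (j + 1) ≤ H j0 := hH.mono (by omega)
      have hmt : t = H (j + 1) ∨ t < H (j + 1) := hle.eq_or_lt
      rcases hmt with h5 | h5
      · exact (hlast h5).1 ⟨j0, by omega, r1, r4.trans hrow.letter.symm⟩
      · omega
    rw [hH.fnum_pword hq hpt hpt' (fun h' => h (hc.1 h')) (by omega) (r4.trans hrow.letter.symm)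
      (fun _ => m2) ?_, fnum_of_not_caes htq h m1 m2
        fun z z1 z2 => m3 z z1 (by omega) (by omega)]
    · omega
    · intro u v huv l1 l2 e1 e2
      obtain ⟨o1, o2, o3⟩ := hH.pt_order hpt' huv l1
      obtain ⟨o4, o5, o6⟩ := hH.pt_order huv hpt l2
      have ha := e1.trans hrow.letter
      have e2 := e2 hrow.letter
      have hvq := (hH.pt_lt hq huv).2
      have hmv : m < v := by
        rcases o1.eq_or_lt with h5 | h5
        · exact o3 h5
        · have : H (j0 + 1) ≤ H u := hH.mono (by omega)
          have := huv.ge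
          omega
      have hvt : v = t := by
        by_contra hne
        exact m3 v hmv hvq hne e2
      subst hvt
      rcases o4.eq_or_lt with h5 | h5
      · have := o6 h5; omega
      · have : H (u + 1) ≤ H j := hH.mono (by omega)
        have := huv.le
        rcases hrow.left with h6 | h6
        · omega
        · exact h6 u h5 ha

/-- The last point of a column `a` and the first point of the next column `a`, for the path in which
the former column is shortened and the latter lengthened: the two faces have opposite signs. -/
theorem fnum_lower (hq : 1 ≤ q) (hH : IsPath a p q V H) (hjj : j < j') (hj' : j' < p)
    (hV : V j = a) (hV' : V j' = a) (hb : ∀ z, j < z → z < j' → V z ≠ a)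
    (hlt : H j < H (j + 1)) :
    Odd (inv p q V W H + fnum (p + q - 1) (pword a p V W H) (j + H (j + 1)) +
      (inv p q V W (lower j j' H) +
        fnum (p + q - 1) (pword a p V W (lower j j' H)) (j' + (H (j + 1) - 1)))) := by
  classical
  have hH' := isPath_lower hH hjj hj' hV hV' hlt
  have hc : ∀ z, j < z → z ≤ j' → H z = H (j + 1) := fun z z1 z2 =>
    hH.const_of (by omega) (by omega) fun w w1 w2 => hb w (by omega) (by omega)
  set t := H (j + 1) with ht
  have hpt : IsPt p H j t := ⟨by omega, hlt.le, le_rfl⟩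
  have hcj : Caes p V j := ⟨j', hjj, hj', hV'.trans hV.symm⟩
  have hx := (hH.caes_iff (W := W) hq hpt).2 (Or.inl ⟨rfl, hcj⟩)
  have l1 : lower j j' H j' = t - 1 := by
    rw [lower, if_pos ⟨hjj, le_rfl⟩, hc j' hjj le_rfl]
  have l2 : t ≤ lower j j' H (j' + 1) := by
    rw [lower, if_neg (by omega), ← hc j' hjj le_rfl]; exact hH.mono (by omega)
  have hpt' : IsPt p (lower j j' H) j' (t - 1) := ⟨hj', l1.le, by omega⟩
  have hx' := hH'.caes_iff (W := W) hq hpt'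
  have hne : t - 1 ≠ lower j j' H (j' + 1) := by omega
  have hlt' : t - 1 < lower j j' H (j' + 1) := by omega
  simp only [hne, hlt', false_and, true_and, false_or] at hx'
  have hi : inv p q V W H + (if Caes q W (t - 1) then 1 else 0) * cnum p V j =
      inv p q V W (lower j j' H) + (if Caes q W (t - 1) then 1 else 0) * cnum p V j' := by
    rw [cnum_eq_sum (by omega), cnum_eq_sum hj'.le, inv, inv, Finset.mul_sum, Finset.mul_sum,
      ← Finset.sum_add_distrib, ← Finset.sum_add_distrib]
    refine Finset.sum_congr rfl fun x _ => ?_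
    by_cases hcx : Caes p V x
    swap
    · simp [hcx]
    simp only [hcx, true_and, if_true]
    by_cases h1 : x < j
    · rw [show lower j j' H (x + 1) = H (x + 1) from if_neg (by omega)]
      simp [h1, h1.trans hjj]
    · by_cases h2 : x < j'
      · rw [show lower j j' H (x + 1) = H (x + 1) - 1 from if_pos (by omega),
          hc (x + 1) (by omega) (by omega)]
        have := cnum_succ (p := q) (V := W) (x := t - 1)
        rw [show t - 1 + 1 = t by omega] at this
        simp [h1, h2, this]
      · rw [show lower j j' H (x + 1) = H (x + 1) from if_neg (by omega)]
        simp [h1, h2]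
  have ct := cnum_succ (p := q) (V := W) (x := t - 1)
  rw [show t - 1 + 1 = t by omega] at ct
  rw [fnum_of_caes hx, hH.cnum_eq hq hpt]
  by_cases h : Caes q W (t - 1)
  · rw [fnum_of_caes (hx'.2 h), hH'.cnum_eq hq hpt']
    rw [if_pos h] at hi ct
    rw [Nat.odd_iff]
    omega
  · have hpt0 : IsPt p (lower j j' H) j (t - 1) := by
      refine ⟨by omega, ?_, ?_⟩
      · rw [lower, if_neg (by omega)]; omega
      · rw [lower, if_pos (by omega)]
    rw [hH'.fnum_pword hq hpt' hpt0 (fun h' => h (hx'.1 h')) (by omega) (hV.trans hV'.symm)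
      (fun _ => rfl)]
    · rw [if_neg h] at hi ct
      rw [Nat.odd_iff]
      omega
    · intro u v huv k1 k2 e1 _
      obtain ⟨o1, o2, o3⟩ := hH'.pt_order hpt0 huv k1
      obtain ⟨o4, o5, o6⟩ := hH'.pt_order huv hpt' k2
      exact hb u (by omega) (by omega) (e1.trans hV')

end FunWord

/-! ### The sum of the faces along all paths -/

namespace FunWord

variable {α β : Type*} {a : α} {p q : ℕ} {V : ℕ → α} {W : ℕ → β} {H : ℕ → ℕ} {x y : ℕ}

theorem finite_isPath (a : α) (p q : ℕ) (V : ℕ → α) : {H | IsPath a p q V H}.Finite := by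
  refine Set.finite_coe_iff.1 (Finite.of_injective (β := Fin p → Fin (q + 1))
    (fun H x => ⟨H.1 x, by have := H.2.le_last x; omega⟩) ?_)
  rintro ⟨H, hH⟩ ⟨H', hH'⟩ h
  refine Subtype.ext (funext fun x => ?_)
  by_cases hx : x < p
  · exact congrArg Fin.val (congrFun h ⟨x, hx⟩)
  · exact (hH.last x (by omega)).trans (hH'.last x (by omega)).symm

/-- The finite set of paths. -/
noncomputable def paths (a : α) (p q : ℕ) (V : ℕ → α) : Finset (ℕ → ℕ) :=
  (finite_isPath a p q V).toFinset

theorem mem_paths : H ∈ paths a p q V ↔ IsPath a p q V H := by simp [paths]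

theorem neg_one_pow_of_odd_add {m n : ℕ} (h : Odd (m + n)) : (-1 : ℤ) ^ m = -(-1) ^ n := by
  have h1 : (-1 : ℤ) ^ m * (-1) ^ n = -1 := by rw [← pow_add]; exact h.neg_one_pow
  have h2 : (-1 : ℤ) ^ n * (-1) ^ n = 1 := by rw [← pow_add, ← two_mul, pow_mul]; simp
  linear_combination (-1 : ℤ) ^ n * h1 - (-1 : ℤ) ^ m * h2

/-- The point `(x, y)` is the last one of a column of a caesura `a`, and not the only one. -/
structure IsUpper (a : α) (p : ℕ) (V : ℕ → α) (H : ℕ → ℕ) (x y : ℕ) : Prop where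
  letter : V x = a
  caes : Caes p V x
  lt : H x < H (x + 1)
  eq : y = H (x + 1)

/-- The point `(x, y)` is the first one of a column of a repeated `a` that is not the first `a`,
and not the only one. -/
structure IsLower (a : α) (V : ℕ → α) (H : ℕ → ℕ) (x y : ℕ) : Prop where
  letter : V x = a
  prev : ∃ z, z < x ∧ V z = a
  lt : H x < H (x + 1)
  eq : y = H x

/-- The column `x` consists of a single point, and its letter is repeated. -/
structure IsCol (p : ℕ) (V : ℕ → α) (H : ℕ → ℕ) (x : ℕ) : Prop where
  eq : H (x + 1) = H x
  rep : Rep p V x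

/-- The point `(x, y)` belongs to a repeated letter of `W` and can be deleted together with its
row. -/
structure IsRepRow (a : α) (p q : ℕ) (V : ℕ → α) (W : ℕ → β) (H : ℕ → ℕ) (x y : ℕ) : Prop where
  row : IsRow a p V H x y
  rep : Rep q W y

theorem IsCol.rep_pword (hq : 1 ≤ q) (hH : IsPath a p q V H) (hpt : IsPt p H x y)
    (h : IsCol p V H x) : Rep (p + q - 1) (pword a p V W H) (x + y) := by
  obtain ⟨h1, h2⟩ := h
  obtain ⟨p1, p2, p3⟩ := hpt
  by_cases hc : Caes p V x
  · exact Caes.rep ((hH.caes_iff hq ⟨p1, p2, p3⟩).2 (Or.inl ⟨by omega, hc⟩))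
  · obtain ⟨m1, m2, m3⟩ := mark_spec h2 hc
    rw [hH.rep_iff hq ⟨p1, p2, p3⟩]
    refine ⟨mark p V x, H (mark p V x + 1), ⟨by omega, hH.mono (by omega), le_rfl⟩,
      Or.inl (by omega), m2, fun ha => ?_⟩
    have : H x = H (mark p V x + 1) := hH.const_of (by omega) (by omega) fun z z1 z2 hz =>
      m3 z (by omega) (by omega) (by omega) (hz.trans ha.symm)
    rw [← this]; congr 1; omega

theorem IsUpper.rep_pword (hq : 1 ≤ q) (hH : IsPath a p q V H) (hpt : IsPt p H x y)
    (h : IsUpper a p V H x y) : Rep (p + q - 1) (pword a p V W H) (x + y) :=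
  Caes.rep ((hH.caes_iff hq hpt).2 (Or.inl ⟨h.eq, h.caes⟩))

theorem IsLower.rep_pword (hq : 1 ≤ q) (hH : IsPath a p q V H) (hpt : IsPt p H x y)
    (h : IsLower a V H x y) : Rep (p + q - 1) (pword a p V W H) (x + y) := by
  obtain ⟨h1, ⟨z, z1, z2⟩, h3, rfl⟩ := h
  have hlt := hpt.lt
  obtain ⟨w, w1, w2, w3⟩ := exists_prev (V := V) (x := x) ⟨z, z1, z2.trans h1.symm⟩
  have : H x = H (w + 1) := hH.const_of (by omega) hlt.le fun u u1 u2 hu =>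
    w3 u (by omega) u2 (hu.trans h1.symm)
  rw [hH.rep_iff hq hpt]
  exact ⟨w, H x, ⟨by omega, hH.mono w1.le, this.le⟩, Or.inl (by omega), w2, fun _ => rfl⟩

theorem IsRepRow.rep_pword (hq : 1 ≤ q) (hH : IsPath a p q V H) (hpt : IsPt p H x y)
    (h : IsRepRow a p q V W H x y) : Rep (p + q - 1) (pword a p V W H) (x + y) := by
  obtain ⟨⟨r1, r2, r3, r4⟩, ⟨z, z1, z2, z3⟩⟩ := h
  have hyq := (hH.pt_lt hq hpt).2
  rw [hH.rep_iff hq hpt]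
  have key : ∃ u, IsPt p H u z ∧ V u = a := by
    by_cases hz : z = 0
    · obtain ⟨u, u1, u2, u3, u4⟩ := hH.exists_rise (y := 0) (by omega)
      exact ⟨u, ⟨u1, by omega, by omega⟩, u4⟩
    · obtain ⟨u, u1, u2, u3, u4⟩ := hH.exists_rise (y := z - 1) (by omega)
      exact ⟨u, ⟨u1, by omega, by omega⟩, u4⟩
  obtain ⟨u, hu, hVu⟩ := key
  exact ⟨u, z, hu, Or.inr z1, hVu.trans r1.symm, fun _ => z3⟩

/-- The four kinds of points of repeated letters. -/
theorem rep_cases (hq : 1 ≤ q) (hH : IsPath a p q V H) (hpt : IsPt p H x y)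
    (hr : Rep (p + q - 1) (pword a p V W H) (x + y)) :
    IsCol p V H x ∨ IsRepRow a p q V W H x y ∨ IsUpper a p V H x y ∨ IsLower a V H x y := by
  rw [hH.rep_iff hq hpt] at hr
  obtain ⟨x', y', h', h1, h2, h3⟩ := hr
  have hge := hpt.ge
  have hle := hpt.le
  have hge' := h'.ge
  have hle' := h'.le
  by_cases he : H (x + 1) = H x
  · refine Or.inl ⟨he, x', ?_, h'.lt, h2⟩
    rintro rfl; omega
  · have hlt : H x < H (x + 1) := by have : H x ≤ H (x + 1) := hH.mono (by omega); omega
    have ha := hH.eq_of_lt hpt.lt hlt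
    by_cases hU : IsUpper a p V H x y
    · exact Or.inr (Or.inr (Or.inl hU))
    by_cases hL : IsLower a V H x y
    · exact Or.inr (Or.inr (Or.inr hL))
    refine Or.inr (Or.inl ⟨⟨ha, hlt, ?_, ?_⟩, ⟨y', ?_, (hH.pt_lt hq h').2, h3 ha⟩⟩)
    · by_contra! hcon
      exact hU ⟨ha, hcon.2, hlt, by omega⟩
    · by_contra! hcon
      exact hL ⟨ha, hcon.2, hlt, by omega⟩
    · rintro rfl
      have hx : x' ≠ x := by simpa using h1
      rcases lt_or_gt_of_ne hx with h | h
      · have : H (x' + 1) ≤ H x := hH.mono (by omega)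
        exact hL ⟨ha, ⟨x', h, h2.trans ha⟩, hlt, by omega⟩
      · have : H (x + 1) ≤ H x' := hH.mono (by omega)
        exact hU ⟨ha, ⟨x', h, h'.lt, h2⟩, hlt, by omega⟩

/-- The four kinds of points exclude each other. -/
theorem sum_rep_cases {A : Type*} [AddCommMonoid A] (hq : 1 ≤ q) (hH : IsPath a p q V H)
    (hpt : IsPt p H x y) (F : A) :
    open Classical in
    (if Rep (p + q - 1) (pword a p V W H) (x + y) then F else 0) =
      (if IsCol p V H x then F else 0) + (if IsRepRow a p q V W H x y then F else 0) +
        ((if IsUpper a p V H x y then F else 0) + if IsLower a V H x y then F else 0) := by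
  classical
  have e1 : IsCol p V H x → ¬ IsUpper a p V H x y := fun h h' => by
    have := h.eq; have := h'.lt; omega
  have e2 : IsCol p V H x → ¬ IsLower a V H x y := fun h h' => by
    have := h.eq; have := h'.lt; omega
  have e3 : IsCol p V H x → ¬ IsRepRow a p q V W H x y := fun h h' => by
    have := h.eq; have := h'.row.lt; omega
  have e4 : IsUpper a p V H x y → ¬ IsLower a V H x y := fun h h' => by
    have := h.eq; have := h'.eq; have := h.lt; omega
  have e5 : IsUpper a p V H x y → ¬ IsRepRow a p q V W H x y := fun h h' => by
    have := h.eq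
    rcases h'.row.right with h1 | h1
    · omega
    · exact h1 h.caes
  have e6 : IsLower a V H x y → ¬ IsRepRow a p q V W H x y := fun h h' => by
    have := h.eq
    obtain ⟨z, z1, z2⟩ := h.prev
    rcases h'.row.left with h1 | h1
    · omega
    · exact h1 z z1 z2
  by_cases hr : Rep (p + q - 1) (pword a p V W H) (x + y)
  · rw [if_pos hr]
    rcases rep_cases hq hH hpt hr with h | h | h | h
    · simp [h, e1 h, e2 h, e3 h]
    · have n1 : ¬ IsCol p V H x := fun h' => e3 h' h
      have n2 : ¬ IsUpper a p V H x y := fun h' => e5 h' h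
      have n3 : ¬ IsLower a V H x y := fun h' => e6 h' h
      simp [h, n1, n2, n3]
    · have n1 : ¬ IsCol p V H x := fun h' => e1 h' h
      simp [h, n1, e4 h, e5 h]
    · have n1 : ¬ IsCol p V H x := fun h' => e2 h' h
      have n2 : ¬ IsUpper a p V H x y := fun h' => e4 h' h
      simp [h, n1, n2, e6 h]
  · have n1 : ¬ IsCol p V H x := fun h => hr (h.rep_pword hq hH hpt)
    have n2 : ¬ IsUpper a p V H x y := fun h => hr (h.rep_pword hq hH hpt)
    have n3 : ¬ IsLower a V H x y := fun h => hr (h.rep_pword hq hH hpt)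
    have n4 : ¬ IsRepRow a p q V W H x y := fun h => hr (h.rep_pword hq hH hpt)
    simp [hr, n1, n2, n3, n4]

/-- The face of the word along the path `H` at the `k`-th point, with the product of the sign of the
path and the sign of the face. The map `φ` sends words to elements of an abelian group. -/
noncomputable def faceTerm {A : Type*} [AddCommGroup A] (φ : List (α ⊕ β) → A) (a : α) (p q : ℕ)
    (V : ℕ → α) (W : ℕ → β) (H : ℕ → ℕ) (k : ℕ) : A :=
  (-1 : ℤ) ^ (inv p q V W H + fnum (p + q - 1) (pword a p V W H) k) •
    φ ((List.range (p + q - 1 - 1)).map (pword a p V W H ∘ skip k))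

/-- The sum of the images under `φ` of the words along all paths, with the signs of the paths. -/
noncomputable def pathSum {A : Type*} [AddCommGroup A] (φ : List (α ⊕ β) → A) (a : α) (p q : ℕ)
    (V : ℕ → α) (W : ℕ → β) : A :=
  ∑ H ∈ paths a p q V, (-1 : ℤ) ^ inv p q V W H •
    φ ((List.range (p + q - 1)).map (pword a p V W H))

open Classical in
/-- Pairs of a path and one of its points. -/
noncomputable def pts (a : α) (p q : ℕ) (V : ℕ → α) : Finset ((ℕ → ℕ) × ℕ × ℕ) :=
  (paths a p q V ×ˢ (Finset.range p ×ˢ Finset.range q)).filter fun d => IsPt p d.1 d.2.1 d.2.2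

theorem mem_pts (hq : 1 ≤ q) {d : (ℕ → ℕ) × ℕ × ℕ} :
    d ∈ pts a p q V ↔ IsPath a p q V d.1 ∧ IsPt p d.1 d.2.1 d.2.2 := by
  unfold pts
  simp only [Finset.mem_filter, Finset.mem_product, mem_paths, Finset.mem_range]
  exact ⟨fun h => ⟨h.1.1, h.2⟩, fun h => ⟨⟨h.1, h.2.lt, (h.1.pt_lt hq h.2).2⟩, h.2⟩⟩

variable {A : Type*} [AddCommGroup A] (φ : List (α ⊕ β) → A)

open Classical in
/-- The points of a path `H` are numbered by `x + y`. -/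
theorem sum_pts (hq : 1 ≤ q) (F : (ℕ → ℕ) → ℕ → A) :
    ∑ H ∈ paths a p q V, ∑ k ∈ Finset.range (p + q - 1), F H k =
      ∑ d ∈ pts a p q V, F d.1 (d.2.1 + d.2.2) := by
  unfold pts
  rw [Finset.sum_filter, Finset.sum_product]
  refine Finset.sum_congr rfl fun H hH => ?_
  have hH := mem_paths.1 hH
  rw [← Finset.sum_filter]
  symm
  refine Finset.sum_bij (fun d _ => d.1 + d.2) ?_ ?_ ?_ fun _ _ => rfl
  · rintro ⟨x, y⟩ hd
    simp only [Finset.mem_filter] at hd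
    exact Finset.mem_range.2 (hH.pt_lt hq hd.2).1
  · rintro ⟨x, y⟩ hd ⟨x', y'⟩ hd' e
    simp only [Finset.mem_filter] at hd hd' e
    obtain ⟨rfl, rfl⟩ := hH.pt_unique hd.2 hd'.2 e
    rfl
  · intro k hk
    obtain ⟨x, y, h, rfl⟩ := hH.exists_pt (Finset.mem_range.1 hk)
    exact ⟨(x, y), by simp [h, h.lt, (hH.pt_lt hq h).2], rfl⟩

open Classical in
/-- The points whose column can be deleted give the faces of `V`. -/
theorem sum_col (hp : 1 ≤ p) (hq : 1 ≤ q) :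
    ∑ d ∈ pts a p q V with IsCol p V d.1 d.2.1, faceTerm φ a p q V W d.1 (d.2.1 + d.2.2) =
      ∑ j ∈ Finset.range p with Rep p V j,
        (-1 : ℤ) ^ fnum p V j • pathSum φ a (p - 1) q (V ∘ skip j) W := by
  simp only [pathSum, Finset.smul_sum]
  rw [Finset.sum_sigma']
  refine Finset.sum_bij' (fun d _ => ⟨d.2.1, delCol d.2.1 d.1⟩)
    (fun e _ => (insCol e.1 e.2, e.1, e.2 e.1)) ?_ ?_ ?_ ?_ ?_
  · rintro ⟨H, x, y⟩ hd
    simp only [Finset.mem_filter, mem_pts hq, Finset.mem_sigma, Finset.mem_range, mem_paths] at hd ⊢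
    exact ⟨⟨hd.1.2.lt, hd.2.rep⟩, isPath_delCol hd.1.1 hd.1.2.lt hd.2.eq⟩
  · rintro ⟨j, H⟩ he
    simp only [Finset.mem_filter, mem_pts hq, Finset.mem_sigma, Finset.mem_range, mem_paths] at he ⊢
    exact ⟨⟨isPath_insCol he.2 he.1.1, he.1.1, insCol_self.le, by rw [insCol_succ, insCol_self]⟩,
      insCol_succ, he.1.2⟩
  · rintro ⟨H, x, y⟩ hd
    simp only [Finset.mem_filter, mem_pts hq] at hd
    have h1 := hd.1.2.ge
    have h2 := hd.1.2.le
    have h3 := hd.2.eq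
    simp only [insCol_delCol h3, delCol, le_refl, if_true, Prod.mk.injEq, true_and]
    omega
  · rintro ⟨j, H⟩ _
    simp only [delCol_insCol]
  · rintro ⟨H, x, y⟩ hd
    simp only [Finset.mem_filter, mem_pts hq] at hd
    obtain ⟨⟨hH, hpt⟩, hc⟩ := hd
    have hy : y = H x := by have := hpt.ge; have := hpt.le; have := hc.eq; omega
    subst hy
    simp only [faceTerm]
    rw [fnum_col hq hH hpt.lt hc.eq hc.rep, pow_add _ _ (2 * _), pow_mul, neg_one_sq, one_pow,
      mul_one, pow_add, mul_smul, show p - 1 + q - 1 = p + q - 1 - 1 by omega]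
    congr 3
    exact List.map_congr_left fun k hk => pword_delCol hH hpt.lt hc.eq (List.mem_range.1 hk)

/-- The column that is to be lengthened by the row `t`: the first column with letter `a` that
reaches height `t`, or the last column with letter `a` if there is none. -/
theorem exists_insert {t : ℕ} (ha : ∃ j, j < p ∧ V j = a) :
    ∃ j, j < p ∧ V j = a ∧ (t ≤ H (j + 1) ∨ ¬ Caes p V j) ∧
      ∀ z, z < j → V z = a → ¬ (t ≤ H (z + 1) ∨ ¬ Caes p V z) := by
  classical
  have hex : ∃ j, j < p ∧ V j = a ∧ (t ≤ H (j + 1) ∨ ¬ Caes p V j) := by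
    let S := (Finset.range p).filter fun j => V j = a
    have hS : S.Nonempty := by obtain ⟨j, h1, h2⟩ := ha; exact ⟨j, by simp [S, h1, h2]⟩
    obtain ⟨j, hj, hmax⟩ := S.exists_max_image id hS
    simp only [S, Finset.mem_filter, Finset.mem_range, id] at hj hmax
    refine ⟨j, hj.1, hj.2, Or.inr ?_⟩
    rintro ⟨z, z1, z2, z3⟩
    have := hmax z ⟨z2, z3.trans hj.2⟩
    omega
  obtain ⟨h1, h2, h3⟩ := Nat.find_spec hex
  refine ⟨Nat.find hex, h1, h2, h3, fun z z1 z2 z3 => Nat.find_min hex z1 ⟨by omega, z2, z3⟩⟩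

open Classical in
/-- The points whose row can be deleted give the faces of `W`. -/
theorem sum_row (hq : 1 ≤ q) (ha : ∃ j, j < p ∧ V j = a) :
    ∑ d ∈ pts a p q V with IsRepRow a p q V W d.1 d.2.1 d.2.2,
        faceTerm φ a p q V W d.1 (d.2.1 + d.2.2) =
      ∑ t ∈ Finset.range q with Rep q W t,
        (-1 : ℤ) ^ (cnum p V p + fnum q W t) • pathSum φ a p (q - 1) V (W ∘ skip t) := by
  simp only [pathSum, Finset.smul_sum]
  rw [Finset.sum_sigma']
  refine Finset.sum_bij (fun d _ => ⟨d.2.2, delRow d.2.1 d.1⟩) ?_ ?_ ?_ ?_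
  · rintro ⟨H, x, y⟩ hd
    simp only [Finset.mem_filter, mem_pts hq, Finset.mem_sigma, Finset.mem_range, mem_paths] at hd ⊢
    exact ⟨⟨(hd.1.1.pt_lt hq hd.1.2).2, hd.2.rep⟩,
      isPath_delRow hd.1.1 hd.1.2.lt hd.2.row.letter hd.2.row.lt⟩
  · rintro ⟨H, x, t⟩ hd ⟨H', x', t'⟩ hd' e
    simp only [Finset.mem_filter, mem_pts hq] at hd hd'
    simp only [Sigma.mk.injEq, heq_eq_eq] at e
    obtain ⟨rfl, e⟩ := e
    obtain ⟨⟨hH, hpt⟩, ⟨r1, r2, r3, r4⟩, -⟩ := hd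
    obtain ⟨⟨hH', hpt'⟩, ⟨s1, s2, s3, s4⟩, -⟩ := hd'
    -- the deleted row determines the column, as the one found by `exists_insert`
    have hx : x = x' := by
      rcases lt_trichotomy x x' with h | h | h
      · exfalso
        have h1 : t < H (x + 1) := r3.resolve_right fun hn => hn ⟨x', h, hpt'.lt, s1.trans r1.symm⟩
        have h2 : H' x' < t := s4.resolve_right fun hn => hn x h r1
        have e1 := congrFun e (x + 1)
        simp only [delRow] at e1
        rw [if_neg (by omega), if_pos (by omega)] at e1
        have : H' (x + 1) ≤ H' x' := hH'.mono h
        omega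
      · exact h
      · exfalso
        have h1 : t < H' (x' + 1) := s3.resolve_right fun hn => hn ⟨x, h, hpt.lt, r1.trans s1.symm⟩
        have h2 : H x < t := r4.resolve_right fun hn => hn x' h s1
        have e1 := congrFun e (x' + 1)
        simp only [delRow] at e1
        rw [if_pos (by omega), if_neg (by omega)] at e1
        have : H (x' + 1) ≤ H x := hH.mono h
        omega
    subst hx
    have : H = H' := by rw [← insRow_delRow hH r2, ← insRow_delRow hH' s2, e]
    rw [this]
  · rintro ⟨t, H⟩ he
    simp only [Finset.mem_filter, Finset.mem_sigma, Finset.mem_range, mem_paths] at he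
    obtain ⟨⟨ht, hr⟩, hH⟩ := he
    have hq2 : 2 ≤ q := by obtain ⟨z, z1, z2, -⟩ := hr; omega
    obtain ⟨j, j1, j2, j3, j4⟩ := exists_insert (H := H) (t := t) ha
    have hm : H j ≤ H (j + 1) := hH.mono (by omega)
    have e1 : insRow j H j = H j := if_pos le_rfl
    have e2 : insRow j H (j + 1) = H (j + 1) + 1 := if_neg (by omega)
    have hlow : H j < t ∨ ∀ z, z < j → V z ≠ a := by
      by_contra! hcon
      obtain ⟨h1, z, z1, z2⟩ := hcon
      obtain ⟨w, w1, w2, w3⟩ := exists_prev (V := V) (x := j) ⟨z, z1, z2.trans j2.symm⟩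
      have h4 := j4 w w1 (w2.trans j2)
      have : H j = H (w + 1) := hH.const_of (by omega) j1.le fun u u1 u2 hu =>
        w3 u (by omega) u2 (hu.trans j2.symm)
      exact h4 (Or.inl (by omega))
    have hlo : H j ≤ t := by
      rcases hlow with h | h
      · exact h.le
      · have : H j = H 0 := hH.const_of (by omega) j1.le fun u _ u2 => h u u2
        rw [this, hH.zero]; omega
    have hhi : t ≤ H (j + 1) + 1 := by
      rcases j3 with h | h
      · omega
      · have : H p = H (j + 1) := hH.const_of (by omega) le_rfl fun u u1 u2 hu =>
          h ⟨u, by omega, u2, hu.trans j2.symm⟩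
        rw [hH.last p le_rfl] at this
        omega
    refine ⟨(insRow j H, j, t), ?_, by simp only [delRow_insRow]⟩
    simp only [Finset.mem_filter, mem_pts hq]
    refine ⟨⟨isPath_insRow hH j1 j2 hq2, j1, by omega, by omega⟩, ⟨j2, by omega, ?_, ?_⟩, hr⟩
    · rcases j3 with h | h
      · left; omega
      · exact Or.inr h
    · rw [e1]; exact hlow
  · rintro ⟨H, x, t⟩ hd
    simp only [Finset.mem_filter, mem_pts hq] at hd
    obtain ⟨⟨hH, hpt⟩, hc⟩ := hd
    have hq2 : 2 ≤ q := by
      obtain ⟨z, z1, z2, -⟩ := hc.rep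
      have := (hH.pt_lt hq hpt).2
      omega
    simp only [faceTerm]
    rw [fnum_row hH hpt hc.row (hH.pt_lt hq hpt).2 hc.rep, pow_add _ (_ + _), mul_smul,
      show p + (q - 1) - 1 = p + q - 1 - 1 by omega]
    congr 3
    exact List.map_congr_left fun k hk => pword_delRow hH hpt hc.row (List.mem_range.1 hk) hq2

/-- The next occurrence of `a` after position `x`; used only if there is one. -/
noncomputable def nextOcc (a : α) (V : ℕ → α) (x : ℕ) : ℕ := sInf {z | x < z ∧ V z = a}

theorem nextOcc_eq (h1 : x < y) (h2 : V y = a) (h3 : ∀ z, x < z → z < y → V z ≠ a) :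
    nextOcc a V x = y := by
  refine le_antisymm (Nat.sInf_le ⟨h1, h2⟩) ?_
  by_contra hlt
  obtain ⟨m1, m2⟩ := Nat.sInf_mem (s := {z | x < z ∧ V z = a}) ⟨y, h1, h2⟩
  exact h3 _ m1 (not_le.1 hlt) m2

theorem nextOcc_spec (h : Caes p V x) (hx : V x = a) :
    x < nextOcc a V x ∧ nextOcc a V x < p ∧ V (nextOcc a V x) = a ∧
      ∀ z, x < z → z < nextOcc a V x → V z ≠ a := by
  obtain ⟨y, y1, y2, y3⟩ := h
  obtain ⟨z, z1, z2, z3, z4⟩ := exists_next (V := V) ⟨y, y1, y2, y3.trans hx⟩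
  rw [nextOcc_eq z1 z3 z4]
  exact ⟨z1, z2, z3, z4⟩

open Classical in
/-- The remaining points cancel in pairs: the last point of the column of a caesura `a` is matched
with the first point of the next column `a`, for the path in which this column is lengthened and the
former one shortened. -/
theorem sum_upper_add_sum_lower (hq : 1 ≤ q) :
    ∑ d ∈ pts a p q V with IsUpper a p V d.1 d.2.1 d.2.2,
        faceTerm φ a p q V W d.1 (d.2.1 + d.2.2) +
      ∑ d ∈ pts a p q V with IsLower a V d.1 d.2.1 d.2.2,
        faceTerm φ a p q V W d.1 (d.2.1 + d.2.2) = 0 := by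
  rw [add_eq_zero_iff_eq_neg, ← Finset.sum_neg_distrib]
  refine Finset.sum_bij (fun d _ => (lower d.2.1 (nextOcc a V d.2.1) d.1,
    nextOcc a V d.2.1, d.2.2 - 1)) ?_ ?_ ?_ ?_
  · rintro ⟨H, x, y⟩ hd
    simp only [Finset.mem_filter, mem_pts hq] at hd ⊢
    obtain ⟨⟨hH, hpt⟩, ⟨u1, u2, u3, rfl⟩⟩ := hd
    obtain ⟨n1, n2, n3, n4⟩ := nextOcc_spec u2 u1
    set x' := nextOcc a V x
    have e1 : lower x x' H x' = H x' - 1 := if_pos ⟨n1, le_rfl⟩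
    have e2 : lower x x' H (x' + 1) = H (x' + 1) := if_neg (by omega)
    have e3 : H x' = H (x + 1) := hH.const_of (by omega) n2.le fun z z1 z2 => n4 z (by omega) z2
    have e4 : H x' ≤ H (x' + 1) := hH.mono (by omega)
    exact ⟨⟨isPath_lower hH n1 n2 u1 n3 u3, n2, by omega, by omega⟩,
      n3, ⟨x, n1, u1⟩, by omega, by omega⟩
  · rintro ⟨H, x, y⟩ hd ⟨H', x', y'⟩ hd' e
    simp only [Finset.mem_filter, mem_pts hq] at hd hd'
    simp only [Prod.mk.injEq] at e
    obtain ⟨⟨hH, hpt⟩, ⟨u1, u2, u3, u4⟩⟩ := hd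
    obtain ⟨⟨hH', hpt'⟩, ⟨v1, v2, v3, v4⟩⟩ := hd'
    obtain ⟨e1, e2, e3⟩ := e
    obtain ⟨n1, n2, n3, n4⟩ := nextOcc_spec u2 u1
    obtain ⟨m1, m2, m3, m4⟩ := nextOcc_spec v2 v1
    have hx : x = x' := by
      rcases lt_trichotomy x x' with h | h | h
      · exact absurd v1 (n4 x' h (by omega))
      · exact h
      · exact absurd u1 (m4 x h (by omega))
    subst hx
    have : H = H' := by rw [← raise_lower hH u3, ← raise_lower hH' v3, e1]
    subst this
    rw [u4, v4]
  · rintro ⟨H, x', y⟩ hd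
    simp only [Finset.mem_filter, mem_pts hq] at hd
    obtain ⟨⟨hH, hpt⟩, ⟨u1, ⟨z, z1, z2⟩, u3, rfl⟩⟩ := hd
    have hx' := hpt.lt
    obtain ⟨x, n1, n2, n3⟩ := exists_prev (V := V) (x := x') ⟨z, z1, z2.trans u1.symm⟩
    simp only [u1] at n2 n3
    have hn : nextOcc a V x = x' := nextOcc_eq n1 u1 n3
    have e1 : raise x x' H x = H x := if_neg (by omega)
    have e2 : raise x x' H (x + 1) = H (x + 1) + 1 := if_pos (by omega)
    have e3 : H x' = H (x + 1) := hH.const_of (by omega) hx'.le fun z z1 z2 => n3 z (by omega) z2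
    have e4 : H x ≤ H (x + 1) := hH.mono (by omega)
    refine ⟨(raise x x' H, x, H x' + 1), ?_, ?_⟩
    · simp only [Finset.mem_filter, mem_pts hq]
      exact ⟨⟨isPath_raise hH hx' n2 u1 u3, by omega, by omega, by omega⟩,
        n2, ⟨x', n1, hx', u1.trans n2.symm⟩, by omega, by omega⟩
    · simp only [hn, lower_raise, Nat.add_sub_cancel]
  · rintro ⟨H, x, y⟩ hd
    simp only [Finset.mem_filter, mem_pts hq] at hd
    obtain ⟨⟨hH, hpt⟩, ⟨u1, u2, u3, rfl⟩⟩ := hd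
    obtain ⟨n1, n2, n3, n4⟩ := nextOcc_spec u2 u1
    simp only [faceTerm]
    rw [neg_one_pow_of_odd_add (fnum_lower (W := W) hq hH n1 n2 u1 n3 n4 u3), neg_smul]
    congr 3
    exact List.map_congr_left fun k hk => pword_lower hH n1 n2 u1 n3 n4 u3 (List.mem_range.1 hk)

open Classical in
/-- The faces of the words along the paths for `V` and `W` are the words along the paths for the
faces of `V` and `W`. -/
theorem sum_faceTerm (hp : 1 ≤ p) (hq : 1 ≤ q) (ha : ∃ j, j < p ∧ V j = a) :
    ∑ H ∈ paths a p q V, ∑ k ∈ Finset.range (p + q - 1) with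
        Rep (p + q - 1) (pword a p V W H) k, faceTerm φ a p q V W H k =
      ∑ j ∈ Finset.range p with Rep p V j,
        (-1 : ℤ) ^ fnum p V j • pathSum φ a (p - 1) q (V ∘ skip j) W +
      ∑ t ∈ Finset.range q with Rep q W t,
        (-1 : ℤ) ^ (cnum p V p + fnum q W t) • pathSum φ a p (q - 1) V (W ∘ skip t) := by
  simp only [Finset.sum_filter (fun k => Rep _ _ k)]
  rw [sum_pts hq fun H k => if Rep (p + q - 1) (pword a p V W H) k then
    faceTerm φ a p q V W H k else 0]
  rw [Finset.sum_congr rfl fun d hd => sum_rep_cases hq ((mem_pts hq).1 hd).1 ((mem_pts hq).1 hd).2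
    (faceTerm φ a p q V W d.1 (d.2.1 + d.2.2))]
  rw [Finset.sum_add_distrib, Finset.sum_add_distrib, Finset.sum_add_distrib,
    ← Finset.sum_filter, ← Finset.sum_filter, ← Finset.sum_filter, ← Finset.sum_filter,
    sum_col φ hp hq, sum_row φ hq ha, sum_upper_add_sum_lower φ hq, add_zero,
    Finset.sum_filter, Finset.sum_filter]

end FunWord

/-! ### The words of the operad as functions -/

namespace FunWord

variable {α β γ : Type*}

theorem getElem?_map_range (x : ℕ → γ) (N i : ℕ) :
    ((List.range N).map x)[i]? = if i < N then some (x i) else none := by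
  simp only [List.getElem?_map]
  split_ifs with h
  · rw [List.getElem?_range h]; rfl
  · rw [List.getElem?_eq_none (by simpa using h)]; rfl

theorem eraseIdx_map_range (x : ℕ → γ) {N i : ℕ} (hi : i < N) :
    ((List.range N).map x).eraseIdx i = (List.range (N - 1)).map (x ∘ skip i) := by
  apply List.ext_getElem?
  intro k
  rw [List.getElem?_eraseIdx, getElem?_map_range, getElem?_map_range, getElem?_map_range]
  unfold skip
  simp only [Function.comp]
  split_ifs <;> first | rfl | omega

section congruence

variable {N : ℕ} {x : ℕ → γ} {x' : ℕ → α}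
  (h : ∀ i j, i < N → j < N → (x i = x j ↔ x' i = x' j))
include h

theorem caes_congr {i : ℕ} : Caes N x i ↔ Caes N x' i := by
  constructor
  · rintro ⟨y, h1, h2, h3⟩; exact ⟨y, h1, h2, (h y i h2 (by omega)).1 h3⟩
  · rintro ⟨y, h1, h2, h3⟩; exact ⟨y, h1, h2, (h y i h2 (by omega)).2 h3⟩

theorem rep_congr {i : ℕ} (hi : i < N) : Rep N x i ↔ Rep N x' i := by
  constructor
  · rintro ⟨y, h1, h2, h3⟩; exact ⟨y, h1, h2, (h y i h2 hi).1 h3⟩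
  · rintro ⟨y, h1, h2, h3⟩; exact ⟨y, h1, h2, (h y i h2 hi).2 h3⟩

theorem cnum_congr (i : ℕ) : cnum N x i = cnum N x' i := by
  classical
  induction i with
  | zero => simp [cnum_zero]
  | succ i ih => rw [cnum_succ, cnum_succ, ih]; simp only [caes_congr h]

theorem fnum_congr {i : ℕ} (hi : i < N) : fnum N x i = fnum N x' i := by
  classical
  have hp : prv x i = prv x' i := by
    unfold prv
    congr 1
    refine Finset.filter_congr fun j hj => h j i ?_ hi
    have := Finset.mem_range.1 hj; omega
  unfold fnum mark
  rw [cnum_congr h, hp]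
  simp only [caes_congr h]

end congruence

section bridge

variable {n : ℕ} {W : SWord n} {N : ℕ} {x : ℕ → Fin n} (hx : W.letters = (List.range N).map x)
include hx

theorem getElem?_letters {i : ℕ} (hi : i < N) : W.letters[i]? = some (x i) := by
  rw [hx, getElem?_map_range, if_pos hi]

theorem length_letters : W.letters.length = N := by rw [hx]; simp

theorem pos_length : 1 ≤ N := by
  have h1 := length_letters hx
  have := List.length_pos_iff.2 W.nonempty
  omega

theorem first_eq : W.first = x 0 := by
  have h := getElem?_letters hx (pos_length hx)
  unfold SWord.first
  rw [List.head_eq_iff_head?_eq_some, List.head?_eq_getElem?]; exact h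

theorem isCaesura_iff (i : ℕ) : W.IsCaesura i ↔ Caes N x i := by
  unfold SWord.IsCaesura
  constructor
  · rintro ⟨u, h1, h2⟩
    obtain ⟨k, hk⟩ := List.mem_iff_getElem?.1 h1
    rw [List.getElem?_drop, hx, getElem?_map_range] at hk
    rw [hx, getElem?_map_range] at h2
    split_ifs at hk h2 with h3 h4
    simp only [Option.some.injEq] at hk h2
    exact ⟨i + 1 + k, by omega, h3, by rw [hk, h2]⟩
  · rintro ⟨y, h1, h2, h3⟩
    refine ⟨x i, ?_, getElem?_letters hx (by omega)⟩
    rw [List.mem_iff_getElem?]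
    refine ⟨y - (i + 1), ?_⟩
    rw [List.getElem?_drop, show i + 1 + (y - (i + 1)) = y by omega, getElem?_letters hx h2, h3]

theorem caesuraNumber_eq (i : ℕ) : W.caesuraNumber i = cnum N x (i + 1) := by
  classical
  unfold SWord.caesuraNumber cnum
  rw [Nat.count_eq_card_filter_range]
  congr 1
  ext j
  simp only [Finset.mem_filter, isCaesura_iff hx]

theorem prevOcc_eq {i : ℕ} (hi : i < N) : W.prevOcc i = prv x i := by
  classical
  unfold SWord.prevOcc prv
  congr 1
  ext j
  simp only [Finset.mem_filter, Finset.mem_range]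
  refine and_congr_right fun hj => ?_
  rw [getElem?_letters hx hi, getElem?_letters hx (by omega), Option.some.injEq]

theorem faceNumber_eq {i : ℕ} (hi : i < N) : W.faceNumber i = fnum N x i := by
  classical
  unfold SWord.faceNumber fnum mark
  simp only [caesuraNumber_eq hx, prevOcc_eq hx hi, isCaesura_iff hx]
  split_ifs <;> rfl

theorem repeated_iff {i : ℕ} (hi : i < N) : W.Repeated (x i) ↔ Rep N x i := by
  have hl : i < W.letters.length := by rw [length_letters hx]; exact hi
  have he : W.letters[i] = x i := by
    have := getElem?_letters hx hi
    rwa [List.getElem?_eq_getElem hl, Option.some.injEq] at this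
  have hperm := (List.getElem_cons_eraseIdx_perm hl).count_eq (x i)
  rw [he, List.count_cons_self] at hperm
  unfold SWord.Repeated
  have h2 : 2 ≤ W.letters.count (x i) ↔ x i ∈ W.letters.eraseIdx i := by
    rw [← List.count_pos_iff]; omega
  rw [h2, hx, eraseIdx_map_range x hi]
  simp only [List.mem_map, List.mem_range, Function.comp]
  constructor
  · rintro ⟨k, hk, e⟩; exact ⟨skip i k, skip_ne _ _, skip_lt hk, e⟩
  · rintro ⟨y, h1, h2, h3⟩
    obtain ⟨k, hk, rfl⟩ := exists_skip hi h2 h1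
    exact ⟨k, hk, h3⟩

theorem chain_ne {i : ℕ} (hi : i + 1 < N) : x i ≠ x (i + 1) := by
  have hl : i + 1 < W.letters.length := by rw [length_letters hx]; exact hi
  have := List.isChain_iff_getElem.1 W.nondegenerate i hl
  have e1 := getElem?_letters hx (i := i) (by omega)
  have e2 := getElem?_letters hx hi
  rw [List.getElem?_eq_getElem (by omega), Option.some.injEq] at e1 e2
  rwa [e1, e2] at this

theorem exists_letter (u : Fin n) : ∃ i, i < N ∧ x i = u := by
  have := W.surjective u
  rw [hx] at this
  simpa using this

omit hx in
/-- Subsequences of length four, in terms of positions. -/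
theorem sublist_four {x : ℕ → γ} {N : ℕ} {u v : γ} :
    [u, v, u, v].Sublist ((List.range N).map x) ↔
      ∃ i j k l, i < j ∧ j < k ∧ k < l ∧ l < N ∧ x i = u ∧ x j = v ∧ x k = u ∧ x l = v := by
  constructor
  · intro h
    obtain ⟨f, hf⟩ := List.sublist_iff_exists_orderEmbedding_getElem?_eq.1 h
    have h0 := hf 0; have h1 := hf 1; have h2 := hf 2; have h3 := hf 3
    rw [getElem?_map_range] at h0 h1 h2 h3
    simp only [List.getElem?_cons_zero, List.getElem?_cons_succ] at h0 h1 h2 h3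
    split_ifs at h0 h1 h2 h3 with g0 g1 g2 g3
    simp only [Option.some.injEq] at h0 h1 h2 h3
    exact ⟨f 0, f 1, f 2, f 3, f.strictMono (by omega), f.strictMono (by omega),
      f.strictMono (by omega), g3, h0.symm, h1.symm, h2.symm, h3.symm⟩
  · rintro ⟨i, j, k, l, h1, h2, h3, h4, rfl, rfl, e1, e2⟩
    have : [i, j, k, l].Sublist (List.range N) := by
      refine List.sublist_of_subperm_of_pairwise (r := (· < ·)) ?_ ?_ List.pairwise_lt_range
      · refine List.subperm_of_subset ?_ ?_
        · simp; omega
        · intro z hz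
          simp only [List.mem_cons, List.not_mem_nil, or_false] at hz
          rw [List.mem_range]; omega
      · simp; omega
    have h := this.map x
    simpa [e1, e2] using h

theorem not_interlacing {i j k l : ℕ} (h1 : i < j) (h2 : j < k) (h3 : k < l) (h4 : l < N)
    (e1 : x k = x i) (e2 : x l = x j) : x i = x j := by
  by_contra hne
  refine W.noninterlacing _ _ hne ?_
  rw [hx, sublist_four]
  exact ⟨i, j, k, l, h1, h2, h3, h4, rfl, rfl, e1, e2⟩

/-- The letter after a caesura occurs there for the first time. -/
theorem ne_of_caes {i z : ℕ} (hc : Caes N x i) (hz : z ≤ i) : x z ≠ x (i + 1) := by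
  have hi := hc.lt
  obtain ⟨y, h1, h2, h3⟩ := hc
  have hne := chain_ne hx hi
  intro he
  rcases hz.eq_or_lt with rfl | hlt
  · exact hne he
  · have hy : y ≠ i + 1 := fun e => hne (by rw [← e, h3])
    have := not_interlacing hx hlt (by omega : i < i + 1) (by omega : i + 1 < y) h2 he.symm h3
    exact hne (this.symm.trans he)

/-- A letter is interposed if and only if it follows a caesura. -/
theorem interposed_iff (v : Fin n) :
    W.Interposed v ↔ ∃ i, Caes N x i ∧ x (i + 1) = v := by
  constructor
  · rintro ⟨u, p, s, h, hs⟩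
    obtain ⟨k, hk⟩ := List.mem_iff_getElem?.1 hs
    have e1 : W.letters[p.length]? = some u := by rw [h]; simp
    have e2 : W.letters[p.length + 1]? = some v := by
      rw [h, List.getElem?_append_right (by omega)]; simp
    have e3 : W.letters[p.length + (k + 2)]? = some u := by
      rw [h, List.getElem?_append_right (by omega)]; simpa using hk
    rw [hx, getElem?_map_range] at e1 e2 e3
    split_ifs at e1 e2 e3 with g1 g2 g3
    simp only [Option.some.injEq] at e1 e2 e3
    exact ⟨p.length, ⟨_, by omega, g3, by rw [e3, e1]⟩, e2⟩
  · rintro ⟨i, hc, rfl⟩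
    have hi := hc.lt
    have hne := chain_ne hx hi
    obtain ⟨y, h1, h2, h3⟩ := hc
    have hy : y ≠ i + 1 := fun e => hne (by rw [← e, h3])
    have hl := length_letters hx
    have e1 := getElem?_letters hx (i := i) (by omega)
    have e2 := getElem?_letters hx hi
    have e3 := getElem?_letters hx h2
    rw [List.getElem?_eq_getElem (by omega), Option.some.injEq] at e1 e2
    refine ⟨x i, W.letters.take i, W.letters.drop (i + 2), ?_, ?_⟩
    · rw [← e1, ← e2, List.cons_getElem_drop_succ, List.cons_getElem_drop_succ,
        List.take_append_drop]
    · rw [List.mem_iff_getElem?]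
      refine ⟨y - (i + 2), ?_⟩
      rw [List.getElem?_drop, show i + 2 + (y - (i + 2)) = y by omega, e3, h3]

/-- The degree of a word is the number of its caesurae. -/
theorem deg_eq : W.deg = cnum N x N := by
  classical
  have h1 : cnum N x N + n = N := by
    have h2 : cnum N x N = ((Finset.range N).filter (Caes N x)).card := by
      unfold cnum; exact Nat.count_eq_card_filter_range _ _
    have h3 : ((Finset.range N).filter fun i => ¬ Caes N x i).card = n := by
      conv_rhs => rw [← Fintype.card_fin n, ← Finset.card_univ]
      refine Finset.card_bij (fun i _ => x i) (fun _ _ => Finset.mem_univ _) ?_ ?_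
      · intro i hi j hj e
        simp only [Finset.mem_filter, Finset.mem_range] at hi hj
        by_contra hne
        rcases lt_or_gt_of_ne hne with h | h
        · exact hi.2 ⟨j, h, hj.1, e.symm⟩
        · exact hj.2 ⟨i, h, hi.1, e⟩
      · intro u _
        obtain ⟨i, hi, e⟩ := exists_letter hx u
        have hne : ((Finset.range N).filter fun j => x j = u).Nonempty := ⟨i, by simp [hi, e]⟩
        obtain ⟨j, hj, hmax⟩ := Finset.exists_max_image _ id hne
        simp only [Finset.mem_filter, Finset.mem_range, id] at hj hmax
        refine ⟨j, ?_, hj.2⟩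
        simp only [Finset.mem_filter, Finset.mem_range]
        refine ⟨hj.1, ?_⟩
        rintro ⟨y, y1, y2, y3⟩
        have := hmax y ⟨y2, y3.trans hj.2⟩
        omega
    have h4 := Finset.card_filter_add_card_filter_not (s := Finset.range N) (Caes N x)
    rw [Finset.card_range] at h4
    omega
  unfold SWord.deg
  rw [length_letters hx]
  omega

end bridge

theorem idxOf_map_range [DecidableEq γ] {x : ℕ → γ} {N k : ℕ} (hk : k < N)
    (h : ∀ z, z < k → x z ≠ x k) : ((List.range N).map x).idxOf (x k) = k := by
  unfold List.idxOf
  rw [List.findIdx_eq (by simpa using hk)]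
  constructor
  · simp
  · intro j hj
    simpa using h j hj

/-- Every word is of the form assumed above. -/
theorem exists_fn {n : ℕ} (W : SWord n) :
    W.letters = (List.range W.letters.length).map fun i => W.letters.getD i W.first := by
  apply List.ext_getElem?
  intro k
  rw [getElem?_map_range]
  split_ifs with h
  · simp [h]
  · simpa using h

end FunWord

/-! ### Eliminating consecutive repetitions -/

namespace FunWord

variable {α β γ : Type*}

theorem destutter'_append_singleton [DecidableEq γ] (L : List γ) (a b : γ) :
    (L ++ [b]).destutter' (· ≠ ·) a =
      L.destutter' (· ≠ ·) a ++ if (a :: L).getLast? = some b then [] else [b] := by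
  induction L generalizing a with
  | nil => by_cases h : a = b <;> simp [h]
  | cons c L ih =>
    rw [List.getLast?_cons_cons, List.cons_append]
    by_cases h : a = c
    · subst h
      rw [List.destutter'_cons_neg _ (by simp), List.destutter'_cons_neg _ (by simp), ih]
    · rw [List.destutter'_cons_pos _ h, List.destutter'_cons_pos _ h, ih, List.cons_append]

theorem destutter_append_singleton [DecidableEq γ] (L : List γ) (b : γ) :
    (L ++ [b]).destutter (· ≠ ·) =
      L.destutter (· ≠ ·) ++ if L.getLast? = some b then [] else [b] := by
  cases L with
  | nil => simp
  | cons a L => exact destutter'_append_singleton L a b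

/-- The number of places before position `k` at which `x` passes between two different letters
satisfying `P`. -/
def changes [DecidableEq γ] (P : γ → Prop) [DecidablePred P] (x : ℕ → γ) (k : ℕ) : ℕ :=
  Nat.count (fun i => P (x i) ∧ P (x (i + 1)) ∧ x i ≠ x (i + 1)) k

variable [DecidableEq γ] {P : γ → Prop} [DecidablePred P] {x : ℕ → γ} {N : ℕ}

theorem changes_succ_of {k : ℕ} (h : P (x k) ∧ P (x (k + 1)) ∧ x k ≠ x (k + 1)) :
    changes P x (k + 1) = changes P x k + 1 := by
  unfold changes; rw [Nat.count_succ, if_pos h]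

theorem changes_succ_of_not {k : ℕ} (h : ¬ (P (x k) ∧ P (x (k + 1)) ∧ x k ≠ x (k + 1))) :
    changes P x (k + 1) = changes P x k := by
  unfold changes; rw [Nat.count_succ, if_neg h]; rfl

theorem changes_eq_of {r k : ℕ} (hrk : r ≤ k) (h : ∀ z, r < z → z ≤ k → ¬ P (x z)) :
    changes P x k = changes P x r := by
  induction k, hrk using Nat.le_induction with
  | base => rfl
  | succ k hk ih =>
    rw [changes_succ_of_not fun h' => h (k + 1) (by omega) le_rfl h'.2.1]
    exact ih fun z h1 h2 => h z h1 (by omega)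

/-- The letters satisfying `P`, without repetitions: provided that the letters before and after a
nonempty block of letters not satisfying `P` are equal, they are counted by `changes`. -/
theorem destutter_filter_aux
    (hc : ∀ r k, r + 1 < k → k < N → P (x r) → P (x k) → (∀ z, r < z → z < k → ¬ P (x z)) →
      x r = x k) :
    (∀ k, k < N → P (x k) → ((((List.range N).map x).filter fun u => decide (P u)).destutter
        (· ≠ ·))[changes P x k]? = some (x k)) ∧
      (∀ r, r < N → P (x r) → (∀ z, r < z → z < N → ¬ P (x z)) →
        ((((List.range N).map x).filter fun u => decide (P u)).destutter (· ≠ ·)).length =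
          changes P x r + 1 ∧
        (((List.range N).map x).filter fun u => decide (P u)).getLast? = some (x r)) ∧
      ((∀ k, k < N → ¬ P (x k)) → ((List.range N).map x).filter (fun u => decide (P u)) = []) := by
  induction N with
  | zero => simp
  | succ N ih =>
    obtain ⟨ih1, ih2, ih3⟩ := ih fun r k h1 h2 => hc r k h1 (by omega)
    rw [List.range_succ, List.map_append, List.map_singleton, List.filter_append]
    by_cases hP : P (x N)
    · rw [show [x N].filter (fun u => decide (P u)) = [x N] by simp [hP],
        destutter_append_singleton]
      set F := ((List.range N).map x).filter fun u => decide (P u)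
      by_cases hex : ∃ k, k < N ∧ P (x k)
      · obtain ⟨r, ⟨hr1, hr2⟩, hr3⟩ : ∃ r, (r < N ∧ P (x r)) ∧
            ∀ z, r < z → z < N → ¬ P (x z) := by
          obtain ⟨k, hk⟩ := hex
          have hne : ((Finset.range N).filter fun j => P (x j)).Nonempty :=
            ⟨k, by simp [hk.1, hk.2]⟩
          obtain ⟨j, hj, hmax⟩ := Finset.exists_max_image _ id hne
          simp only [Finset.mem_filter, Finset.mem_range, id] at hj hmax
          refine ⟨j, hj, fun z z1 z2 z3 => ?_⟩
          have := hmax z ⟨z2, z3⟩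
          omega
        obtain ⟨hlen, hlast⟩ := ih2 r hr1 hr2 hr3
        have htau : changes P x N = changes P x r + if x r = x N then 0 else 1 := by
          by_cases hrN : r + 1 = N
          · subst hrN
            split_ifs with h
            · rw [changes_succ_of_not fun h' => h'.2.2 h]; rfl
            · exact changes_succ_of ⟨hr2, hP, h⟩
          · have he := hc r N (by omega) (by omega) hr2 hP hr3
            rw [if_pos he]
            obtain ⟨M, rfl⟩ : ∃ M, N = M + 1 := ⟨N - 1, by omega⟩
            rw [changes_succ_of_not fun h' => hr3 M (by omega) (by omega) h'.1]
            exact changes_eq_of (by omega) fun z z1 z2 => hr3 z z1 (by omega)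
        have hif : (if F.getLast? = some (x N) then [] else [x N]) =
            if x r = x N then [] else [x N] := by
          rw [hlast]; simp only [Option.some.injEq]
        rw [hif]
        refine ⟨fun k hk hPk => ?_, fun s hs hPs hs' => ?_, fun h => (h N (by omega) hP).elim⟩
        · rcases Nat.lt_succ_iff_lt_or_eq.1 hk with h | rfl
          · have := ih1 k h hPk
            rw [List.getElem?_append_left]
            · exact this
            · by_contra hcon
              rw [List.getElem?_eq_none (by omega)] at this
              simp at this
          · rw [htau]
            split_ifs with h
            · rw [List.append_nil, add_zero, ih1 r hr1 hr2, h]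
            · rw [List.getElem?_append_right (by omega), hlen]; simp
        · have hsN : s = N := by
            by_contra hne
            exact hs' N (by omega) (by omega) hP
          subst hsN
          refine ⟨?_, by simp⟩
          rw [List.length_append, hlen, htau]
          split_ifs <;> simp
      · push Not at hex
        have hF : F = [] := ih3 hex
        have htau : ∀ k, k ≤ N → changes P x k = 0 := by
          intro k
          induction k with
          | zero => intro _; simp [changes]
          | succ k ihk =>
            intro hk
            rw [changes_succ_of_not fun h' => hex k (by omega) h'.1]
            exact ihk (by omega)
        refine ⟨fun k hk hPk => ?_, fun s hs hPs hs' => ?_, fun h => (h N (by omega) hP).elim⟩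
        · rcases Nat.lt_succ_iff_lt_or_eq.1 hk with h | rfl
          · exact (hex k h hPk).elim
          · rw [htau k le_rfl, hF]; simp
        · rw [htau s (by omega), hF]
          have hsN : s = N := by
            by_contra hne
            exact hex s (by omega) hPs
          simp [hsN]
    · rw [show [x N].filter (fun u => decide (P u)) = [] by simp [hP], List.append_nil]
      refine ⟨fun k hk hPk => ?_, fun s hs hPs hs' => ?_, fun h => ?_⟩
      · refine ih1 k ?_ hPk
        rcases Nat.lt_succ_iff_lt_or_eq.1 hk with h | rfl
        · exact h
        · exact (hP hPk).elim
      · refine ih2 s ?_ hPs fun z z1 z2 => hs' z z1 (by omega)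
        rcases Nat.lt_succ_iff_lt_or_eq.1 hs with h | rfl
        · exact h
        · exact (hP hPs).elim
      · exact ih3 fun k hk => h k (by omega)

/-- A sequence `s` of columns such that every step goes to the next column, or stays in a column
with letter `a`, consists of the columns of the points of a path. -/
theorem exists_path {a : α} {p q : ℕ} {V : ℕ → α} (hp : 1 ≤ p) (hq : 1 ≤ q) {s : ℕ → ℕ}
    (h0 : s 0 = 0) (hs : ∀ k, s (k + 1) = s k ∨ s (k + 1) = s k + 1)
    (hl : s (p + q - 2) = p - 1)
    (hv : ∀ k, k + 1 < p + q - 1 → s (k + 1) = s k → V (s k) = a) :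
    ∃ H, IsPath a p q V H ∧ ∀ k, k < p + q - 1 → IsPt p H (s k) (k - s k) := by
  classical
  have hmono : Monotone s := monotone_nat_of_le_succ fun k => by rcases hs k with h | h <;> omega
  have hex : ∀ c, c < p → ∃ i, s i = c := by
    intro c
    induction c with
    | zero => intro _; exact ⟨0, h0⟩
    | succ c ih =>
      intro hc
      by_contra! hne
      have : ∀ i, s i ≤ c := by
        intro i
        induction i with
        | zero => omega
        | succ i ihi =>
          have := hne (i + 1)
          rcases hs i with h | h <;> omega
      have := this (p + q - 2)
      omega
  set I : ℕ → ℕ := fun c => if h : c < p then Nat.find (hex c h) else 0 with hI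
  have hIs : ∀ c, c < p → s (I c) = c := fun c hc => by
    simp only [hI, dif_pos hc]; exact Nat.find_spec (hex c hc)
  have hIle : ∀ c i, c < p → s i = c → I c ≤ i := fun c i hc hi => by
    simp only [hI, dif_pos hc]; exact Nat.find_min' (hex c hc) hi
  have hIstep : ∀ c, c + 1 < p → I c < I (c + 1) := by
    intro c hc
    by_contra hcon
    have h1 := hmono (not_lt.1 hcon)
    rw [hIs c (by omega), hIs (c + 1) hc] at h1
    omega
  have hI0 : I 0 = 0 := by have := hIle 0 0 (by omega) h0; omega
  have hIN : ∀ c, c < p → I c ≤ c + (q - 1) := by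
    intro c hc
    have h1 : ∀ d, d ≤ p - 1 → I (p - 1 - d) + d ≤ p + q - 2 := by
      intro d
      induction d with
      | zero => intro _; exact hIle _ _ (by omega) hl
      | succ d ih =>
        intro hd
        have := ih (by omega)
        have h3 := hIstep (p - 1 - (d + 1)) (by omega)
        rw [show p - 1 - (d + 1) + 1 = p - 1 - d by omega] at h3
        omega
    have := h1 (p - 1 - c) (by omega)
    rw [show p - 1 - (p - 1 - c) = c by omega] at this
    omega
  have hIge : ∀ c, c < p → c ≤ I c := by
    intro c
    induction c with
    | zero => intro _; omega
    | succ c ih => intro hc; have := ih (by omega); have := hIstep c hc; omega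
  set H : ℕ → ℕ := fun c => if c < p then I c - c else q - 1 with hH
  have hHlt : ∀ c, c < p → H c = I c - c := fun c hc => if_pos hc
  have hHge : ∀ c, ¬ c < p → H c = q - 1 := fun c hc => if_neg hc
  refine ⟨H, ⟨?_, ?_, ?_, fun c hc => hHge c (by omega)⟩, ?_⟩
  · rw [hHlt 0 (by omega), hI0]
  · refine monotone_nat_of_le_succ fun c => ?_
    by_cases h1 : c + 1 < p
    · rw [hHlt c (by omega), hHlt _ h1]
      have := hIstep c h1
      omega
    · rw [hHge _ h1]
      by_cases h2 : c < p
      · rw [hHlt c h2]; have := hIN c h2; omega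
      · rw [hHge _ h2]
  · intro c hc hV
    have h3 := hIN c hc
    have h4 := hIge c hc
    by_cases hlt : I c + 1 < p + q - 1
    · have h5 : s (I c + 1) = c + 1 := by
        rcases hs (I c) with h | h
        · exact absurd (hv _ hlt h) (by rwa [hIs c hc])
        · rw [h, hIs c hc]
      have hc1 : c + 1 < p := by
        have := hmono (show I c + 1 ≤ p + q - 2 by omega)
        omega
      have h6 := hIle (c + 1) _ hc1 h5
      have h7 := hIstep c hc1
      rw [hHlt c hc, hHlt _ hc1]
      omega
    · rw [hHlt c hc, hHge (c + 1) (by omega)]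
      omega
  · intro k hk
    have h1 : s k ≤ p - 1 := by rw [← hl]; exact hmono (by omega)
    have hsk : s k < p := by omega
    refine ⟨hsk, ?_, ?_⟩
    · rw [hHlt _ hsk]
      have := hIle (s k) k hsk rfl
      omega
    · by_cases h2 : s k + 1 < p
      · rw [hHlt _ h2]
        have : k < I (s k + 1) := by
          by_contra hcon
          have := hmono (not_lt.1 hcon)
          rw [hIs _ h2] at this
          omega
        omega
      · rw [hHge _ h2]; omega

end FunWord

/-! ### Extensions of words as paths -/

namespace FunWord

section block

variable {m n l : ℕ} (h : l + 1 = m + n) (a : Fin m)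

theorem blockProj_blockIncl (j : Fin n) : blockProj h a (blockIncl h a j) = a := by
  unfold blockProj blockIncl
  rw [dif_neg (by simp), dif_pos (by simp)]

theorem blockIncl_injective : Function.Injective (blockIncl h a) := by
  intro i j e
  have := congrArg Fin.val e
  simp only [blockIncl] at this
  exact Fin.ext (by omega)

theorem blockProj_eq_iff (k : Fin l) : blockProj h a k = a ↔ ∃ j, blockIncl h a j = k := by
  constructor
  · intro e
    unfold blockProj at e
    split_ifs at e with h1 h2
    · have := congrArg Fin.val e; simp only at this; omega
    · exact ⟨⟨k - a, by omega⟩, Fin.ext (by simp only [blockIncl]; omega)⟩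
    · have := congrArg Fin.val e; simp only at this; omega
  · rintro ⟨j, rfl⟩; exact blockProj_blockIncl h a j

theorem blockProj_liftVertex (W : SWord n) (v : Fin m) :
    blockProj h a (SWord.liftVertex h a W v) = v := by
  have hn := W.first.2
  unfold SWord.liftVertex
  split_ifs with h1 h2
  · have h1' : (v : ℕ) < a := h1
    unfold blockProj; rw [dif_pos h1']
  · have h2' : (a : ℕ) < v := h2
    unfold blockProj
    rw [dif_neg (by simp only; omega), dif_neg (by simp only; omega)]
    exact Fin.ext (by simp only; omega)
  · rw [blockProj_blockIncl]; omega

theorem liftVertex_self (W : SWord n) : SWord.liftVertex h a W a = blockIncl h a W.first := by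
  unfold SWord.liftVertex; simp

theorem liftVertex_blockProj (W : SWord n) (k : Fin l) (hk : blockProj h a k ≠ a) :
    SWord.liftVertex h a W (blockProj h a k) = k := by
  unfold blockProj at hk ⊢
  split_ifs at hk ⊢ with h1 h2
  · unfold SWord.liftVertex
    rw [dif_pos (by exact h1)]
  · simp at hk
  · have hka : (a : ℕ) < k + 1 - n := by
      have : (k : ℕ) + 1 - n ≠ a := fun e => hk (Fin.ext e)
      omega
    unfold SWord.liftVertex
    rw [dif_neg (by rw [Fin.lt_def]; simp only; omega), dif_pos (by rw [Fin.lt_def]; exact hka)]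
    exact Fin.ext (by simp only; omega)

/-- The vertex of an extension corresponding to a vertex of `V` (other than `a`) or of `W`. -/
def emb (W : SWord n) : Fin m ⊕ Fin n → Fin l :=
  Sum.elim (SWord.liftVertex h a W) (blockIncl h a)

variable {Vf : ℕ → Fin m} {Wf : ℕ → Fin n} {x y x' y' : ℕ} (W : SWord n)

theorem blockProj_emb : blockProj h a (emb h a W (letter a Vf Wf x y)) = Vf x := by
  by_cases hV : Vf x = a
  · rw [letter_of_eq hV]; exact (blockProj_blockIncl h a _).trans hV.symm
  · rw [letter_of_ne hV]; exact blockProj_liftVertex h a W _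

theorem emb_letter_iff : emb h a W (letter a Vf Wf x y) = emb h a W (letter a Vf Wf x' y') ↔
    letter a Vf Wf x y = letter a Vf Wf x' y' := by
  refine ⟨fun e => ?_, fun e => by rw [e]⟩
  have hV : Vf x = Vf x' := by
    have := congrArg (blockProj h a) e
    rwa [blockProj_emb, blockProj_emb] at this
  rw [letter_eq_iff]
  refine ⟨hV, fun ha => ?_⟩
  rw [letter_of_eq ha, letter_of_eq (hV.symm.trans ha)] at e
  exact blockIncl_injective h a e

/-- The words along a path over `Fin m ⊕ Fin n` and over the vertices of the extension repeat
letters at the same positions. -/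
theorem emb_pword_iff {p : ℕ} {H : ℕ → ℕ} {i j : ℕ} :
    emb h a W (pword a p Vf Wf H i) = emb h a W (pword a p Vf Wf H j) ↔
      pword a p Vf Wf H i = pword a p Vf Wf H j := emb_letter_iff h a W

end block

variable {m n l : ℕ} {h : l + 1 = m + n} {a : Fin m} {V : SWord m} {W : SWord n}
  {p q : ℕ} {Vf : ℕ → Fin m} {Wf : ℕ → Fin n}

/-- Every extension `X` is read along a path: the column of a position is the number of changes of
the letters of `β(X)` before it, and its row the number of changes of the letters of `X` in the
image of `α`. -/
theorem exists_path_of_isExt (hV : V.letters = (List.range p).map Vf)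
    (hW : W.letters = (List.range q).map Wf) {X : SWord l} (hX : SWord.IsExt h a V W X) :
    ∃ H, IsPath a p q Vf H ∧
      X.letters = (List.range (p + q - 1)).map (emb h a W ∘ pword a p Vf Wf H) := by
  obtain ⟨x2, x3, x1⟩ := hX
  obtain ⟨N, xf, hx⟩ : ∃ N xf, X.letters = (List.range N).map xf := ⟨_, _, exists_fn X⟩
  have hN := pos_length hx
  have hp := pos_length hV
  have hq := pos_length hW
  set P : Fin l → Prop := fun k => ∃ j, blockIncl h a j = k with hP
  -- the columns, from the elimination of repetitions in the image under `blockProj`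
  set s : ℕ → ℕ := changes (fun _ => True) fun k => blockProj h a (xf k) with hs
  have hVs : (∀ k, k < N → s k < p ∧ Vf (s k) = blockProj h a (xf k)) ∧ p = s (N - 1) + 1 := by
    have key := destutter_filter_aux (P := fun _ : Fin m => True)
      (x := fun k => blockProj h a (xf k)) (N := N)
      (fun r k h1 _ _ _ h2 => absurd trivial (h2 (r + 1) (by omega) h1))
    have e : (((List.range N).map fun k => blockProj h a (xf k)).filter
        fun _ => decide True).destutter (· ≠ ·) = (List.range p).map Vf := by
      rw [← hV, ← x1, hx, List.map_map]
      simp only [decide_true, List.filter_true]; rfl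
    rw [e] at key
    refine ⟨fun k hk => ?_, ?_⟩
    · have := key.1 k hk trivial
      rw [getElem?_map_range] at this
      split_ifs at this with hlt
      exact ⟨hlt, Option.some.inj this⟩
    · have := (key.2.1 (N - 1) (by omega) trivial fun z _ _ => by omega).1
      simpa using this
  -- the rows, from the elimination of repetitions among the letters in the image of `blockIncl`
  set τ : ℕ → ℕ := changes P xf with hτ
  have hWs : (∀ k, k < N → P (xf k) → blockIncl h a (Wf (τ k)) = xf k) ∧ q = τ (N - 1) + 1 := by
    have key := destutter_filter_aux (P := P) (x := xf) (N := N) (by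
      rintro r k h1 h2 ⟨j, hj⟩ ⟨j', hj'⟩ h3
      rw [← hj, ← hj']
      congr 1
      have hl := length_letters hx
      have er := getElem?_letters hx (i := r) (by omega)
      have ek := getElem?_letters hx h2
      rw [List.getElem?_eq_getElem (by omega), Option.some.injEq] at er ek
      refine x3 (X.letters.take r) ((X.letters.drop (r + 1)).take (k - (r + 1)))
        (X.letters.drop (k + 1)) j j' ?_ ?_ ?_
      · rw [hj, hj', ← er, ← ek, List.cons_getElem_drop_succ]
        have : List.drop k X.letters = List.drop (k - (r + 1)) (List.drop (r + 1) X.letters) := by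
          rw [List.drop_drop]; congr 1; omega
        rw [this, List.take_append_drop, List.cons_getElem_drop_succ, List.take_append_drop]
      · intro e
        have := congrArg List.length e
        simp at this
        omega
      · intro u hu i hi
        obtain ⟨z, hz⟩ := List.mem_iff_getElem?.1 hu
        rw [List.getElem?_take] at hz
        split_ifs at hz with hzlt
        rw [List.getElem?_drop, getElem?_letters hx (by omega), Option.some.injEq] at hz
        exact h3 (r + 1 + z) (by omega) (by omega) ⟨i, by rw [hi, hz]⟩)
    have e : (((List.range N).map xf).filter fun u => decide (P u)).destutter (· ≠ ·) =
        (List.range q).map fun k => blockIncl h a (Wf k) := by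
      rw [← hx]
      refine x2.trans ?_
      rw [hW, List.map_map]; rfl
    rw [e] at key
    refine ⟨fun k hk hPk => ?_, ?_⟩
    · have := key.1 k hk hPk
      rw [getElem?_map_range] at this
      split_ifs at this with hlt
      exact Option.some.inj this
    · obtain ⟨r, ⟨hr1, hr2⟩, hr3⟩ : ∃ r, (r < N ∧ P (xf r)) ∧
          ∀ z, r < z → z < N → ¬ P (xf z) := by
        have hex : ∃ k, k < N ∧ P (xf k) := by
          by_contra! hcon
          rw [key.2.2 hcon] at e
          have := congrArg List.length e
          simp at this
          omega
        obtain ⟨k, hk⟩ := hex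
        have hne : ((Finset.range N).filter fun j => P (xf j)).Nonempty :=
          ⟨k, by simp [hk.1, hk.2]⟩
        obtain ⟨j, hj, hmax⟩ := Finset.exists_max_image _ id hne
        simp only [Finset.mem_filter, Finset.mem_range, id] at hj hmax
        refine ⟨j, hj, fun z z1 z2 z3 => ?_⟩
        have := hmax z ⟨z2, z3⟩
        omega
      have := (key.2.1 r hr1 hr2 hr3).1
      rw [hτ, changes_eq_of (r := r) (k := N - 1) (by omega) fun z z1 z2 => hr3 z z1 (by omega)]
      simpa using this
  have hstep : ∀ k, s (k + 1) = s k ∨ s (k + 1) = s k + 1 := by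
    intro k
    by_cases hk : True ∧ True ∧ blockProj h a (xf k) ≠ blockProj h a (xf (k + 1))
    · right; exact changes_succ_of (P := fun _ : Fin m => True) hk
    · left; exact changes_succ_of_not (P := fun _ : Fin m => True) hk
  -- outside the image of `blockIncl`, a step within a column would repeat a letter of `X`
  have hvert : ∀ k, k + 1 < N → s (k + 1) = s k → blockProj h a (xf k) = a ∧
      blockProj h a (xf (k + 1)) = a := by
    intro k hk he
    have e : blockProj h a (xf k) = blockProj h a (xf (k + 1)) := by
      by_contra hne
      have := changes_succ_of (P := fun _ : Fin m => True)
        (x := fun k => blockProj h a (xf k)) (k := k) ⟨trivial, trivial, hne⟩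
      simp only [← hs] at this
      omega
    suffices blockProj h a (xf k) = a from ⟨this, e ▸ this⟩
    by_contra hne
    have h1 := liftVertex_blockProj h a W _ hne
    rw [e] at hne h1
    rw [liftVertex_blockProj h a W _ hne] at h1
    exact chain_ne hx hk h1.symm
  -- every step changes either the column or the row
  have hsum : ∀ k, k < N → s k + τ k = k := by
    intro k
    induction k with
    | zero => intro _; simp [hs, hτ, changes]
    | succ k ih =>
      intro hk
      have ih := ih (by omega)
      rcases hstep k with he | he
      · obtain ⟨v1, v2⟩ := hvert k hk he
        have : τ (k + 1) = τ k + 1 := changes_succ_of ⟨(blockProj_eq_iff h a _).1 v1,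
          (blockProj_eq_iff h a _).1 v2, chain_ne hx hk⟩
        omega
      · have : τ (k + 1) = τ k := by
          refine changes_succ_of_not fun h' => ?_
          have h1 := (blockProj_eq_iff h a _).2 h'.1
          have h2 := (blockProj_eq_iff h a _).2 h'.2.1
          have := changes_succ_of_not (P := fun _ : Fin m => True)
            (x := fun k => blockProj h a (xf k)) (k := k) (fun h3 => h3.2.2 (h1.trans h2.symm))
          simp only [← hs] at this
          omega
        omega
  have hNpq : N = p + q - 1 := by
    have := hsum (N - 1) (by omega)
    have := hVs.2
    have := hWs.2
    omega
  subst hNpq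
  obtain ⟨H, hH, hpt⟩ := exists_path (a := a) (V := Vf) hp hq (s := s) (by simp [hs, changes]) hstep
    (by have := hVs.2; rw [show p + q - 1 - 1 = p + q - 2 by omega] at this; omega)
    (fun k hk he => by rw [(hVs.1 k (by omega)).2]; exact (hvert k hk he).1)
  refine ⟨H, hH, ?_⟩
  rw [hx]
  refine List.map_congr_left fun k hk => ?_
  have hk := List.mem_range.1 hk
  have e1 := hH.pword_eq Wf (hpt k hk)
  have e2 := hsum k hk
  have e3 := (hVs.1 k hk).2
  rw [show k - s k = τ k by omega, e2] at e1
  rw [Function.comp, e1]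
  by_cases ha : Vf (s k) = a
  · rw [letter_of_eq ha]
    exact (hWs.1 k hk ((blockProj_eq_iff h a _).1 (e3.symm.trans ha))).symm
  · rw [letter_of_ne ha]
    have := liftVertex_blockProj h a W (xf k) (by rwa [← e3])
    rw [← e3] at this
    exact this.symm

theorem pt_col {H : ℕ → ℕ} (hH : IsPath a p q Vf H) {k : ℕ} (hk : k < p + q - 1) :
    IsPt p H (col p H k) (k - col p H k) ∧ col p H k ≤ k := by
  obtain ⟨x, y, hpt, rfl⟩ := hH.exists_pt hk
  rw [hH.col_eq hpt, Nat.add_sub_cancel_left]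
  exact ⟨hpt, by omega⟩

theorem col_mono {H : ℕ → ℕ} (hH : IsPath a p q Vf H) {k k' : ℕ} (hk : k < k')
    (hk' : k' < p + q - 1) : col p H k ≤ col p H k' ∧ k - col p H k ≤ k' - col p H k' := by
  obtain ⟨h1, h2⟩ := pt_col hH (hk.trans hk')
  obtain ⟨h3, h4⟩ := pt_col hH hk'
  have := hH.pt_order h1 h3 (by omega)
  exact ⟨this.1, this.2.1⟩

theorem col_succ {H : ℕ → ℕ} (hH : IsPath a p q Vf H) {k : ℕ} (hk : k + 1 < p + q - 1) :
    col p H (k + 1) = col p H k + 1 ∨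
      col p H (k + 1) = col p H k ∧ Vf (col p H k) = a := by
  have h1 := col_mono hH (show k < k + 1 by omega) hk
  obtain ⟨h2, h2'⟩ := pt_col hH (k := k) (by omega)
  obtain ⟨h3, h3'⟩ := pt_col hH hk
  by_cases he : col p H (k + 1) = col p H k
  · refine Or.inr ⟨he, hH.eq_of_lt h2.lt ?_⟩
    have := h2.ge; have := h3.le; rw [he] at this; omega
  · left; omega

/-- Words read along paths are words in the sense of the definition. -/
theorem exists_sword (hV : V.letters = (List.range p).map Vf)
    (hW : W.letters = (List.range q).map Wf) {H : ℕ → ℕ} (hH : IsPath a p q Vf H) :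
    ∃ X : SWord l, X.letters = (List.range (p + q - 1)).map (emb h a W ∘ pword a p Vf Wf H) := by
  have hp := pos_length hV
  have hq := pos_length hW
  set N := p + q - 1 with hN
  set x := emb h a W ∘ pword a p Vf Wf H with hx
  have hb : ∀ k, blockProj h a (x k) = Vf (col p H k) := fun k => blockProj_emb h a W
  have hi : ∀ k, Vf (col p H k) = a → x k = blockIncl h a (Wf (k - col p H k)) := fun k hk => by
    rw [hx, Function.comp, pword, letter_of_eq hk]; rfl
  have hwf : ∀ k, k < N → k - col p H k < q := fun k hk => (hH.pt_lt hq (pt_col hH hk).1).2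
  refine ⟨⟨(List.range N).map x, ?_, ?_, ?_, ?_⟩, rfl⟩
  · intro e
    have := congrArg List.length e
    simp at this
    omega
  · intro u
    simp only [List.mem_map, List.mem_range]
    by_cases hu : blockProj h a u = a
    · obtain ⟨w, rfl⟩ := (blockProj_eq_iff h a u).1 hu
      obtain ⟨y, hy, rfl⟩ := exists_letter hW w
      have key : ∃ c, IsPt p H c y ∧ Vf c = a := by
        by_cases hy0 : y + 1 < q
        · obtain ⟨c, c1, c2, c3, c4⟩ := hH.exists_rise hy0
          exact ⟨c, ⟨c1, c2, c3.le⟩, c4⟩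
        · by_cases hq1 : y = 0
          · obtain ⟨c, c1, c2⟩ := exists_letter hV a
            have := hH.le_last c
            have := hH.le_last (c + 1)
            exact ⟨c, ⟨c1, by omega, by omega⟩, c2⟩
          · obtain ⟨c, c1, c2, c3, c4⟩ := hH.exists_rise (y := y - 1) (by omega)
            exact ⟨c, ⟨c1, by omega, by omega⟩, c4⟩
      obtain ⟨c, hc, hVc⟩ := key
      refine ⟨c + y, (hH.pt_lt hq hc).1, ?_⟩
      rw [hx, Function.comp, hH.pword_eq Wf hc, letter_of_eq hVc]; rfl
    · obtain ⟨c, hc, e⟩ := exists_letter hV (blockProj h a u)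
      have hpt : IsPt p H c (H c) := ⟨hc, le_rfl, hH.mono (by omega)⟩
      refine ⟨c + H c, (hH.pt_lt hq hpt).1, ?_⟩
      rw [hx, Function.comp, hH.pword_eq Wf hpt, letter_of_ne (by rwa [e]), e]
      exact liftVertex_blockProj h a W u hu
  · rw [List.isChain_iff_getElem]
    intro k hk
    simp only [List.length_map, List.length_range] at hk
    simp only [List.getElem_map, List.getElem_range]
    intro e
    have h1 := hb k
    have h2 := hb (k + 1)
    rw [e, h2] at h1
    have h3 := (pt_col hH hk).1.lt
    rcases col_succ hH hk with hs | ⟨hs, ha⟩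
    · rw [hs] at h1 h3
      exact chain_ne hV h3 h1.symm
    · rw [hi k ha, hi (k + 1) (h1.trans ha)] at e
      have := blockIncl_injective h a e
      have hle := (pt_col hH (k := k) (by omega)).2
      have hlt := hwf (k + 1) hk
      rw [hs, show k + 1 - col p H k = k - col p H k + 1 by omega] at this hlt
      exact chain_ne hW hlt this
  · intro u v huv hsub
    obtain ⟨i, j, k, r, i1, i2, i3, i4, e1, e2, e3, e4⟩ := sublist_four.1 hsub
    have b1 := hb i; have b2 := hb j; have b3 := hb k; have b4 := hb r
    rw [e1] at b1; rw [e2] at b2; rw [e3] at b3; rw [e4] at b4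
    have m1 := col_mono hH i1 (by omega)
    have m2 := col_mono hH i2 (by omega)
    have m3 := col_mono hH i3 (by omega)
    by_cases hne : blockProj h a u = blockProj h a v
    · by_cases ha : blockProj h a u = a
      · have w1 := hi i (by rw [← b1, ha]); have w2 := hi j (by rw [← b2, ← hne, ha])
        have w3 := hi k (by rw [← b3, ha]); have w4 := hi r (by rw [← b4, ← hne, ha])
        rw [e1] at w1; rw [e2] at w2; rw [e3] at w3; rw [e4] at w4
        have f1 := blockIncl_injective h a (w1.symm.trans w3)
        have f2 := blockIncl_injective h a (w2.symm.trans w4)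
        have hn : Wf (i - col p H i) ≠ Wf (j - col p H j) := fun e => huv (by rw [w1, w2, e])
        have l1 : i - col p H i ≠ j - col p H j := fun e => hn (by rw [e])
        have l2 : j - col p H j ≠ k - col p H k := fun e => hn (by rw [f1, e])
        have l3 : k - col p H k ≠ r - col p H r := fun e => hn (by rw [f1, f2, e])
        exact hn (not_interlacing hW (i := i - col p H i) (j := j - col p H j)
          (k := k - col p H k) (l := r - col p H r) (by omega) (by omega) (by omega)
          (hwf r i4) f1.symm f2.symm)
      · apply huv
        rw [← liftVertex_blockProj h a W u ha, hne, liftVertex_blockProj h a W v (hne ▸ ha)]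
    · have l1 : col p H i ≠ col p H j := fun e => hne (by rw [b1, b2, e])
      have l2 : col p H j ≠ col p H k := fun e => hne (by rw [b2, b3, e])
      have l3 : col p H k ≠ col p H r := fun e => hne (by rw [b3, b4, e])
      have := not_interlacing hV (i := col p H i) (j := col p H j) (k := col p H k)
        (l := col p H r) (by omega) (by omega) (by omega) (pt_col hH i4).1.lt
        (b3.symm.trans b1) (b4.symm.trans b2)
      exact hne (b1.trans (this.trans b2.symm))

/-- Words read along paths are extensions. -/
theorem isExt_of_path (hV : V.letters = (List.range p).map Vf)
    (hW : W.letters = (List.range q).map Wf) {H : ℕ → ℕ} (hH : IsPath a p q Vf H)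
    {X : SWord l}
    (hX : X.letters = (List.range (p + q - 1)).map (emb h a W ∘ pword a p Vf Wf H)) :
    SWord.IsExt h a V W X := by
  have hp := pos_length hV
  have hq := pos_length hW
  set N := p + q - 1 with hN
  set x := emb h a W ∘ pword a p Vf Wf H with hx
  have hb : ∀ k, blockProj h a (x k) = Vf (col p H k) := fun k => blockProj_emb h a W
  have hi : ∀ k, Vf (col p H k) = a → x k = blockIncl h a (Wf (k - col p H k)) := fun k hk => by
    rw [hx, Function.comp, pword, letter_of_eq hk]; rfl
  have hP : ∀ k, (∃ j, blockIncl h a j = x k) ↔ Vf (col p H k) = a := fun k => by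
    rw [← blockProj_eq_iff, hb]
  have hwf : ∀ k, k < N → k - col p H k < q := fun k hk => (hH.pt_lt hq (pt_col hH hk).1).2
  -- letters before and after a deleted block lie in the same row
  have hrow : ∀ r k, r + 1 < k → k < N → Vf (col p H r) = a → Vf (col p H k) = a →
      (∀ z, r < z → z < k → Vf (col p H z) ≠ a) → x r = x k := by
    intro r k h1 h2 h3 h4 h5
    rw [hi r h3, hi k h4]
    have key : ∀ z, r < z → z < k → z - col p H z = r - col p H r := by
      intro z hz
      induction z, hz using Nat.le_induction with
      | base =>
        intro _
        rcases col_succ hH (k := r) (by omega) with h6 | h6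
        · rw [h6]; omega
        · exact absurd (h6.1 ▸ h3) (h5 (r + 1) (by omega) h1)
      | succ z hz ih =>
        intro hzk
        rw [← ih (by omega)]
        rcases col_succ hH (k := z) (by omega) with h6 | h6
        · rw [h6]; omega
        · exact absurd h6.2 (h5 z (by omega) (by omega))
    obtain ⟨k, rfl⟩ : ∃ z, k = z + 1 := ⟨k - 1, by omega⟩
    rw [← key k (by omega) (by omega)]
    rcases col_succ hH h2 with h6 | h6
    · rw [h6]; congr 2; omega
    · exact absurd h6.2 (h5 k (by omega) (by omega))
  refine ⟨?_, ?_, ?_⟩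
  · have hτ : ∀ k, k < N → changes (fun u => ∃ j, blockIncl h a j = u) x k = k - col p H k := by
      intro k
      induction k with
      | zero => intro _; simp [changes]
      | succ k ih =>
        intro hk
        have hle := (pt_col hH (k := k) (by omega)).2
        rcases col_succ hH hk with hs | ⟨hs, ha⟩
        · rw [changes_succ_of_not, ih (by omega), hs]
          · omega
          · rw [hP, hP, hs]
            rintro ⟨e1, e2, -⟩
            have := (pt_col hH hk).1.lt
            rw [hs] at this
            exact chain_ne hV this (e1.trans e2.symm)
        · rw [changes_succ_of, ih (by omega), hs]
          · omega
          · rw [hP, hP, hs]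
            exact ⟨ha, ha, chain_ne hX hk⟩
    have key := destutter_filter_aux (P := fun u => ∃ j, blockIncl h a j = u) (x := x) (N := N)
      (fun r k h1 h2 h3 h4 h5 => hrow r k h1 h2 ((hP r).1 h3) ((hP k).1 h4)
        fun z z1 z2 hz => h5 z z1 z2 ((hP z).2 hz))
    rw [hX]
    set Y := (((List.range N).map x).filter
      fun u => decide (∃ j, blockIncl h a j = u)).destutter (· ≠ ·)
    have hrows : ∀ y, y < q → ∃ c, IsPt p H c y ∧ Vf c = a := by
      intro y hy
      by_cases hy0 : y + 1 < q
      · obtain ⟨c, c1, c2, c3, c4⟩ := hH.exists_rise hy0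
        exact ⟨c, ⟨c1, c2, c3.le⟩, c4⟩
      · by_cases hq1 : y = 0
        · obtain ⟨c, c1, c2⟩ := exists_letter hV a
          have := hH.le_last c
          have := hH.le_last (c + 1)
          exact ⟨c, ⟨c1, by omega, by omega⟩, c2⟩
        · obtain ⟨c, c1, c2, c3, c4⟩ := hH.exists_rise (y := y - 1) (by omega)
          exact ⟨c, ⟨c1, by omega, by omega⟩, c4⟩
    have hlen : Y.length = q := by
      obtain ⟨r, ⟨hr1, hr2⟩, hr3⟩ : ∃ r, (r < N ∧ Vf (col p H r) = a) ∧
          ∀ z, r < z → z < N → ¬ Vf (col p H z) = a := by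
        obtain ⟨c, c1, c2⟩ := hrows 0 (by omega)
        have hne : ((Finset.range N).filter fun j => Vf (col p H j) = a).Nonempty :=
          ⟨c + 0, Finset.mem_filter.2 ⟨Finset.mem_range.2 (hH.pt_lt hq c1).1, by
            rw [hH.col_eq c1]; exact c2⟩⟩
        obtain ⟨j, hj, hmax⟩ := Finset.exists_max_image _ id hne
        simp only [Finset.mem_filter, Finset.mem_range, id] at hj hmax
        refine ⟨j, hj, fun z z1 z2 z3 => ?_⟩
        have := hmax z ⟨z2, z3⟩
        omega
      have h1 := (key.2.1 r hr1 ((hP r).2 hr2) fun z z1 z2 hz => hr3 z z1 z2 ((hP z).1 hz)).1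
      rw [hτ r hr1] at h1
      rw [h1]
      have h2 := hwf r hr1
      obtain ⟨c, c1, c2⟩ := hrows (q - 1) (by omega)
      have h3 := (hH.pt_lt hq c1).1
      have h4 : c + (q - 1) ≤ r := by
        by_contra hcon
        exact hr3 _ (not_le.1 hcon) h3 (by rwa [hH.col_eq c1])
      rcases h4.eq_or_lt with h5 | h5
      · rw [← h5, hH.col_eq c1]; omega
      · have := (col_mono hH h5 hr1).2
        rw [hH.col_eq c1] at this
        omega
    apply List.ext_getElem?
    intro y
    rw [hW, List.map_map, getElem?_map_range]
    split_ifs with hy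
    · obtain ⟨c, c1, c2⟩ := hrows y hy
      have h3 := (hH.pt_lt hq c1).1
      have h4 := hH.col_eq c1
      have := key.1 (c + y) h3 ((hP _).2 (by rwa [h4]))
      rw [hτ _ h3, h4, Nat.add_sub_cancel_left, hi _ (by rwa [h4]), h4,
        Nat.add_sub_cancel_left] at this
      exact this
    · exact List.getElem?_eq_none (by omega)
  · intro p' mid s j j' hsplit hmid hmid'
    set r := p'.length with hr
    set k := r + 1 + mid.length with hk
    have hml : 0 < mid.length := List.length_pos_iff.2 hmid
    have e1 : X.letters[r]? = some (blockIncl h a j) := by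
      rw [hsplit, List.getElem?_append_right (by omega)]; simp [hr]
    have e2 : X.letters[k]? = some (blockIncl h a j') := by
      rw [hsplit, List.getElem?_append_right (by omega),
        show k - p'.length = mid.length + 1 by omega, List.getElem?_cons_succ,
        List.getElem?_append_right (by omega)]
      simp
    have e3 : ∀ z, r < z → z < k → ∃ u ∈ mid, X.letters[z]? = some u := by
      intro z z1 z2
      have hzl : z - (r + 1) < mid.length := by omega
      refine ⟨mid[z - (r + 1)], List.getElem_mem _, ?_⟩
      rw [hsplit, List.getElem?_append_right (by omega),
        show z - p'.length = (z - (r + 1)) + 1 by omega,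
        List.getElem?_cons_succ, List.getElem?_append_left hzl, List.getElem?_eq_getElem hzl]
    rw [hX, getElem?_map_range] at e1 e2
    split_ifs at e1 e2 with g1 g2
    simp only [Option.some.injEq] at e1 e2
    have := hrow r k (by omega) g2 ((hP r).1 ⟨j, e1.symm⟩) ((hP k).1 ⟨j', e2.symm⟩) (by
      intro z z1 z2 hz
      obtain ⟨u, hu, hzu⟩ := e3 z z1 z2
      rw [hX, getElem?_map_range, if_pos (by omega), Option.some.injEq] at hzu
      obtain ⟨i, hi⟩ := (hP z).2 hz
      exact hmid' u hu i (hi.trans hzu))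
    rw [e1, e2] at this
    exact blockIncl_injective h a this
  · have hσ : ∀ k, k < N →
        changes (fun _ => True) (fun k => blockProj h a (x k)) k = col p H k := by
      intro k
      induction k with
      | zero =>
        intro hk
        have := (pt_col hH hk).2
        simp [changes]; omega
      | succ k ih =>
        intro hk
        rcases col_succ hH hk with hs | ⟨hs, ha⟩
        · rw [changes_succ_of, ih (by omega), hs]
          refine ⟨trivial, trivial, ?_⟩
          rw [hb, hb, hs]
          have := (pt_col hH hk).1.lt
          rw [hs] at this
          exact chain_ne hV this
        · rw [changes_succ_of_not, ih (by omega), hs]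
          rintro ⟨-, -, hne⟩
          rw [hb, hb, hs] at hne
          exact hne rfl
    have key := destutter_filter_aux (P := fun _ : Fin m => True)
      (x := fun k => blockProj h a (x k)) (N := N)
      (fun r k h1 _ _ _ h2 => absurd trivial (h2 (r + 1) (by omega) h1))
    simp only [decide_true, List.filter_true] at key
    rw [hX, List.map_map]
    have hlen := (key.2.1 (N - 1) (by omega) trivial fun z _ _ => by omega).1
    rw [hσ _ (by omega)] at hlen
    have hlast : col p H (N - 1) = p - 1 := by
      have hpt : IsPt p H (p - 1) (q - 1) :=
        ⟨by omega, hH.le_last _, by rw [hH.last (p - 1 + 1) (by omega)]⟩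
      rw [show N - 1 = p - 1 + (q - 1) by omega, hH.col_eq hpt]
    apply List.ext_getElem?
    intro c
    rw [hV, getElem?_map_range]
    split_ifs with hc
    · have hpt : IsPt p H c (H c) := ⟨hc, le_rfl, hH.mono (by omega)⟩
      have h3 := (hH.pt_lt hq hpt).1
      have := key.1 (c + H c) h3 trivial
      rw [hσ _ h3, hb, hH.col_eq hpt] at this
      exact this
    · refine List.getElem?_eq_none ?_
      refine le_trans hlen.le ?_
      omega

/-- A word is read along at most one path: as `V` has no consecutive repetitions, the columns of the
points can be read off from the word. -/
theorem path_injective (hV : V.letters = (List.range p).map Vf) (hq : 1 ≤ q) {H H' : ℕ → ℕ}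
    (hH : IsPath a p q Vf H) (hH' : IsPath a p q Vf H')
    (he : (List.range (p + q - 1)).map (emb h a W ∘ pword a p Vf Wf H) =
      (List.range (p + q - 1)).map (emb h a W ∘ pword a p Vf Wf H')) : H = H' := by
  have hp := pos_length hV
  have hb : ∀ k, k < p + q - 1 → Vf (col p H k) = Vf (col p H' k) := by
    intro k hk
    have h1 := List.map_inj_left.1 he k (List.mem_range.2 hk)
    have h2 := congrArg (blockProj h a) h1
    simp only [Function.comp] at h2
    unfold pword at h2
    rwa [blockProj_emb, blockProj_emb] at h2
  have hc : ∀ k, k < p + q - 1 → col p H k = col p H' k := by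
    intro k
    induction k with
    | zero =>
      intro hk
      have := (pt_col hH hk).2
      have := (pt_col hH' hk).2
      omega
    | succ k ih =>
      intro hk
      have ih := ih (by omega)
      have h1 := hb (k + 1) hk
      have l1 := (pt_col hH hk).1.lt
      have l2 := (pt_col hH' hk).1.lt
      rcases col_succ hH hk with hs | ⟨hs, -⟩ <;> rcases col_succ hH' hk with hs' | ⟨hs', -⟩
      · omega
      · rw [hs] at l1
        rw [hs, hs', ← ih] at h1
        exact absurd h1.symm (chain_ne hV l1)
      · rw [hs'] at l2
        rw [hs, hs', ih] at h1
        exact absurd h1 (chain_ne hV l2)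
      · omega
  funext z
  by_cases hz : z < p
  · have key : ∀ {H H' : ℕ → ℕ}, IsPath a p q Vf H → IsPath a p q Vf H' →
        (∀ k, k < p + q - 1 → col p H k = col p H' k) → H' z ≤ H z := by
      intro H H' hH hH' hc
      have hpt : IsPt p H z (H z) := ⟨hz, le_rfl, hH.mono (by omega)⟩
      have h3 := (hH.pt_lt hq hpt).1
      have h4 := hH.col_eq hpt
      have h5 := (pt_col hH' h3).1
      rw [← hc _ h3, h4, Nat.add_sub_cancel_left] at h5
      exact h5.ge
    exact le_antisymm (key hH' hH fun k hk => (hc k hk).symm) (key hH hH' hc)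
  · rw [hH.last z (by omega), hH'.last z (by omega)]

/-- The sign of an extension is given by the number of inversions of its path. -/
theorem extSign_eq (hV : V.letters = (List.range p).map Vf)
    (hW : W.letters = (List.range q).map Wf) {H : ℕ → ℕ} (hH : IsPath a p q Vf H)
    {X : SWord l}
    (hX : X.letters = (List.range (p + q - 1)).map (emb h a W ∘ pword a p Vf Wf H)) :
    SWord.extSign h a V W X = (-1) ^ inv p q Vf Wf H := by
  classical
  have hq := pos_length hW
  unfold SWord.extSign
  congr 1
  -- both sides count pairs of a caesura of `V` and a caesura of `W`, since the interposed letters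
  -- are those following a caesura
  have hinv : inv p q Vf Wf H =
      ((Finset.range p ×ˢ Finset.range q).filter fun c => Caes p Vf c.1 ∧ Caes q Wf c.2 ∧
        c.2 < H (c.1 + 1)).card := by
    rw [Finset.card_filter, Finset.sum_product]
    unfold inv
    refine Finset.sum_congr rfl fun x hx => ?_
    split_ifs with hc
    · rw [← Finset.card_filter]
      unfold cnum
      rw [Nat.count_eq_card_filter_range]
      congr 1
      ext y
      simp only [Finset.mem_filter, Finset.mem_range]
      constructor
      · rintro ⟨h1, h2⟩; exact ⟨by have := h2.lt; omega, hc, h2, h1⟩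
      · rintro ⟨h1, _, h2, h3⟩; exact ⟨h3, h2⟩
    · simp [hc]
  rw [hinv]
  symm
  -- the position of the letter of `V` following a caesura
  have idxV : ∀ x, Caes p Vf x →
      X.letters.idxOf (SWord.liftVertex h a W (Vf (x + 1))) = x + 1 + H (x + 1) := by
    intro x hc
    have hlt := hc.lt
    have hpt : IsPt p H (x + 1) (H (x + 1)) := ⟨hlt, le_rfl, hH.mono (by omega)⟩
    have h3 := (hH.pt_lt hq hpt).1
    have e : SWord.liftVertex h a W (Vf (x + 1)) =
        (emb h a W ∘ pword a p Vf Wf H) (x + 1 + H (x + 1)) := by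
      rw [Function.comp, hH.pword_eq Wf hpt]
      by_cases ha : Vf (x + 1) = a
      · have : H (x + 1) = H 0 := hH.const_of (by omega) hlt.le fun z _ z2 hz =>
          ne_of_caes hV hc (show z ≤ x by omega) (hz.trans ha.symm)
        rw [letter_of_eq ha, ha, liftVertex_self, first_eq hW, this, hH.zero]; rfl
      · rw [letter_of_ne ha]; rfl
    rw [hX, e]
    refine idxOf_map_range h3 fun z hz => ?_
    simp only [Function.comp]
    have hz' : z < p + q - 1 := hz.trans h3
    obtain ⟨u, v, huv, rfl⟩ := hH.exists_pt hz'
    rw [hH.pword_eq Wf huv, hH.pword_eq Wf hpt, Ne, emb_letter_iff, letter_eq_iff]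
    rintro ⟨e1, -⟩
    obtain ⟨o1, o2, o3⟩ := hH.pt_order huv hpt hz
    rcases o1.eq_or_lt with rfl | h5
    · have := o3 rfl
      have := huv.ge
      omega
    · exact ne_of_caes hV hc (show u ≤ x by omega) e1
  -- the position of the letter of `W` following a caesura
  have idxW : ∀ y, Caes q Wf y → ∃ c, c < p ∧ H c ≤ y ∧ y < H (c + 1) ∧
      X.letters.idxOf (blockIncl h a (Wf (y + 1))) = c + y + 1 := by
    intro y hc
    have hlt := hc.lt
    obtain ⟨c, c1, c2, c3, c4⟩ := hH.exists_rise hlt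
    refine ⟨c, c1, c2, c3, ?_⟩
    have hpt : IsPt p H c (y + 1) := ⟨c1, by omega, by omega⟩
    have h3 := (hH.pt_lt hq hpt).1
    have e : blockIncl h a (Wf (y + 1)) =
        (emb h a W ∘ pword a p Vf Wf H) (c + y + 1) := by
      rw [Function.comp, add_assoc, hH.pword_eq Wf hpt, letter_of_eq c4]; rfl
    rw [hX, e]
    refine idxOf_map_range h3 fun z hz => ?_
    simp only [Function.comp]
    have hz' : z < p + q - 1 := hz.trans h3
    obtain ⟨u, v, huv, rfl⟩ := hH.exists_pt hz'
    rw [add_assoc, hH.pword_eq Wf huv, hH.pword_eq Wf hpt, Ne, emb_letter_iff, letter_eq_iff]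
    rintro ⟨e1, e2⟩
    have e2 := e2 (e1.trans c4)
    obtain ⟨o1, o2, o3⟩ := hH.pt_order huv hpt hz
    have hv : v = y + 1 := by
      by_contra hne
      exact ne_of_caes hW hc (show v ≤ y by omega) e2
    rcases o1.eq_or_lt with rfl | h5
    · have := o3 rfl
      omega
    · have : H (u + 1) ≤ H c := hH.mono (by omega)
      have := huv.le
      omega
  refine Finset.card_bij (fun c _ => (Vf (c.1 + 1), Wf (c.2 + 1))) ?_ ?_ ?_
  · rintro ⟨x, y⟩ hc
    simp only [Finset.mem_filter] at hc
    obtain ⟨-, h1, h2, h3⟩ := hc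
    simp only [Finset.mem_filter, Finset.mem_univ, true_and]
    refine ⟨(interposed_iff hV _).2 ⟨x, h1, rfl⟩, (interposed_iff hW _).2 ⟨y, h2, rfl⟩, ?_⟩
    obtain ⟨c, c1, c2, c3, c4⟩ := idxW y h2
    rw [idxV x h1, c4]
    have : c ≤ x := by
      by_contra hcon
      have : H (x + 1) ≤ H c := hH.mono (by omega)
      omega
    omega
  · rintro ⟨x, y⟩ hc ⟨x', y'⟩ hc' e
    simp only [Finset.mem_filter] at hc hc'
    simp only [Prod.mk.injEq] at e ⊢
    constructor
    · rcases lt_trichotomy x x' with hlt | heq | hlt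
      · exact absurd e.1 (ne_of_caes hV hc'.2.1 (show x + 1 ≤ x' by omega))
      · exact heq
      · exact absurd e.1.symm (ne_of_caes hV hc.2.1 (show x' + 1 ≤ x by omega))
    · rcases lt_trichotomy y y' with hlt | heq | hlt
      · exact absurd e.2 (ne_of_caes hW hc'.2.2.1 (show y + 1 ≤ y' by omega))
      · exact heq
      · exact absurd e.2.symm (ne_of_caes hW hc.2.2.1 (show y' + 1 ≤ y by omega))
  · rintro ⟨v, w⟩ hvw
    simp only [Finset.mem_filter, Finset.mem_univ, true_and] at hvw
    obtain ⟨h1, h2, h3⟩ := hvw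
    obtain ⟨x, hx, rfl⟩ := (interposed_iff hV v).1 h1
    obtain ⟨y, hy, rfl⟩ := (interposed_iff hW w).1 h2
    obtain ⟨c, c1, c2, c3, c4⟩ := idxW y hy
    rw [idxV x hx, c4] at h3
    refine ⟨(x, y), ?_, rfl⟩
    have hxl := hx.lt
    have hyl := hy.lt
    simp only [Finset.mem_filter, Finset.mem_product, Finset.mem_range]
    refine ⟨⟨by omega, by omega⟩, hx, hy, ?_⟩
    by_contra hcon
    have : x < c := by
      by_contra hcon'
      have : H (c + 1) ≤ H (x + 1) := hH.mono (by omega)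
      omega
    omega

end FunWord

/-! ### The boundary operator and the partial compositions of quilts -/

namespace FunWord

section sublists

variable {γ : Type*} {x : ℕ → γ} {N : ℕ} {u v w : γ}

theorem sublist_pair : [u, v].Sublist ((List.range N).map x) ↔
    ∃ i j, i < j ∧ j < N ∧ x i = u ∧ x j = v := by
  constructor
  · intro h
    obtain ⟨f, hf⟩ := List.sublist_iff_exists_orderEmbedding_getElem?_eq.1 h
    have h0 := hf 0; have h1 := hf 1
    rw [getElem?_map_range] at h0 h1
    simp only [List.getElem?_cons_zero, List.getElem?_cons_succ] at h0 h1
    split_ifs at h0 h1 with g0 g1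
    simp only [Option.some.injEq] at h0 h1
    exact ⟨f 0, f 1, f.strictMono (by omega), g1, h0.symm, h1.symm⟩
  · rintro ⟨i, j, h1, h2, rfl, rfl⟩
    have : [i, j].Sublist (List.range N) := by
      refine List.sublist_of_subperm_of_pairwise (r := (· < ·)) ?_ ?_ List.pairwise_lt_range
      · refine List.subperm_of_subset ?_ ?_
        · simp; omega
        · intro z hz
          simp only [List.mem_cons, List.not_mem_nil, or_false] at hz
          rw [List.mem_range]; omega
      · simp; omega
    exact this.map x

theorem sublist_triple : [u, v, w].Sublist ((List.range N).map x) ↔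
    ∃ i j k, i < j ∧ j < k ∧ k < N ∧ x i = u ∧ x j = v ∧ x k = w := by
  constructor
  · intro h
    obtain ⟨f, hf⟩ := List.sublist_iff_exists_orderEmbedding_getElem?_eq.1 h
    have h0 := hf 0; have h1 := hf 1; have h2 := hf 2
    rw [getElem?_map_range] at h0 h1 h2
    simp only [List.getElem?_cons_zero, List.getElem?_cons_succ] at h0 h1 h2
    split_ifs at h0 h1 h2 with g0 g1 g2
    simp only [Option.some.injEq] at h0 h1 h2
    exact ⟨f 0, f 1, f 2, f.strictMono (by omega), f.strictMono (by omega), g2,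
      h0.symm, h1.symm, h2.symm⟩
  · rintro ⟨i, j, k, h1, h2, h3, rfl, rfl, rfl⟩
    have : [i, j, k].Sublist (List.range N) := by
      refine List.sublist_of_subperm_of_pairwise (r := (· < ·)) ?_ ?_ List.pairwise_lt_range
      · refine List.subperm_of_subset ?_ ?_
        · simp; omega
        · intro z hz
          simp only [List.mem_cons, List.not_mem_nil, or_false] at hz
          rw [List.mem_range]; omega
      · simp; omega
    exact this.map x

end sublists

variable {m n l : ℕ} {h : l + 1 = m + n} {a : Fin m}

/-- Descendants in an extension project to descendants. -/
theorem le_blockProj {S : PlanarTree m} {T : PlanarTree n} {U : PlanarTree l}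
    (hU : PlanarTree.IsExt h a S T U) {u w : Fin l} (huw : U.le u w) :
    S.le (blockProj h a u) (blockProj h a w) := by
  induction huw with
  | refl => exact Relation.ReflTransGen.refl
  | tail _ e ih =>
    rcases hU.2.2.1 _ _ e with h1 | ⟨h1, h2⟩
    · exact ih.tail h1
    · rw [h1] at ih
      rwa [h2]

/-- Descendants within the image of `blockIncl` are descendants in `T`: a chain of edges of `U` that
starts and ends in this image cannot leave it. -/
theorem le_of_blockIncl_le {S : PlanarTree m} {T : PlanarTree n} {U : PlanarTree l}
    (hU : PlanarTree.IsExt h a S T U) {r s : Fin n}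
    (huw : U.le (blockIncl h a r) (blockIncl h a s)) : T.le r s := by
  suffices ∀ y, U.le (blockIncl h a r) y → ∀ s, y = blockIncl h a s → T.le r s from
    this _ huw s rfl
  intro y hy
  induction hy with
  | refl => intro s e; rw [blockIncl_injective h a e]; exact Relation.ReflTransGen.refl
  | @tail y z hy e ih =>
    rintro s rfl
    have h1 := le_blockProj hU hy
    have h2 := le_blockProj hU (Relation.ReflTransGen.single e)
    rw [blockProj_blockIncl] at h1 h2
    obtain ⟨t, rfl⟩ := (blockProj_eq_iff h a y).1 (S.antisymm _ _ h2 h1)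
    exact (ih t rfl).tail ((hU.1 _ _).2 e)

theorem eq_of_blockProj_eq {u v : Fin l} (e : blockProj h a u = blockProj h a v)
    (hu : blockProj h a u ≠ a) (W : SWord n) : u = v := by
  rw [← liftVertex_blockProj h a W u hu, e, liftVertex_blockProj h a W v (e ▸ hu)]

/-- Extensions of the word and of the tree of a quilt always form a quilt. -/
theorem exists_quilt_of_isExt (P : Quilt m) (Q : Quilt n) {X : SWord l} {U : PlanarTree l}
    (hX : SWord.IsExt h a P.word Q.word X) (hU : PlanarTree.IsExt h a P.tree Q.tree U) :
    ∃ R : Quilt l, R.word = X ∧ R.tree = U := by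
  obtain ⟨p, Vf, hV⟩ : ∃ p Vf, P.word.letters = (List.range p).map Vf := ⟨_, _, exists_fn _⟩
  obtain ⟨q, Wf, hW⟩ : ∃ q Wf, Q.word.letters = (List.range q).map Wf := ⟨_, _, exists_fn _⟩
  have hq := pos_length hW
  obtain ⟨H, hH, hXl⟩ := exists_path_of_isExt hV hW hX
  set x := emb h a Q.word ∘ pword a p Vf Wf H with hx
  have hb : ∀ k, blockProj h a (x k) = Vf (col p H k) := fun k => blockProj_emb h a _
  have hi : ∀ k, Vf (col p H k) = a → x k = blockIncl h a (Wf (k - col p H k)) := fun k hk => by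
    rw [hx, Function.comp, pword, letter_of_eq hk]; rfl
  -- letters with different projections are compared in `P`, letters of the inserted word in `Q`
  have hcol : ∀ i j, i < j → j < p + q - 1 → blockProj h a (x i) ≠ blockProj h a (x j) →
      col p H i < col p H j ∧ col p H j < p := by
    intro i j h1 h2 hne
    refine ⟨lt_of_le_of_ne (col_mono hH h1 h2).1 fun e => hne ?_, (pt_col hH h2).1.lt⟩
    rw [hb, hb, e]
  have hrow : ∀ i j, i < j → j < p + q - 1 → x i ≠ x j → Vf (col p H i) = a →
      Vf (col p H j) = a → i - col p H i < j - col p H j ∧ j - col p H j < q := by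
    intro i j h1 h2 hne e1 e2
    refine ⟨lt_of_le_of_ne (col_mono hH h1 h2).2 fun e => hne ?_,
      (hH.pt_lt hq (pt_col hH h2).1).2⟩
    rw [hi i e1, hi j e2, e]
  refine ⟨⟨X, U, ?_, ?_⟩, rfl, rfl⟩
  · intro u v huv ⟨h1, hne⟩
    rw [hXl, sublist_pair] at huv
    obtain ⟨i, j, hij, hj, rfl, rfl⟩ := huv
    by_cases e : blockProj h a (x i) = blockProj h a (x j)
    · by_cases ha : blockProj h a (x i) = a
      · have a1 : Vf (col p H i) = a := by rw [← hb, ha]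
        have a2 : Vf (col p H j) = a := by rw [← hb, ← e, ha]
        obtain ⟨r1, r2⟩ := hrow i j hij hj hne.symm a1 a2
        have e1 := hi i a1
        have e2 := hi j a2
        refine Q.not_below (Wf (i - col p H i)) (Wf (j - col p H j)) ?_ ⟨?_, ?_⟩
        · rw [hW, sublist_pair]; exact ⟨_, _, r1, r2, rfl, rfl⟩
        · refine le_of_blockIncl_le hU ?_
          rwa [← e1, ← e2]
        · intro e3; rw [e1, e2, e3] at hne; exact hne rfl
      · exact hne (eq_of_blockProj_eq e ha Q.word).symm
    · obtain ⟨r1, r2⟩ := hcol i j hij hj e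
      refine P.not_below (Vf (col p H i)) (Vf (col p H j)) ?_ ⟨?_, ?_⟩
      · rw [hV, sublist_pair]; exact ⟨_, _, r1, r2, rfl, rfl⟩
      · rw [← hb, ← hb]; exact le_blockProj hU h1
      · rw [← hb, ← hb]; exact fun e' => e e'.symm
  · intro u v huv
    rw [hXl, sublist_triple] at huv
    obtain ⟨i, j, k, hij, hjk, hk, rfl, rfl, e3⟩ := huv
    by_cases hne : x j = x i
    · exact Or.inl hne
    right
    by_cases e : blockProj h a (x i) = blockProj h a (x j)
    · by_cases ha : blockProj h a (x i) = a
      · have a1 : Vf (col p H i) = a := by rw [← hb, ha]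
        have a2 : Vf (col p H j) = a := by rw [← hb, ← e, ha]
        have a3 : Vf (col p H k) = a := by rw [← hb, e3, ha]
        obtain ⟨r1, -⟩ := hrow i j hij (by omega) (Ne.symm hne) a1 a2
        obtain ⟨r2, r3⟩ := hrow j k hjk hk (e3 ▸ hne) a2 a3
        have e1 := hi i a1
        have e2 := hi j a2
        have e4 : Wf (k - col p H k) = Wf (i - col p H i) :=
          blockIncl_injective h a (by rw [← e1, ← hi k a3, e3])
        rw [e1, e2]
        refine (hU.2.1 _ _).1 ((Q.left_of (Wf (i - col p H i)) (Wf (j - col p H j)) ?_).resolve_left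
          fun e5 => hne (by rw [e1, e2, e5]))
        rw [hW, sublist_triple]; exact ⟨_, _, _, r1, r2, r3, rfl, rfl, e4⟩
      · exact absurd (eq_of_blockProj_eq e ha Q.word).symm hne
    · obtain ⟨r1, -⟩ := hcol i j hij (by omega) e
      obtain ⟨r2, r3⟩ := hcol j k hjk hk (by rw [e3]; exact Ne.symm e)
      refine hU.2.2.2 _ _ ((P.left_of _ _ ?_).resolve_left fun e' => e e'.symm)
      rw [hV, sublist_triple]
      exact ⟨_, _, _, r1, r2, r3, (hb i).symm, (hb j).symm, by rw [← hb, e3]⟩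

instance finite_planarTree (n : ℕ) : Finite (PlanarTree n) :=
  Finite.of_injective (β := (Fin n → Fin n → Prop) × (Fin n → Fin n → Prop))
    (fun T => (T.edge, T.left)) fun _ _ e =>
      PlanarTree.ext (congrArg Prod.fst e) (congrArg Prod.snd e)

noncomputable instance fintype_planarTree (n : ℕ) : Fintype (PlanarTree n) := Fintype.ofFinite _

open Classical in
/-- The quilt with the given word and tree as an element of `Quilt(n)`, or `0` if there is no such
quilt of degree `d`. -/
noncomputable def quiltOf (d : ℤ) (T : PlanarTree n) (L : List (Fin n)) : Quilt.Mod n d :=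
  if hQ : ∃ Q : Quilt.OfDeg n d, Q.1.tree = T ∧ Q.1.word.letters = L then
    Finsupp.single hQ.choose 1
  else 0

theorem quiltOf_eq {d : ℤ} (Q : Quilt.OfDeg n d) :
    quiltOf d Q.1.tree Q.1.word.letters = Finsupp.single Q 1 := by
  have hQ : ∃ R : Quilt.OfDeg n d, R.1.tree = Q.1.tree ∧ R.1.word.letters = Q.1.word.letters :=
    ⟨Q, rfl, rfl⟩
  unfold quiltOf
  rw [dif_pos hQ]
  congr 1
  exact Subtype.ext (Quilt.ext (SWord.ext hQ.choose_spec.2) hQ.choose_spec.1)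

open Classical in
theorem boundary_eq {d : ℤ} (Q : Quilt.OfDeg n d) {N : ℕ} {x : ℕ → Fin n}
    (hx : Q.1.word.letters = (List.range N).map x) :
    Quilt.boundary Q = ∑ k ∈ Finset.range N with Rep N x k,
      (-1 : ℤ) ^ fnum N x k • quiltOf (d - 1) Q.1.tree ((List.range (N - 1)).map (x ∘ skip k)) := by
  unfold Quilt.boundary
  have hN := length_letters hx
  subst hN
  rw [Finset.sum_filter, ← Fin.sum_univ_eq_sum_range (fun k => if Rep _ x k then
    (-1 : ℤ) ^ fnum _ x k •
      quiltOf (d - 1) Q.1.tree ((List.range (_ - 1)).map (x ∘ skip k)) else 0)]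
  refine Finset.sum_congr rfl fun i _ => ?_
  have hget : Q.1.word.letters.get i = x i := by
    have := getElem?_letters hx i.2
    rwa [List.getElem?_eq_getElem i.2, Option.some.injEq] at this
  by_cases hr : Rep Q.1.word.letters.length x i
  · have hr' : Q.1.word.Repeated (Q.1.word.letters.get i) := by
      rw [hget]; exact (repeated_iff hx i.2).2 hr
    rw [dif_pos hr', if_pos hr, faceNumber_eq hx i.2]
    have := quiltOf_eq (d := d - 1)
      ⟨Q.1.face i hr', (SWord.deg_face _ i hr').trans (congrArg (· - 1) Q.2)⟩
    rw [← eraseIdx_map_range x i.2, ← hx]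
    refine Eq.trans ?_ (congrArg (fun z => (-1 : ℤ) ^ fnum _ x i • z) this.symm)
    rw [Finsupp.smul_single, smul_eq_mul, mul_one]
  · rw [dif_neg, if_neg hr]
    rw [hget, repeated_iff hx i.2]; exact hr

/-- A face of a quilt. -/
theorem exists_face {d : ℤ} (Q : Quilt.OfDeg n d) {N : ℕ} {x : ℕ → Fin n}
    (hx : Q.1.word.letters = (List.range N).map x) {k : ℕ} (hk : k < N) (hr : Rep N x k) :
    ∃ R : Quilt.OfDeg n (d - 1), R.1.tree = Q.1.tree ∧
      R.1.word.letters = (List.range (N - 1)).map (x ∘ skip k) := by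
  have hN := length_letters hx
  have hget : Q.1.word.letters.get ⟨k, by omega⟩ = x k := by
    have := getElem?_letters hx hk
    rwa [List.getElem?_eq_getElem (by omega), Option.some.injEq] at this
  have hr' : Q.1.word.Repeated (Q.1.word.letters.get ⟨k, by omega⟩) := by
    rw [hget]; exact (repeated_iff hx hk).2 hr
  refine ⟨⟨Q.1.face _ hr', (SWord.deg_face _ _ hr').trans (congrArg (· - 1) Q.2)⟩, rfl, ?_⟩
  rw [← eraseIdx_map_range x hk, ← hx]; rfl

open Classical in
/-- The partial composition of quilts as a sum over extensions of trees and over paths. -/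
theorem partialComp_eq {p q r : ℤ} (hd : r = p + q) (P : Quilt.OfDeg m p) (Q : Quilt.OfDeg n q)
    {M N : ℕ} {Vf : ℕ → Fin m} {Wf : ℕ → Fin n}
    (hV : P.1.word.letters = (List.range M).map Vf)
    (hW : Q.1.word.letters = (List.range N).map Wf) :
    Quilt.partialComp h hd a P Q =
      ∑ U : PlanarTree l with PlanarTree.IsExt h a P.1.tree Q.1.tree U,
        pathSum (fun L => quiltOf r U (L.map (emb h a Q.1.word))) a M N Vf Wf := by
  unfold Quilt.partialComp pathSum
  have hN := pos_length hW
  have hM := pos_length hV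
  rw [← Finset.sum_product', ← Finset.sum_filter]
  have key : ∀ c ∈ (Finset.univ.filter fun U : PlanarTree l =>
      PlanarTree.IsExt h a P.1.tree Q.1.tree U) ×ˢ paths a M N Vf,
      ∃ X : Quilt.OfDeg l r, X.1.tree = c.1 ∧ X.1.word.letters =
        (List.range (M + N - 1)).map (emb h a Q.1.word ∘ pword a M Vf Wf c.2) := by
    rintro ⟨U, H⟩ hc
    simp only [Finset.mem_product, Finset.mem_filter, Finset.mem_univ, true_and, mem_paths] at hc
    obtain ⟨X, hX⟩ := exists_sword (h := h) hV hW hc.2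
    obtain ⟨R, rfl, hR⟩ := exists_quilt_of_isExt P.1 Q.1 (isExt_of_path hV hW hc.2 hX) hc.1
    refine ⟨⟨R, ?_⟩, hR, hX⟩
    have h1 := P.2
    have h2 := Q.2
    have h3 := length_letters hV
    have h4 := length_letters hW
    have h5 := length_letters hX
    simp only [Quilt.deg, SWord.deg] at h1 h2 ⊢
    omega
  symm
  refine Finset.sum_bij (fun c hc => (key c hc).choose) ?_ ?_ ?_ ?_
  · rintro ⟨U, H⟩ hc
    obtain ⟨h1, h2⟩ := (key _ hc).choose_spec
    simp only [Finset.mem_product, Finset.mem_filter, Finset.mem_univ, true_and, mem_paths] at hc ⊢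
    exact ⟨isExt_of_path hV hW hc.2 h2, by rw [h1]; exact hc.1⟩
  · rintro ⟨U, H⟩ hc ⟨U', H'⟩ hc' e
    obtain ⟨h1, h2⟩ := (key _ hc).choose_spec
    obtain ⟨h1', h2'⟩ := (key _ hc').choose_spec
    rw [e] at h1 h2
    simp only [Finset.mem_product, Finset.mem_filter, Finset.mem_univ, true_and, mem_paths]
      at hc hc'
    exact Prod.ext (h1.symm.trans h1') (path_injective hV hN hc.2 hc'.2 (h2.symm.trans h2'))
  · intro X hX
    simp only [Finset.mem_filter, Finset.mem_univ, true_and] at hX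
    obtain ⟨H, hH, hl⟩ := exists_path_of_isExt hV hW hX.1
    have hc : (X.1.tree, H) ∈ (Finset.univ.filter fun U : PlanarTree l =>
        PlanarTree.IsExt h a P.1.tree Q.1.tree U) ×ˢ paths a M N Vf := by
      simp only [Finset.mem_product, Finset.mem_filter, Finset.mem_univ, true_and, mem_paths]
      exact ⟨hX.2, hH⟩
    refine ⟨_, hc, ?_⟩
    obtain ⟨h1, h2⟩ := (key _ hc).choose_spec
    exact Subtype.ext (Quilt.ext (SWord.ext (h2.trans hl.symm)) h1)
  · rintro ⟨U, H⟩ hc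
    have hc' := hc
    obtain ⟨h1, h2⟩ := (key _ hc).choose_spec
    simp only [Finset.mem_product, Finset.mem_filter, Finset.mem_univ, true_and, mem_paths] at hc
    have := quiltOf_eq (key (U, H) hc').choose
    rw [h1, h2] at this
    simp only at this ⊢
    rw [extSign_eq hV hW hc.2 h2, List.map_map, this, Finsupp.smul_single, smul_eq_mul, mul_one]

/-- The value of `emb` on the letters of words along paths does not depend on the word. -/
theorem emb_letter_congr (W W' : SWord n) {Vf : ℕ → Fin m} {Wf : ℕ → Fin n} (x y : ℕ) :
    emb h a W (letter a Vf Wf x y) = emb h a W' (letter a Vf Wf x y) := by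
  by_cases hV : Vf x = a
  · rw [letter_of_eq hV]; rfl
  · rw [letter_of_ne hV]
    simp only [emb, Sum.elim_inl]
    unfold SWord.liftVertex
    split_ifs with h1 h2
    · rfl
    · rfl
    · omega

theorem map_emb_pword_congr (W W' : SWord n) {Vf : ℕ → Fin m} {Wf : ℕ → Fin n} {p : ℕ}
    {H : ℕ → ℕ} (L : List ℕ) :
    (L.map (pword a p Vf Wf H)).map (emb h a W) =
      (L.map (pword a p Vf Wf H)).map (emb h a W') := by
  rw [List.map_map, List.map_map]
  exact List.map_congr_left fun k _ => emb_letter_congr W W' _ _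

/-- The boundary operator of `Quilt`. -/
noncomputable def bd {n : ℕ} {d : ℤ} : Quilt.Mod n d →ₗ[ℤ] Quilt.Mod n (d - 1) :=
  Finsupp.linearCombination ℤ Quilt.boundary

theorem bd_single {d : ℤ} (Q : Quilt.OfDeg n d) :
    bd (Finsupp.single Q 1) = Quilt.boundary Q := by
  rw [bd, Finsupp.linearCombination_single, one_smul]

open Classical in
/-- The boundary operator of `Quilt` is a derivation for the partial compositions. -/
theorem bd_partialComp {p q r : ℤ} (hd : r = p + q) (h₁ : r - 1 = (p - 1) + q)
    (h₂ : r - 1 = p + (q - 1)) (P : Quilt.OfDeg m p) (Q : Quilt.OfDeg n q) :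
    bd (Quilt.partialComp h hd a P Q) =
      Finsupp.linearCombination ℤ (fun P' => Quilt.partialComp h h₁ a P' Q) (Quilt.boundary P) +
      (p.negOnePow : ℤ) •
        Finsupp.linearCombination ℤ (fun Q' => Quilt.partialComp h h₂ a P Q')
          (Quilt.boundary Q) := by
  obtain ⟨M, Vf, hV⟩ : ∃ p Vf, P.1.word.letters = (List.range p).map Vf := ⟨_, _, exists_fn _⟩
  obtain ⟨N, Wf, hW⟩ : ∃ q Wf, Q.1.word.letters = (List.range q).map Wf := ⟨_, _, exists_fn _⟩
  have hM := pos_length hV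
  have hN := pos_length hW
  have hp : (p.negOnePow : ℤ) = (-1) ^ cnum M Vf M := by
    have h1 := deg_eq hV
    have h2 := P.2
    rw [Quilt.deg, h1] at h2
    rw [← h2]
    simp [Int.negOnePow_def]
  set φ : PlanarTree l → List (Fin m ⊕ Fin n) → Quilt.Mod l (r - 1) :=
    fun U L => quiltOf (r - 1) U (L.map (emb h a Q.1.word)) with hφ
  -- the boundary of the composition
  have e1 : bd (Quilt.partialComp h hd a P Q) =
      ∑ U : PlanarTree l with PlanarTree.IsExt h a P.1.tree Q.1.tree U,
        ∑ H ∈ paths a M N Vf, ∑ k ∈ Finset.range (M + N - 1) with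
          Rep (M + N - 1) (pword a M Vf Wf H) k, faceTerm (φ U) a M N Vf Wf H k := by
    rw [partialComp_eq hd P Q hV hW, map_sum]
    refine Finset.sum_congr rfl fun U hU => ?_
    simp only [Finset.mem_filter, Finset.mem_univ, true_and] at hU
    unfold pathSum
    rw [map_sum]
    refine Finset.sum_congr rfl fun H hH => ?_
    rw [mem_paths] at hH
    obtain ⟨X, hX⟩ := exists_sword (h := h) hV hW hH
    obtain ⟨R, rfl, hR⟩ := exists_quilt_of_isExt P.1 Q.1 (isExt_of_path hV hW hH hX) hU
    have hRd : R.deg = r := by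
      have h1 := P.2
      have h2 := Q.2
      have h3 := length_letters hV
      have h4 := length_letters hW
      have h5 := length_letters hX
      simp only [Quilt.deg, SWord.deg] at h1 h2 ⊢
      omega
    have e := quiltOf_eq (⟨R, hRd⟩ : Quilt.OfDeg l r)
    simp only [hR, hX] at e
    rw [map_zsmul]
    beta_reduce
    rw [List.map_map, e, bd_single, boundary_eq _ hX, Finset.smul_sum]
    -- the numbers attached to the faces depend only on which positions carry equal letters
    have hiff : ∀ i j, i < M + N - 1 → j < M + N - 1 →
        ((emb h a Q.1.word ∘ pword a M Vf Wf H) i = (emb h a Q.1.word ∘ pword a M Vf Wf H) j ↔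
          pword a M Vf Wf H i = pword a M Vf Wf H j) := fun i j _ _ => emb_pword_iff h a _
    refine Finset.sum_congr ?_ fun k hk => ?_
    · ext k
      simp only [Finset.mem_filter, Finset.mem_range]
      exact and_congr_right fun hk => rep_congr hiff hk
    · simp only [Finset.mem_filter, Finset.mem_range] at hk
      rw [faceTerm, fnum_congr hiff hk.1, smul_smul, ← pow_add, hφ]
      simp only [List.map_map, Function.comp_assoc, hR]
  -- the faces of the first quilt
  have e2 : Finsupp.linearCombination ℤ (fun P' => Quilt.partialComp h h₁ a P' Q)
      (Quilt.boundary P) = ∑ U : PlanarTree l with PlanarTree.IsExt h a P.1.tree Q.1.tree U,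
        ∑ j ∈ Finset.range M with Rep M Vf j,
          (-1 : ℤ) ^ fnum M Vf j • pathSum (φ U) a (M - 1) N (Vf ∘ skip j) Wf := by
    rw [boundary_eq P hV, map_sum, Finset.sum_comm]
    refine Finset.sum_congr rfl fun j hj => ?_
    simp only [Finset.mem_filter, Finset.mem_range] at hj
    obtain ⟨P', hP1, hP2⟩ := exists_face P hV hj.1 hj.2
    have e := quiltOf_eq P'
    rw [hP1, hP2] at e
    rw [map_zsmul, e, Finsupp.linearCombination_single, one_smul, partialComp_eq h₁ P' Q hP2 hW,
      Finset.smul_sum, hP1]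
  -- the faces of the second quilt
  have e3 : Finsupp.linearCombination ℤ (fun Q' => Quilt.partialComp h h₂ a P Q')
      (Quilt.boundary Q) = ∑ U : PlanarTree l with PlanarTree.IsExt h a P.1.tree Q.1.tree U,
        ∑ t ∈ Finset.range N with Rep N Wf t,
          (-1 : ℤ) ^ fnum N Wf t • pathSum (φ U) a M (N - 1) Vf (Wf ∘ skip t) := by
    rw [boundary_eq Q hW, map_sum, Finset.sum_comm]
    refine Finset.sum_congr rfl fun t ht => ?_
    simp only [Finset.mem_filter, Finset.mem_range] at ht
    obtain ⟨Q', hQ1, hQ2⟩ := exists_face Q hW ht.1 ht.2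
    have e := quiltOf_eq Q'
    rw [hQ1, hQ2] at e
    rw [map_zsmul, e, Finsupp.linearCombination_single, one_smul, partialComp_eq h₂ P Q' hV hQ2,
      Finset.smul_sum, hQ1]
    refine Finset.sum_congr rfl fun U _ => ?_
    unfold pathSum
    congr 1
    refine Finset.sum_congr rfl fun H _ => ?_
    congr 2
    exact congrArg (quiltOf (r - 1) U) (map_emb_pword_congr _ _ _)
  -- `sum_faceTerm` applies for every extension `U` of the trees
  rw [e1, e2, e3, hp, Finset.smul_sum, ← Finset.sum_add_distrib]
  refine Finset.sum_congr rfl fun U _ => ?_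
  rw [sum_faceTerm (φ U) hM hN (exists_letter hV a), Finset.smul_sum]
  congr 1
  refine Finset.sum_congr rfl fun t _ => ?_
  rw [smul_smul, pow_add]

end FunWord

/-! ### Square and equivariance of the boundary operator of quilts -/

namespace FunWord

section

variable {α : Type*} {p : ℕ} {V : ℕ → α}

theorem caes_skip_of_not_rep {j k : ℕ} (hj : j < p) (hn : ¬ Rep p V j) :
    Caes (p - 1) (V ∘ skip j) k ↔ Caes p V (skip j k) := by
  constructor
  · rintro ⟨y, h1, h2, h3⟩
    exact ⟨skip j y, skip_lt_skip.2 h1, skip_lt h2, h3⟩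
  · rintro ⟨y, h1, h2, h3⟩
    by_cases hy : y = j
    · subst hy
      exact absurd ⟨skip y k, by omega, by omega, h3.symm⟩ hn
    · obtain ⟨z, z1, rfl⟩ := exists_skip hj h2 hy
      exact ⟨z, skip_lt_skip.1 h1, z1, h3⟩

theorem cnum_skip_of_not_rep {j : ℕ} (hj : j < p) (hn : ¬ Rep p V j) (k : ℕ) :
    cnum (p - 1) (V ∘ skip j) k = cnum p V (skip j k) := by
  classical
  have hc : ¬ Caes p V j := fun h => hn h.rep
  induction k with
  | zero =>
    rw [cnum_zero]
    by_cases h : j = 0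
    · subst h
      rw [show skip 0 0 = 0 + 1 from rfl, cnum_succ_of_not hc, cnum_zero]
    · rw [show skip j 0 = 0 from if_pos (by omega), cnum_zero]
  | succ k ih =>
    have e : cnum p V (skip j k + 1) = cnum p V (skip j (k + 1)) := by
      by_cases h : k + 1 = j
      · rw [show skip j k = k from if_pos (by omega), show skip j (k + 1) = k + 1 + 1 from
          if_neg (by omega)]
        exact (cnum_succ_of_not (by rwa [h])).symm
      · congr 1; unfold skip; split_ifs <;> omega
    rw [← e, cnum_succ, cnum_succ, ih]
    simp only [caes_skip_of_not_rep hj hn]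

/-- Deleting a letter that is not repeated does not change the numbers of the other letters. -/
theorem fnum_skip_of_not_rep {j k : ℕ} (hj : j < p) (hn : ¬ Rep p V j) (hk : k < p - 1)
    (hr : Rep (p - 1) (V ∘ skip j) k) : fnum (p - 1) (V ∘ skip j) k = fnum p V (skip j k) := by
  by_cases hc : Caes (p - 1) (V ∘ skip j) k
  · rw [fnum_of_caes hc, fnum_of_caes ((caes_skip_of_not_rep hj hn).1 hc),
      cnum_skip_of_not_rep hj hn]
  · obtain ⟨h1, h2, h3⟩ := mark_spec hr hc
    rw [fnum_of_not_caes hk hc h1 h2 fun z z1 z2 => h3 z z1 (by omega) (by omega),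
      fnum_of_not_caes (skip_lt hk) (fun h => hc ((caes_skip_of_not_rep hj hn).2 h))
        (skip_lt_skip.2 h1) h2, cnum_skip_of_not_rep hj hn]
    intro z z1 z2 z3
    by_cases hz : z = j
    · subst hz
      exact hn ⟨skip z k, by omega, skip_lt hk, z3.symm⟩
    · obtain ⟨y, y1, rfl⟩ := exists_skip hj (z2.trans (skip_lt hk)) hz
      exact h3 y (skip_lt_skip.1 z1) y1 (by have := skip_lt_skip.1 z2; omega) z3

theorem skip_skip' {i k : ℕ} (h : i ≤ k) : V ∘ skip (k + 1) ∘ skip i = V ∘ skip i ∘ skip k := by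
  funext x; simp only [Function.comp, skip_skip h]

end

variable {n : ℕ}

open Classical in
/-- The boundary operator of `Quilt` has square zero. -/
theorem bd_boundary {d : ℤ} (Q : Quilt.OfDeg n d) : bd (Quilt.boundary Q) = 0 := by
  obtain ⟨N, x, hx⟩ : ∃ p Vf, Q.1.word.letters = (List.range p).map Vf := ⟨_, _, exists_fn _⟩
  have e1 : bd (Quilt.boundary Q) = ∑ i ∈ Finset.range N with Rep N x i,
      ∑ k ∈ Finset.range (N - 1) with Rep (N - 1) (x ∘ skip i) k,
        (-1 : ℤ) ^ (fnum N x i + fnum (N - 1) (x ∘ skip i) k) •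
          quiltOf (d - 1 - 1) Q.1.tree
            ((List.range (N - 1 - 1)).map (x ∘ skip i ∘ skip k)) := by
    rw [boundary_eq Q hx, map_sum]
    refine Finset.sum_congr rfl fun i hi => ?_
    simp only [Finset.mem_filter, Finset.mem_range] at hi
    obtain ⟨R, hR1, hR2⟩ := exists_face Q hx hi.1 hi.2
    have e := quiltOf_eq R
    rw [hR1, hR2] at e
    rw [map_zsmul, e, bd_single, boundary_eq R hR2, Finset.smul_sum]
    refine Finset.sum_congr rfl fun k _ => ?_
    rw [smul_smul, ← pow_add, hR1, Function.comp_assoc]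
  rw [e1, Finset.sum_sigma']
  -- the pairs of deletions `(i, k)` and `(k + 1, i)`, for `i ≤ k`, delete the same two letters
  have key : ∀ i k, i ≤ k → k < N - 1 →
      ((Rep N x i ∧ Rep (N - 1) (x ∘ skip i) k) ↔
        (Rep N x (k + 1) ∧ Rep (N - 1) (x ∘ skip (k + 1)) i)) := by
    intro i k hik hk
    refine ⟨fun ⟨h1, h2⟩ => ⟨(fnum_add_fnum hik hk h1 h2).1, (fnum_add_fnum hik hk h1 h2).2.1⟩,
      fun ⟨h1, h2⟩ => ?_⟩
    obtain ⟨z, z1, z2, z3, z4⟩ := (rep_skip (by omega)).1 h2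
    rw [show skip (k + 1) i = i from if_pos (by omega)] at z2 z4
    refine ⟨⟨z, z2, z3, z4⟩, (rep_skip (by omega)).2 ?_⟩
    rw [show skip i k = k + 1 from if_neg (by omega)]
    obtain ⟨y, y1, y2, y3⟩ := h1
    by_cases hy : y = i
    · subst hy; exact ⟨z, z2, z1, z3, z4.trans y3⟩
    · exact ⟨y, hy, y1, y2, y3⟩
  have hval : ∀ i k, i ≤ k → k < N - 1 → Rep N x i → Rep (N - 1) (x ∘ skip i) k →
      (-1 : ℤ) ^ (fnum N x i + fnum (N - 1) (x ∘ skip i) k) •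
          quiltOf (d - 1 - 1) Q.1.tree
            ((List.range (N - 1 - 1)).map (x ∘ skip i ∘ skip k)) +
        (-1 : ℤ) ^ (fnum N x (k + 1) + fnum (N - 1) (x ∘ skip (k + 1)) i) •
          quiltOf (d - 1 - 1) Q.1.tree
            ((List.range (N - 1 - 1)).map (x ∘ skip (k + 1) ∘ skip i)) = 0 := by
    intro i k hik hk h1 h2
    rw [neg_one_pow_of_odd_add (fnum_add_fnum hik hk h1 h2).2.2, skip_skip' hik, neg_smul,
      neg_add_cancel]
  refine Finset.sum_involution
    (fun c _ => if c.1 ≤ c.2 then ⟨c.2 + 1, c.1⟩ else ⟨c.2, c.1 - 1⟩) ?_ ?_ ?_ ?_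
  · rintro ⟨i, k⟩ hc
    simp only [Finset.mem_sigma, Finset.mem_filter, Finset.mem_range] at hc ⊢
    obtain ⟨⟨h1, h2⟩, h3, h4⟩ := hc
    by_cases hik : i ≤ k
    · simp only [if_pos hik]
      exact hval i k hik h3 h2 h4
    · simp only [if_neg hik]
      obtain ⟨i, rfl⟩ : ∃ j, i = j + 1 := ⟨i - 1, by omega⟩
      obtain ⟨h5, h6⟩ := (key k i (by omega) (by omega)).2 ⟨h2, h4⟩
      rw [add_comm, Nat.add_sub_cancel]
      exact hval k i (by omega) (by omega) h5 h6
  · rintro ⟨i, k⟩ hc - he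
    by_cases hik : i ≤ k
    · simp only [if_pos hik, Sigma.mk.injEq] at he; omega
    · simp only [if_neg hik, Sigma.mk.injEq] at he; omega
  · rintro ⟨i, k⟩ hc
    simp only [Finset.mem_sigma, Finset.mem_filter, Finset.mem_range] at hc ⊢
    obtain ⟨⟨h1, h2⟩, h3, h4⟩ := hc
    by_cases hik : i ≤ k
    · simp only [if_pos hik]
      obtain ⟨h5, h6⟩ := (key i k hik h3).1 ⟨h2, h4⟩
      exact ⟨⟨by omega, h5⟩, by omega, h6⟩
    · simp only [if_neg hik]
      obtain ⟨i, rfl⟩ : ∃ j, i = j + 1 := ⟨i - 1, by omega⟩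
      obtain ⟨h5, h6⟩ := (key k i (by omega) (by omega)).2 ⟨h2, h4⟩
      exact ⟨⟨by omega, h5⟩, by omega, h6⟩
  · rintro ⟨i, k⟩ hc
    by_cases hik : i ≤ k
    · simp only [if_pos hik]
      rw [if_neg (by omega)]
      simp
    · simp only [if_neg hik]
      rw [if_pos (by omega)]
      simp only [Sigma.mk.injEq, heq_eq_eq, and_true]
      omega

open Classical in
/-- The boundary operator of `Quilt` is equivariant. -/
theorem boundary_quiltAct {d : ℤ} (σ : Equiv.Perm (Fin n)) (Q : Quilt.OfDeg n d) :
    Quilt.boundary (MQuilt.quiltAct σ Q) =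
      Finsupp.linearCombination ℤ (fun R => Finsupp.single (MQuilt.quiltAct σ R) (1 : ℤ))
        (Quilt.boundary Q) := by
  obtain ⟨N, x, hx⟩ : ∃ p Vf, Q.1.word.letters = (List.range p).map Vf := ⟨_, _, exists_fn _⟩
  have hact : ∀ {d : ℤ} (R : Quilt.OfDeg n d) {N : ℕ} {x : ℕ → Fin n},
      R.1.word.letters = (List.range N).map x →
      (MQuilt.quiltAct σ R).1.word.letters = (List.range N).map (σ.symm ∘ x) := by
    intro d R N x hx
    rw [← List.map_map, ← hx]; rfl
  have hiff : ∀ i j, i < N → j < N → ((σ.symm ∘ x) i = (σ.symm ∘ x) j ↔ x i = x j) :=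
    fun i j _ _ => σ.symm.injective.eq_iff
  rw [boundary_eq _ (hact Q hx), boundary_eq Q hx, map_sum]
  refine Finset.sum_congr ?_ fun i hi => ?_
  · ext i
    simp only [Finset.mem_filter, Finset.mem_range]
    exact and_congr_right fun hi => rep_congr hiff hi
  · simp only [Finset.mem_filter, Finset.mem_range] at hi
    obtain ⟨R, hR1, hR2⟩ := exists_face Q hx hi.1 hi.2
    have e := quiltOf_eq R
    rw [hR1, hR2] at e
    have e' := quiltOf_eq (MQuilt.quiltAct σ R)
    rw [hact R hR2] at e'
    rw [show (MQuilt.quiltAct σ R).1.tree = (MQuilt.quiltAct σ Q).1.tree from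
      congrArg (PlanarTree.act σ) hR1] at e'
    rw [map_zsmul, e, Finsupp.linearCombination_single, one_smul, fnum_congr hiff hi.1, ← e',
      Function.comp_assoc]

theorem boundary_quiltOne : Quilt.boundary MQuilt.quiltOne = 0 := by
  refine Finset.sum_eq_zero fun i _ => dif_neg fun h => ?_
  have h1 : ∀ u : Fin 1, ([0] : List (Fin 1)).count u = 1 := by decide
  exact absurd (h.trans_eq (h1 _)) (by norm_num)

theorem boundary_quiltTwo : Quilt.boundary MQuilt.quiltTwo = 0 := by
  refine Finset.sum_eq_zero fun i _ => dif_neg fun h => ?_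
  have h1 : ∀ u : Fin 2, ([0, 1] : List (Fin 2)).count u = 1 := by decide
  exact absurd (h.trans_eq (h1 _)) (by norm_num)

end FunWord

/-! ### The Leibniz rule on formal expressions -/

namespace GradedOperad

variable {O : GradedOperad}

theorem negOnePow_congr {a b : ℤ} (h : Even (a - b)) :
    (a.negOnePow : ℤ) = (b.negOnePow : ℤ) := by
  rw [(Int.negOnePow_eq_iff a b).2 h]

theorem negOnePow_mul (a b : ℤ) :
    (a.negOnePow : ℤ) * (b.negOnePow : ℤ) = ((a + b).negOnePow : ℤ) := by
  rw [Int.negOnePow_add, Units.val_mul]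

theorem negOnePow_eq_neg {a b : ℤ} (h : Odd (a - b)) :
    (a.negOnePow : ℤ) = -(b.negOnePow : ℤ) := by
  have : a = (a - b) + b := by ring
  rw [this, Int.negOnePow_add, Int.negOnePow_odd _ h]
  simp

/-- The value at `x ∘ₐ y` of a derivation of degree `-1` with values `x'` at `x` and `y'` at `y`. -/
def leib {m n l : ℕ} (h : l + 1 = m + n) {p q r : ℤ} (hd : r = p + q) (a : Fin m)
    (x : O.obj m p) (x' : O.obj m (p - 1)) (y : O.obj n q) (y' : O.obj n (q - 1)) :
    O.obj l (r - 1) :=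
  O.comp h (show r - 1 = (p - 1) + q by omega) a x' y +
    (p.negOnePow : ℤ) • O.comp h (show r - 1 = p + (q - 1) by omega) a x y'

theorem comp_smul_left {m n l : ℕ} (h : l + 1 = m + n) {p q r : ℤ} (hd : r = p + q) (a : Fin m)
    (c : ℤ) (x : O.obj m p) (y : O.obj n q) :
    O.comp h hd a (c • x) y = c • O.comp h hd a x y := by
  rw [map_zsmul, AddMonoidHom.coe_smul, Pi.smul_apply]

theorem comp_add_left {m n l : ℕ} (h : l + 1 = m + n) {p q r : ℤ} (hd : r = p + q) (a : Fin m)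
    (x x' : O.obj m p) (y : O.obj n q) :
    O.comp h hd a (x + x') y = O.comp h hd a x y + O.comp h hd a x' y := by
  rw [map_add, AddMonoidHom.add_apply]

/-- The Leibniz rule is compatible with the sequential composition axiom. -/
theorem leib_assoc {m n k l₁ l₂ l : ℕ} {p q t s₁ s₂ r : ℤ}
    (h₁ : l₁ + 1 = m + n) (h₂ : l + 1 = l₁ + k) (h₃ : l₂ + 1 = n + k) (h₄ : l + 1 = m + l₂)
    (d₁ : s₁ = p + q) (d₂ : r = s₁ + t) (d₃ : s₂ = q + t) (d₄ : r = p + s₂)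
    (a : Fin m) (b : Fin n) (x : O.obj m p) (x' : O.obj m (p - 1)) (y : O.obj n q)
    (y' : O.obj n (q - 1)) (z : O.obj k t) (z' : O.obj k (t - 1)) :
    leib h₂ d₂ (blockIncl h₁ a b) (O.comp h₁ d₁ a x y) (leib h₁ d₁ a x x' y y') z z' =
      leib h₄ d₄ a x x' (O.comp h₃ d₃ b y z) (leib h₃ d₃ b y y' z z') := by
  unfold leib
  rw [comp_add_left, comp_smul_left, map_add, map_zsmul,
    O.comp_assoc h₁ h₂ h₃ h₄ _ _ d₃ (show r - 1 = (p - 1) + s₂ by omega),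
    O.comp_assoc h₁ h₂ h₃ h₄ _ _ (show s₂ - 1 = (q - 1) + t by omega)
      (show r - 1 = p + (s₂ - 1) by omega),
    O.comp_assoc h₁ h₂ h₃ h₄ _ _ (show s₂ - 1 = q + (t - 1) by omega)
      (show r - 1 = p + (s₂ - 1) by omega), smul_add, smul_smul, negOnePow_mul,
    negOnePow_congr (a := s₁) (b := p + q) ⟨0, by omega⟩, add_assoc]

/-- The Leibniz rule is compatible with the parallel composition axiom and its Koszul sign. -/
theorem leib_comm {m n k l₁ l₂ l : ℕ} {p q t s₁ s₂ r : ℤ}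
    (h₁ : l₁ + 1 = m + n) (h₂ : l + 1 = l₁ + k) (h₃ : l₂ + 1 = m + k) (h₄ : l + 1 = l₂ + n)
    (d₁ : s₁ = p + q) (d₂ : r = s₁ + t) (d₃ : s₂ = p + t) (d₄ : r = s₂ + q)
    (a b : Fin m) (hab : a < b) (b' : Fin l₁) (hb : (b' : ℕ) + 1 = b + n)
    (a' : Fin l₂) (ha : (a' : ℕ) = a) (x : O.obj m p) (x' : O.obj m (p - 1)) (y : O.obj n q)
    (y' : O.obj n (q - 1)) (z : O.obj k t) (z' : O.obj k (t - 1)) :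
    leib h₂ d₂ b' (O.comp h₁ d₁ a x y) (leib h₁ d₁ a x x' y y') z z' =
      ((q * t).negOnePow : ℤ) •
        leib h₄ d₄ a' (O.comp h₃ d₃ b x z) (leib h₃ d₃ b x x' z z') y y' := by
  unfold leib
  rw [comp_add_left, comp_smul_left, comp_add_left, comp_smul_left,
    O.comp_comm h₁ h₂ h₃ h₄ (show s₁ - 1 = (p - 1) + q by omega) (show r - 1 = s₁ - 1 + t by omega)
      (show s₂ - 1 = (p - 1) + t by omega) (show r - 1 = s₂ - 1 + q by omega) a b hab b' hb a' ha,
    O.comp_comm h₁ h₂ h₃ h₄ (show s₁ - 1 = p + (q - 1) by omega) (show r - 1 = s₁ - 1 + t by omega)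
      d₃ (show r - 1 = s₂ + (q - 1) by omega) a b hab b' hb a' ha,
    O.comp_comm h₁ h₂ h₃ h₄ d₁ (show r - 1 = s₁ + (t - 1) by omega)
      (show s₂ - 1 = p + (t - 1) by omega) (show r - 1 = s₂ - 1 + q by omega) a b hab b' hb a' ha]
  simp only [smul_add, smul_smul, negOnePow_mul]
  rw [negOnePow_congr (a := p + (q - 1) * t) (b := q * t + s₂) ⟨-t, by subst d₃; ring⟩,
    negOnePow_congr (a := s₁ + q * (t - 1)) (b := q * t + p) ⟨0, by subst d₁; ring⟩]
  abel

/-- The Leibniz rule is compatible with the equivariance of the compositions. -/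
theorem leib_act {m n l : ℕ} (h : l + 1 = m + n) {p q r : ℤ} (hd : r = p + q) (a : Fin m)
    (σ : Equiv.Perm (Fin m)) (τ : Equiv.Perm (Fin n)) (π : Equiv.Perm (Fin l))
    (hπ₁ : ∀ j, π (blockIncl h a j) = blockIncl h (σ a) (τ j))
    (hπ₂ : ∀ k, blockProj h (σ a) (π k) = σ (blockProj h a k)) (x : O.obj m p)
    (x' : O.obj m (p - 1)) (y : O.obj n q) (y' : O.obj n (q - 1)) :
    leib h hd a (O.act σ x) (O.act σ x') (O.act τ y) (O.act τ y') =
      O.act π (leib h hd (σ a) x x' y y') := by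
  unfold leib
  rw [O.act_comp h _ a σ τ π hπ₁ hπ₂, O.act_comp h _ a σ τ π hπ₁ hπ₂, map_add, map_zsmul]

theorem leib_one_left {n : ℕ} {d : ℤ} (h : n + 1 = 1 + n) (hd : d = 0 + d) (y : O.obj n d)
    (y' : O.obj n (d - 1)) : leib h hd 0 O.one 0 y y' = y' := by
  unfold leib
  rw [O.one_comp, map_zero, AddMonoidHom.zero_apply]
  simp

theorem leib_one_right {n : ℕ} {d : ℤ} (h : n + 1 = n + 1) (hd : d = d + 0) (a : Fin n)
    (x : O.obj n d) (x' : O.obj n (d - 1)) : leib h hd a x x' O.one 0 = x' := by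
  unfold leib
  rw [O.comp_one, map_zero, smul_zero, add_zero]

theorem leib_add_left {m n l : ℕ} (h : l + 1 = m + n) {p q r : ℤ} (hd : r = p + q) (a : Fin m)
    (x₁ x₂ : O.obj m p) (x₁' x₂' : O.obj m (p - 1)) (y : O.obj n q) (y' : O.obj n (q - 1)) :
    leib h hd a (x₁ + x₂) (x₁' + x₂') y y' =
      leib h hd a x₁ x₁' y y' + leib h hd a x₂ x₂' y y' := by
  unfold leib
  rw [comp_add_left, comp_add_left, smul_add]
  abel

theorem leib_add_right {m n l : ℕ} (h : l + 1 = m + n) {p q r : ℤ} (hd : r = p + q) (a : Fin m)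
    (x : O.obj m p) (x' : O.obj m (p - 1)) (y₁ y₂ : O.obj n q) (y₁' y₂' : O.obj n (q - 1)) :
    leib h hd a x x' (y₁ + y₂) (y₁' + y₂') =
      leib h hd a x x' y₁ y₁' + leib h hd a x x' y₂ y₂' := by
  unfold leib
  rw [map_add, map_add, smul_add]
  abel

end GradedOperad

namespace MQuilt

/-- The class of a formal expression, as an element of `mQuilt`. -/
def cls {n : ℕ} {d : ℤ} (x : Pre n d) : mQuilt.obj n d := mk x

/-- The boundary of a formal expression, determined by the Leibniz rule and `∂ m = 0`. -/
noncomputable def preBoundary : ∀ {n : ℕ} {d : ℤ}, Pre n d → mQuilt.obj n (d - 1)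
  | _, _, Pre.gen x => ι (FunWord.bd x)
  | _, _, Pre.m => 0
  | _, _, Pre.one => 0
  | _, _, Pre.zero => 0
  | _, _, Pre.neg x => -preBoundary x
  | _, _, Pre.add x y => preBoundary x + preBoundary y
  | _, _, Pre.act σ x => mQuilt.act σ (preBoundary x)
  | _, _, Pre.comp h hd a x y =>
    GradedOperad.leib h hd a (cls x) (preBoundary x) (cls y) (preBoundary y)

theorem preBoundary_signed {n : ℕ} {d : ℤ} (k : ℤ) (x : Pre n d) :
    preBoundary (Pre.signed k x) = (k.negOnePow : ℤ) • preBoundary x := by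
  unfold Pre.signed
  split_ifs with hk
  · rw [Int.negOnePow_even k hk, Units.val_one, one_smul]
  · rw [Int.negOnePow_odd k (Int.not_even_iff_odd.1 hk), Units.val_neg, Units.val_one, neg_smul,
      one_smul, preBoundary]

theorem preBoundary_ofQuilt {n : ℕ} {d : ℤ} (Q : Quilt.OfDeg n d) :
    preBoundary (Pre.ofQuilt Q) = ι (Quilt.boundary Q) := by
  rw [Pre.ofQuilt, preBoundary, FunWord.bd_single]

theorem ι_partialComp {m n l : ℕ} (h : l + 1 = m + n) {p q r : ℤ} (hd : r = p + q) (a : Fin m)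
    (P : Quilt.OfDeg m p) (Q : Quilt.OfDeg n q) :
    ι (Quilt.partialComp h hd a P Q) =
      mQuilt.comp h hd a (ι (Finsupp.single P 1)) (ι (Finsupp.single Q 1)) :=
  mk_eq (Rel.gen_comp h hd a P Q)

theorem ι_quiltAct {n : ℕ} {d : ℤ} (σ : Equiv.Perm (Fin n)) (Q : Quilt.OfDeg n d) :
    ι (Finsupp.single (quiltAct σ Q) 1) = mQuilt.act σ (ι (Finsupp.single Q 1)) :=
  mk_eq (Rel.gen_act σ Q)

theorem ι_quiltOne : ι (Finsupp.single quiltOne 1) = mQuilt.one := mk_eq Rel.gen_one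

theorem ι_linearCombination_left {m n l : ℕ} (h : l + 1 = m + n) {p q r : ℤ} (hd : r = p + q)
    (a : Fin m) (x : Quilt.Mod m p) (Q : Quilt.OfDeg n q) :
    ι (Finsupp.linearCombination ℤ (fun P => Quilt.partialComp h hd a P Q) x) =
      mQuilt.comp h hd a (ι x) (ι (Finsupp.single Q 1)) := by
  induction x using Finsupp.induction_linear with
  | zero => simp
  | add x y hx hy => rw [map_add, map_add, hx, hy, map_add, GradedOperad.comp_add_left]
  | single P c =>
    rw [Finsupp.linearCombination_single, map_zsmul, ι_partialComp,
      ← GradedOperad.comp_smul_left, ← map_zsmul, Finsupp.smul_single, smul_eq_mul, mul_one]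

theorem ι_linearCombination_right {m n l : ℕ} (h : l + 1 = m + n) {p q r : ℤ} (hd : r = p + q)
    (a : Fin m) (P : Quilt.OfDeg m p) (y : Quilt.Mod n q) :
    ι (Finsupp.linearCombination ℤ (fun Q => Quilt.partialComp h hd a P Q) y) =
      mQuilt.comp h hd a (ι (Finsupp.single P 1)) (ι y) := by
  induction y using Finsupp.induction_linear with
  | zero => simp
  | add x y hx hy => rw [map_add, map_add, hx, hy, map_add, map_add]
  | single Q c =>
    rw [Finsupp.linearCombination_single, map_zsmul, ι_partialComp, ← map_zsmul, ← map_zsmul,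
      Finsupp.smul_single, smul_eq_mul, mul_one]

theorem ι_linearCombination_act {n : ℕ} {d : ℤ} (σ : Equiv.Perm (Fin n)) (x : Quilt.Mod n d) :
    ι (Finsupp.linearCombination ℤ (fun R => Finsupp.single (quiltAct σ R) (1 : ℤ)) x) =
      mQuilt.act σ (ι x) := by
  induction x using Finsupp.induction_linear with
  | zero => simp
  | add x y hx hy => rw [map_add, map_add, hx, hy, map_add, map_add]
  | single Q c =>
    rw [Finsupp.linearCombination_single, map_zsmul, ι_quiltAct, ← map_zsmul, ← map_zsmul,
      Finsupp.smul_single, smul_eq_mul, mul_one]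

/-- The composite of `m` with the boundary of a quilt at the vertex `u`. -/
noncomputable def boundaryComp {n l : ℕ} (h : l + 1 = n + 0) {d r : ℤ} (hd : r = d + -1)
    (Q : Quilt.OfDeg n d) (u : Fin n) : mQuilt.obj l (r - 1) :=
  mQuilt.comp h (show r - 1 = (d - 1) + -1 by omega) u (ι (Quilt.boundary Q)) gm

theorem preBoundary_comp_m {n l : ℕ} (h : l + 1 = n + 0) {d r : ℤ} (hd : r = d + -1)
    (Q : Quilt.OfDeg n d) (u : Fin n) :
    preBoundary (Pre.comp h hd u (Pre.ofQuilt Q) Pre.m) = boundaryComp h hd Q u := by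
  rw [preBoundary, GradedOperad.leib, preBoundary_ofQuilt, preBoundary, map_zero, smul_zero,
    add_zero]
  rfl

end MQuilt

/-! ### Inserting `m` in the boundary of a quilt -/

namespace FunWord

variable {n : ℕ}

theorem filter_eraseIdx {L : List (Fin n)} {k : ℕ} {u : Fin n} (hk : L[k]? = some u) :
    (L.eraseIdx k).filter (fun v => decide (v ≠ u)) = L.filter (fun v => decide (v ≠ u)) := by
  obtain ⟨hlt, hk⟩ := List.getElem?_eq_some_iff.1 hk
  conv_rhs => rw [← List.take_append_drop k L, ← List.cons_getElem_drop_succ (h := hlt), hk]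
  rw [List.eraseIdx_eq_take_drop_succ, List.filter_append, List.filter_append,
    List.filter_cons_of_neg (by simp)]

theorem filter_map_range {x : ℕ → Fin n} {N i : ℕ} {u : Fin n} (hi : i < N) (hx : x i = u)
    (h : ∀ z, z < N → x z = u → z = i) :
    ((List.range N).map x).filter (fun v => decide (v ≠ u)) =
      (List.range (N - 1)).map (x ∘ skip i) := by
  rw [← filter_eraseIdx (k := i) (by rw [getElem?_map_range, if_pos hi, hx]),
    eraseIdx_map_range x hi, List.filter_eq_self]
  intro v hv
  obtain ⟨k, hk, rfl⟩ := List.mem_map.1 hv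
  have hk := List.mem_range.1 hk
  simp only [decide_eq_true_eq]
  exact fun e => skip_ne i k (h _ (skip_lt hk) e)

theorem infix_map_range {x : ℕ → Fin n} {N i : ℕ} (hi : i + 2 < N) :
    [x i, x (i + 1), x (i + 2)] <:+: (List.range N).map x := by
  have : [i, i + 1, i + 2] <:+: List.range N := by
    refine ⟨List.range i, List.range' (i + 3) (N - (i + 3)), ?_⟩
    rw [show [i, i + 1, i + 2] = List.range' i 3 from rfl, List.range_eq_range',
      List.range_eq_range', List.append_assoc]
    have e1 := List.range'_append_1 (s := i) (m := 3) (n := N - (i + 3))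
    have e2 := List.range'_append_1 (s := 0) (m := i) (n := 3 + (N - (i + 3)))
    rw [zero_add] at e2
    rw [e1, e2]
    congr 1; omega
  exact this.map x

end FunWord

namespace MQuilt

open FunWord

variable {n l : ℕ} (h : l + 1 = n + 0) {d r : ℤ} (hd : r = d + -1) (Q : Quilt.OfDeg n d) (u : Fin n)

theorem comp_gm_binary (hu : 2 < {v | Q.1.tree.edge u v}.ncard) :
    mQuilt.comp h hd u (ι (Finsupp.single Q 1)) gm = 0 := mk_eq (Rel.m_binary h hd Q u hu)

theorem comp_gm_repeated (hu : Q.1.word.Repeated u) :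
    mQuilt.comp h hd u (ι (Finsupp.single Q 1)) gm = 0 := mk_eq (Rel.m_repeated h hd Q u hu)

theorem comp_gm_between (v : Fin n) (hu : [v, u, v] <:+: Q.1.word.letters) :
    mQuilt.comp h hd u (ι (Finsupp.single Q 1)) gm = 0 := mk_eq (Rel.m_between h hd Q u v hu)

theorem comp_gm_move (P : Quilt.OfDeg n d) (ht : Q.1.tree = P.1.tree)
    (hw : Q.1.word.letters.filter (fun v => decide (v ≠ u)) =
      P.1.word.letters.filter (fun v => decide (v ≠ u))) :
    mQuilt.comp h hd u (ι (Finsupp.single Q 1)) gm =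
      mQuilt.comp h hd u (ι (Finsupp.single P 1)) gm := mk_eq (Rel.m_move h hd P Q u ht hw)

/-- The composite at `u` of `m` with the quilt that has the given tree and word; it is `0` if there
is no such quilt. -/
noncomputable def plug (T : PlanarTree n) (L : List (Fin n)) : mQuilt.obj l r :=
  mQuilt.comp h hd u (ι (quiltOf d T L)) gm

theorem plug_eq {T : PlanarTree n} {L : List (Fin n)} (hT : Q.1.tree = T)
    (hL : Q.1.word.letters = L) :
    plug h hd u T L = mQuilt.comp h hd u (ι (Finsupp.single Q 1)) gm := by
  subst hT hL
  rw [plug, quiltOf_eq]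

variable {N : ℕ} {x : ℕ → Fin n}

open Classical in
theorem boundaryComp_eq (hx : Q.1.word.letters = (List.range N).map x) :
    boundaryComp h hd Q u = ∑ k ∈ Finset.range N with Rep N x k, (-1 : ℤ) ^ fnum N x k •
      plug h (show r - 1 = (d - 1) + -1 by omega) u Q.1.tree
        ((List.range (N - 1)).map (x ∘ skip k)) := by
  rw [boundaryComp, boundary_eq Q hx, map_sum, map_sum, AddMonoidHom.finsetSum_apply]
  refine Finset.sum_congr rfl fun k _ => ?_
  rw [map_zsmul, GradedOperad.comp_smul_left, plug]

/-- A face in which `u` is still repeated vanishes after inserting `m`. -/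
theorem plug_face_repeated (hx : Q.1.word.letters = (List.range N).map x) {k z z' : ℕ}
    (hk : k < N) (hr : Rep N x k) (hzz : z ≠ z') (hzk : z ≠ k) (hzk' : z' ≠ k) (hz : z < N)
    (hz' : z' < N) (hu : x z = u) (hu' : x z' = u) :
    plug h (show r - 1 = (d - 1) + -1 by omega) u Q.1.tree
      ((List.range (N - 1)).map (x ∘ skip k)) = 0 := by
  obtain ⟨R, hR1, hR2⟩ := exists_face Q hx hk hr
  rw [plug_eq _ _ R _ hR1 hR2]
  refine comp_gm_repeated _ _ _ _ ?_
  obtain ⟨y, hy, rfl⟩ := exists_skip hk hz hzk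
  rw [← hu]
  exact (repeated_iff hR2 hy).2 ((rep_skip hk).2 ⟨z', hzk', hzz.symm, hz', hu'.trans hu.symm⟩)

/-- If `u` is repeated, then the faces that delete a letter other than `u` vanish after inserting
`m`, and so do those deleting `u` if it occurs at least three times; if `u` occurs twice, then the
faces deleting it cancel. -/
theorem boundaryComp_repeated (hu : Q.1.word.Repeated u) : boundaryComp h hd Q u = 0 := by
  classical
  obtain ⟨N, x, hx⟩ : ∃ p Vf, Q.1.word.letters = (List.range p).map Vf := ⟨_, _, exists_fn _⟩
  obtain ⟨i, j, hij, hj, hxi, hxj⟩ : ∃ i j, i < j ∧ j < N ∧ x i = u ∧ x j = u := by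
    obtain ⟨i, hi, rfl⟩ := exists_letter hx u
    obtain ⟨j, h1, h2, h3⟩ := (repeated_iff hx hi).1 hu
    rcases lt_or_gt_of_ne h1 with h4 | h4
    · exact ⟨j, i, h4, hi, h3, rfl⟩
    · exact ⟨i, j, h4, h2, rfl, h3⟩
  have hci : Caes N x i := ⟨j, hij, hj, hxj.trans hxi.symm⟩
  rw [boundaryComp_eq h hd Q u hx]
  -- with a third occurrence of `u`, it is repeated in all faces
  by_cases h3 : ∃ z, z ≠ i ∧ z ≠ j ∧ z < N ∧ x z = u
  · obtain ⟨z, z1, z2, z3, z4⟩ := h3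
    refine Finset.sum_eq_zero fun k hk => ?_
    simp only [Finset.mem_filter, Finset.mem_range] at hk
    by_cases hki : i = k
    · rw [plug_face_repeated h hd Q u hx hk.1 hk.2 z2 (hki ▸ z1) (by omega) z3 hj z4 hxj, smul_zero]
    · by_cases hkj : j = k
      · rw [plug_face_repeated h hd Q u hx hk.1 hk.2 z1 (hkj ▸ z2) (by omega) z3 (by omega) z4 hxi,
          smul_zero]
      · rw [plug_face_repeated h hd Q u hx hk.1 hk.2 hij.ne hki hkj (by omega) hj hxi hxj,
          smul_zero]
  · push Not at h3
    have hncj : ¬ Caes N x j := by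
      rintro ⟨z, z1, z2, z3⟩
      exact h3 z (by omega) (by omega) z2 (z3.trans hxj)
    have hri : Rep N x i := hci.rep
    have hrj : Rep N x j := ⟨i, hij.ne, by omega, hxi.trans hxj.symm⟩
    -- otherwise only the faces deleting one of the two occurrences remain; they differ by the
    -- position of `u`, and have consecutive numbers
    rw [Finset.sum_eq_add_of_mem i j (by simp [hri]; omega) (by simp [hrj, hj]) hij.ne]
    · obtain ⟨R, hR1, hR2⟩ := exists_face Q hx (by omega) hri
      obtain ⟨R', hR1', hR2'⟩ := exists_face Q hx hj hrj
      rw [plug_eq _ _ R _ hR1 hR2, plug_eq _ _ R' _ hR1' hR2',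
        comp_gm_move _ _ R u R' (hR1.trans hR1'.symm), ← add_smul, fnum_of_caes hci,
        fnum_of_not_caes hj hncj hij (hxi.trans hxj.symm)
          fun z z1 z2 z3 => h3 z (by omega) (by omega) (by omega) (z3.trans hxj)]
      · rw [pow_succ, pow_add]; simp
      · rw [hR2, hR2', ← eraseIdx_map_range x (by omega), ← eraseIdx_map_range x hj,
          filter_eraseIdx, filter_eraseIdx]
        · rw [getElem?_map_range, if_pos hj, hxj]
        · rw [getElem?_map_range, if_pos (by omega), hxi]
    · rintro k hk ⟨k1, k2⟩
      simp only [Finset.mem_filter, Finset.mem_range] at hk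
      rw [plug_face_repeated h hd Q u hx hk.1 hk.2 hij.ne k1.symm k2.symm (by omega) hj hxi hxj,
        smul_zero]

/-- If the word is `… v u v …`, then the faces deleting one of these two `v` cancel after inserting
`m`, and the other ones vanish. -/
theorem boundaryComp_between (v : Fin n) (hu : [v, u, v] <:+: Q.1.word.letters) :
    boundaryComp h hd Q u = 0 := by
  classical
  by_cases hru : Q.1.word.Repeated u
  · exact boundaryComp_repeated h hd Q u hru
  obtain ⟨N, x, hx⟩ : ∃ p Vf, Q.1.word.letters = (List.range p).map Vf := ⟨_, _, exists_fn _⟩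
  obtain ⟨i, hi, e0, e1, e2⟩ : ∃ i, i + 2 < N ∧ x i = v ∧ x (i + 1) = u ∧ x (i + 2) = v := by
    obtain ⟨s, t, hst⟩ := hu
    rw [hx] at hst
    have hl := congrArg List.length hst
    simp only [List.length_append, List.length_cons, List.length_nil, List.length_map,
      List.length_range] at hl
    have e : ∀ k, k < N → (s ++ [v, u, v] ++ t)[k]? = some (x k) := fun k hk => by
      rw [hst, getElem?_map_range, if_pos hk]
    refine ⟨s.length, by omega, ?_, ?_, ?_⟩
    · have := e s.length (by omega)
      rw [List.append_assoc, List.getElem?_append_right (by omega)] at this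
      simpa using this.symm
    · have := e (s.length + 1) (by omega)
      rw [List.append_assoc, List.getElem?_append_right (by omega)] at this
      simpa using this.symm
    · have := e (s.length + 2) (by omega)
      rw [List.append_assoc, List.getElem?_append_right (by omega)] at this
      simpa using this.symm
  have huu : ∀ z, z < N → x z = u → z = i + 1 := by
    intro z z1 z2
    by_contra hne
    exact hru (e1 ▸ (repeated_iff hx (by omega)).2 ⟨z, hne, z1, z2.trans e1.symm⟩)
  have hci : Caes N x i := ⟨i + 2, by omega, hi, e2.trans e0.symm⟩
  have hnc : ¬ Caes N x (i + 1) := fun ⟨z, z1, z2, z3⟩ => by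
    have := huu z z2 (z3.trans e1); omega
  have hr2 : Rep N x (i + 2) := ⟨i, by omega, by omega, e0.trans e2.symm⟩
  rw [boundaryComp_eq h hd Q u hx, Finset.sum_eq_add_of_mem i (i + 2)
    (by simp [hci.rep]; omega) (by simp [hr2, hi]) (by omega)]
  · obtain ⟨R, hR1, hR2⟩ := exists_face Q hx (by omega) hci.rep
    obtain ⟨R', hR1', hR2'⟩ := exists_face Q hx hi hr2
    -- the numbers of the two deletions are consecutive, since `u` is not a caesura
    have hf2 : fnum N x (i + 2) = cnum N x i + 2 := by
      by_cases hc : Caes N x (i + 2)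
      · rw [fnum_of_caes hc, cnum_succ_of_not hnc, cnum_succ_of hci]
      · refine fnum_of_not_caes hi hc (by omega) (e0.trans e2.symm) fun z z1 z2 => ?_
        obtain rfl : z = i + 1 := by omega
        rw [e1, e2, ← e1, ← e0]
        exact (chain_ne hx (by omega)).symm
    rw [plug_eq _ _ R _ hR1 hR2, plug_eq _ _ R' _ hR1' hR2',
      comp_gm_move _ _ R u R' (hR1.trans hR1'.symm), ← add_smul, fnum_of_caes hci, hf2]
    · rw [pow_succ, pow_add]; simp
    · rw [hR2, hR2', filter_map_range (i := i) (by omega), filter_map_range (i := i + 1) (by omega)]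
      · refine List.map_congr_left fun z _ => ?_
        simp only [Function.comp]
        rcases lt_trichotomy z i with hz | rfl | hz
        · congr 1; unfold skip; split_ifs <;> omega
        · rw [show skip z (skip z z) = z + 2 by unfold skip; simp,
            show skip (z + 2) (skip (z + 1) z) = z by unfold skip; simp, e0, e2]
        · congr 1; unfold skip; split_ifs <;> omega
      · simp only [Function.comp]
        rw [show skip (i + 2) (i + 1) = i + 1 by unfold skip; simp, e1]
      · intro z z1 z2
        have := huu _ (skip_lt z1) z2
        revert this; unfold skip; split_ifs <;> omega
      · simp only [Function.comp]
        rw [show skip i i = i + 1 by unfold skip; simp, e1]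
      · intro z z1 z2
        have := huu _ (skip_lt z1) z2
        revert this; unfold skip; split_ifs <;> omega
  · rintro k hk ⟨k1, k2⟩
    simp only [Finset.mem_filter, Finset.mem_range] at hk
    have k3 : k ≠ i + 1 := by
      rintro rfl
      exact hru (e1 ▸ (repeated_iff hx hk.1).2 hk.2)
    obtain ⟨R, hR1, hR2⟩ := exists_face Q hx hk.1 hk.2
    rw [plug_eq _ _ R _ hR1 hR2, comp_gm_between _ _ _ _ v, smul_zero]
    rw [hR2]
    by_cases hki : k < i
    · have := infix_map_range (x := x ∘ skip k) (N := N - 1) (i := i - 1) (by omega)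
      simp only [Function.comp] at this
      rwa [show skip k (i - 1) = i by unfold skip; split_ifs <;> omega,
        show skip k (i - 1 + 1) = i + 1 by unfold skip; split_ifs <;> omega,
        show skip k (i - 1 + 2) = i + 2 by unfold skip; split_ifs <;> omega, e0, e1, e2] at this
    · have := infix_map_range (x := x ∘ skip k) (N := N - 1) (i := i) (by omega)
      simp only [Function.comp] at this
      rwa [show skip k i = i by unfold skip; split_ifs <;> omega,
        show skip k (i + 1) = i + 1 by unfold skip; split_ifs <;> omega,
        show skip k (i + 2) = i + 2 by unfold skip; split_ifs <;> omega, e0, e1, e2] at this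

/-- The faces of a quilt have the same tree. -/
theorem boundaryComp_binary (hu : 2 < {v | Q.1.tree.edge u v}.ncard) :
    boundaryComp h hd Q u = 0 := by
  classical
  obtain ⟨N, x, hx⟩ : ∃ p Vf, Q.1.word.letters = (List.range p).map Vf := ⟨_, _, exists_fn _⟩
  rw [boundaryComp_eq h hd Q u hx]
  refine Finset.sum_eq_zero fun k hk => ?_
  simp only [Finset.mem_filter, Finset.mem_range] at hk
  obtain ⟨R, hR1, hR2⟩ := exists_face Q hx hk.1 hk.2
  rw [plug_eq _ _ R _ hR1 hR2, comp_gm_binary _ _ _ _ (by rwa [hR1]), smul_zero]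

open Classical in
/-- If `u` occurs only at position `i`, then the composite of `m` with the boundary of a quilt is a
sum over the faces of the word without `u`. -/
theorem boundaryComp_eq_sum_skip (hx : Q.1.word.letters = (List.range N).map x) {i : ℕ} (hi : i < N)
    (hxi : x i = u) (hn : ¬ Rep N x i) :
    boundaryComp h hd Q u = ∑ k ∈ Finset.range (N - 1) with Rep (N - 1) (x ∘ skip i) k,
      (-1 : ℤ) ^ fnum (N - 1) (x ∘ skip i) k •
        plug h (show r - 1 = (d - 1) + -1 by omega) u Q.1.tree
          ((List.range (N - 1)).map (x ∘ skip (skip i k))) := by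
  have hrep : ∀ k, k < N - 1 → (Rep (N - 1) (x ∘ skip i) k ↔ Rep N x (skip i k)) := by
    intro k hk
    rw [rep_skip hi]
    constructor
    · rintro ⟨z, z1, z2, z3, z4⟩; exact ⟨z, z2, z3, z4⟩
    · rintro ⟨z, z1, z2, z3⟩
      refine ⟨z, ?_, z1, z2, z3⟩
      rintro rfl
      exact hn ⟨skip z k, skip_ne _ _, skip_lt hk, z3.symm⟩
  rw [boundaryComp_eq h hd Q u hx]
  symm
  refine Finset.sum_bij (fun k _ => skip i k) ?_ ?_ ?_ ?_
  · intro k hk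
    simp only [Finset.mem_filter, Finset.mem_range] at hk ⊢
    exact ⟨skip_lt hk.1, (hrep k hk.1).1 hk.2⟩
  · intro k _ k' _ e
    rcases lt_trichotomy k k' with hlt | rfl | hlt
    · exact absurd e (skip_lt_skip.2 hlt).ne
    · rfl
    · exact absurd e.symm (skip_lt_skip.2 hlt).ne
  · intro z hz
    simp only [Finset.mem_filter, Finset.mem_range] at hz
    obtain ⟨k, hk, rfl⟩ := exists_skip hi hz.1 fun e => hn (e ▸ hz.2)
    exact ⟨k, by simpa [hk] using (hrep k hk).2 hz.2, rfl⟩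
  · intro k hk
    simp only [Finset.mem_filter, Finset.mem_range] at hk
    rw [fnum_skip_of_not_rep hi hn hk.1 hk.2]

/-- Deleting a letter other than `u`, and then `u`, which occurs only at position `i`. -/
theorem filter_face {i k : ℕ} (hi : i < N) (hxi : x i = u) (hn : ¬ Rep N x i) (hk : k < N - 1) :
    ((List.range (N - 1)).map (x ∘ skip (skip i k))).filter (fun v => decide (v ≠ u)) =
      (List.range (N - 1 - 1)).map (x ∘ skip i ∘ skip k) := by
  have huu : ∀ z, z < N → x z = u → z = i := by
    intro z z1 z2
    by_contra hne
    exact hn ⟨z, hne, z1, z2.trans hxi.symm⟩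
  by_cases hik : i ≤ k
  · have hs : skip i k = k + 1 := if_neg (by omega)
    rw [hs, filter_map_range (i := i) (by omega), ← skip_skip' hik]; rfl
    · simp only [Function.comp]
      rw [show skip (k + 1) i = i from if_pos (by omega), hxi]
    · intro z z1 z2
      have := huu _ (skip_lt z1) z2
      revert this; unfold skip; split_ifs <;> omega
  · have hs : skip i k = k := if_pos (by omega)
    obtain ⟨i, rfl⟩ : ∃ j, i = j + 1 := ⟨i - 1, by omega⟩
    rw [hs, filter_map_range (i := i) (by omega), skip_skip' (by omega)]; rfl
    · simp only [Function.comp]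
      rw [show skip k i = i + 1 from if_neg (by omega), hxi]
    · intro z z1 z2
      have := huu _ (skip_lt z1) z2
      revert this; unfold skip; split_ifs <;> omega

/-- If `u` is repeated, both sides vanish; otherwise the faces of the two words correspond to the
faces of the word without `u`. -/
theorem boundaryComp_move (P : Quilt.OfDeg n d) (ht : Q.1.tree = P.1.tree)
    (hw : Q.1.word.letters.filter (fun v => decide (v ≠ u)) =
      P.1.word.letters.filter (fun v => decide (v ≠ u))) :
    boundaryComp h hd Q u = boundaryComp h hd P u := by
  classical
  have hlen : Q.1.word.letters.length = P.1.word.letters.length := by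
    have h1 := Q.2
    have h2 := P.2
    simp only [Quilt.deg, SWord.deg] at h1 h2
    omega
  -- equal lengths, as the degrees agree, and equal words without `u`
  have hcount : Q.1.word.letters.count u = P.1.word.letters.count u := by
    have hc : ∀ L : List (Fin n),
        L.length = L.count u + (L.filter fun v => decide (v ≠ u)).length := by
      intro L
      rw [← List.countP_eq_length_filter,
        List.length_eq_countP_add_countP (fun v => v == u) (l := L), List.count]
      congr 2
      funext v
      simp
    have h1 := hc Q.1.word.letters
    have h2 := hc P.1.word.letters
    rw [hw] at h1
    omega
  by_cases hru : Q.1.word.Repeated u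
  · rw [boundaryComp_repeated h hd Q u hru, boundaryComp_repeated h hd P u]
    unfold SWord.Repeated at hru ⊢
    omega
  have hru' : ¬ P.1.word.Repeated u := by
    unfold SWord.Repeated at hru ⊢
    omega
  obtain ⟨N, x, hx⟩ : ∃ N x, Q.1.word.letters = (List.range N).map x := ⟨_, _, exists_fn _⟩
  obtain ⟨N', y, hy⟩ : ∃ N x, P.1.word.letters = (List.range N).map x := ⟨_, _, exists_fn _⟩
  obtain rfl : N = N' := by rw [← length_letters hx, ← length_letters hy, hlen]
  obtain ⟨i, hi, hxi⟩ := exists_letter hx u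
  obtain ⟨j, hj, hyj⟩ := exists_letter hy u
  have hni : ¬ Rep N x i := fun hr => hru (hxi ▸ (repeated_iff hx hi).2 hr)
  have hnj : ¬ Rep N y j := fun hr => hru' (hyj ▸ (repeated_iff hy hj).2 hr)
  have hxy : ∀ k, k < N - 1 → (x ∘ skip i) k = (y ∘ skip j) k := by
    rw [hx, hy, filter_map_range hi hxi, filter_map_range hj hyj] at hw
    · exact fun k hk => List.map_inj_left.1 hw k (List.mem_range.2 hk)
    · exact fun z z1 z2 => by_contra fun hne => hnj ⟨z, hne, z1, z2.trans hyj.symm⟩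
    · exact fun z z1 z2 => by_contra fun hne => hni ⟨z, hne, z1, z2.trans hxi.symm⟩
  have hiff : ∀ k k', k < N - 1 → k' < N - 1 →
      ((x ∘ skip i) k = (x ∘ skip i) k' ↔ (y ∘ skip j) k = (y ∘ skip j) k') := by
    intro k k' hk hk'
    rw [hxy k hk, hxy k' hk']
  rw [boundaryComp_eq_sum_skip h hd Q u hx hi hxi hni,
    boundaryComp_eq_sum_skip h hd P u hy hj hyj hnj]
  refine Finset.sum_congr ?_ fun k hk => ?_
  · ext k
    simp only [Finset.mem_filter, Finset.mem_range]
    exact and_congr_right fun hk => rep_congr hiff hk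
  · simp only [Finset.mem_filter, Finset.mem_range] at hk
    rw [fnum_congr hiff hk.1]
    congr 1
    have hrx : Rep N x (skip i k) := by
      obtain ⟨z, z1, z2, z3, z4⟩ := (rep_skip hi).1 ((rep_congr hiff hk.1).2 hk.2)
      exact ⟨z, z2, z3, z4⟩
    have hry : Rep N y (skip j k) := by
      obtain ⟨z, z1, z2, z3, z4⟩ := (rep_skip hj).1 hk.2
      exact ⟨z, z2, z3, z4⟩
    obtain ⟨R, hR1, hR2⟩ := exists_face Q hx (skip_lt hk.1) hrx
    obtain ⟨R', hR1', hR2'⟩ := exists_face P hy (skip_lt hk.1) hry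
    rw [plug_eq _ _ R _ hR1 hR2, plug_eq _ _ R' _ hR1' hR2']
    refine comp_gm_move _ _ R u R' (hR1.trans (ht.trans hR1'.symm)) ?_
    rw [hR2, hR2', filter_face u hi hxi hni hk.1, filter_face u hj hyj hnj hk.1]
    exact List.map_congr_left fun z hz => hxy _ (skip_lt (List.mem_range.1 hz))

end MQuilt

/-! ### The boundary operator of `mQuilt` -/

namespace MQuilt

open GradedOperad

/-- The Leibniz rule is compatible with the relations of `mQuilt`. -/
theorem preBoundary_eq {n : ℕ} {d : ℤ} {x y : Pre n d} (h : Rel x y) :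
    preBoundary x = preBoundary y := by
  induction h with
  | refl x => rfl
  | symm _ ih => exact ih.symm
  | trans _ _ ih₁ ih₂ => exact ih₁.trans ih₂
  | neg _ ih => simp only [preBoundary, ih]
  | add _ _ ih₁ ih₂ => simp only [preBoundary, ih₁, ih₂]
  | act σ _ ih => simp only [preBoundary, ih]
  | comp h hd a hx hy ih₁ ih₂ =>
    have e₁ := mk_eq hx
    have e₂ := mk_eq hy
    simp only [preBoundary, ih₁, ih₂, cls, e₁, e₂]
  | add_assoc x y z => simp only [preBoundary, _root_.add_assoc]
  | add_comm x y => simp only [preBoundary, _root_.add_comm]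
  | zero_add x => simp only [preBoundary, _root_.zero_add]
  | neg_add x => simp only [preBoundary, neg_add_cancel]
  | act_add σ x y => simp only [preBoundary, map_add]
  | comp_add_left h hd a x x' y => exact leib_add_left h hd a (cls x) (cls x') _ _ _ _
  | comp_add_right h hd a x y y' => exact leib_add_right h hd a _ _ (cls y) (cls y') _ _
  | act_one x => exact mQuilt.act_one _
  | act_mul σ τ x => exact mQuilt.act_mul σ τ _
  | one_comp h hd y => exact leib_one_left h hd (cls y) _
  | comp_one h hd a x => exact leib_one_right h hd a (cls x) _
  | comp_assoc h₁ h₂ h₃ h₄ d₁ d₂ d₃ d₄ a b x y z =>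
    exact leib_assoc h₁ h₂ h₃ h₄ d₁ d₂ d₃ d₄ a b (cls x) _ (cls y) _ (cls z) _
  | comp_comm h₁ h₂ h₃ h₄ d₁ d₂ d₃ d₄ a b hab b' hb a' ha x y z =>
    rw [preBoundary_signed]
    exact leib_comm h₁ h₂ h₃ h₄ d₁ d₂ d₃ d₄ a b hab b' hb a' ha (cls x) _ (cls y) _ (cls z) _
  | act_comp h hd a σ τ π hπ₁ hπ₂ x y =>
    exact leib_act h hd a σ τ π hπ₁ hπ₂ (cls x) _ (cls y) _
  | gen_add x y => simp only [preBoundary, map_add]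
  | gen_one => rw [preBoundary_ofQuilt, FunWord.boundary_quiltOne, map_zero, preBoundary]
  | gen_act σ Q =>
    rw [preBoundary_ofQuilt, preBoundary, preBoundary_ofQuilt, FunWord.boundary_quiltAct,
      ι_linearCombination_act]
  | gen_comp h hd a P Q =>
    rw [preBoundary, preBoundary, preBoundary_ofQuilt, preBoundary_ofQuilt,
      FunWord.bd_partialComp hd (by omega) (by omega), map_add, map_zsmul,
      ι_linearCombination_left, ι_linearCombination_right]
    rfl
  | m_assoc =>
    simp only [preBoundary, leib, preBoundary_ofQuilt, FunWord.boundary_quiltTwo, map_zero,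
      AddMonoidHom.zero_apply, smul_zero, add_zero]
  | m_binary h hd Q u hu => rw [preBoundary_comp_m, boundaryComp_binary h hd Q u hu, preBoundary]
  | m_repeated h hd Q u hu =>
    rw [preBoundary_comp_m, boundaryComp_repeated h hd Q u hu, preBoundary]
  | m_between h hd Q u v hu =>
    rw [preBoundary_comp_m, boundaryComp_between h hd Q u v hu, preBoundary]
  | m_move h hd P Q u ht hw =>
    rw [preBoundary_comp_m, preBoundary_comp_m, boundaryComp_move h hd Q u P ht hw]

/-- The extension of the boundary operator of `Quilt` to `mQuilt`. -/
noncomputable def boundary : mQuilt.DegMap := fun n d =>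
  AddMonoidHom.mk' (Quotient.lift (s := setoid n d) preBoundary fun _ _ h => preBoundary_eq h)
    (by rintro ⟨x⟩ ⟨y⟩; exact (rfl : preBoundary (Pre.add x y) = _))

theorem exists_cls {n : ℕ} {d : ℤ} (x : mQuilt.obj n d) : ∃ y, cls y = x := Quotient.exists_rep x

theorem isBoundary_boundary : IsBoundary boundary where
  map_act σ x := by
    obtain ⟨x, rfl⟩ := exists_cls x
    exact (rfl : preBoundary (Pre.act σ x) = _)
  leibniz := by
    intro m n l h p q r hd h₁ h₂ a x y
    obtain ⟨x, rfl⟩ := exists_cls x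
    obtain ⟨y, rfl⟩ := exists_cls y
    exact (rfl : preBoundary (Pre.comp h hd a x y) = _)
  map_quilt Q := preBoundary_ofQuilt Q
  map_m := rfl

theorem IsBoundary.map_ι {D : mQuilt.DegMap} (hD : IsBoundary D) {n : ℕ} {d : ℤ}
    (x : Quilt.Mod n d) : D n d (ι x) = ι (FunWord.bd x) := by
  induction x using Finsupp.induction_linear with
  | zero => simp
  | add x y hx hy => rw [map_add, map_add, map_add, map_add, hx, hy]
  | single Q c =>
    have e : Finsupp.single Q c = c • Finsupp.single Q (1 : ℤ) := by simp
    rw [e, map_zsmul, map_zsmul, map_zsmul, map_zsmul, hD.map_quilt, FunWord.bd_single]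

/-- A property of the elements of `mQuilt` holds if it holds for the generators and is preserved by
the operations. -/
theorem obj_induction {C : ∀ {n : ℕ} {d : ℤ}, mQuilt.obj n d → Prop}
    (hι : ∀ {n : ℕ} {d : ℤ} (x : Quilt.Mod n d), C (ι x)) (hm : C gm)
    (hadd : ∀ {n : ℕ} {d : ℤ} (x y : mQuilt.obj n d), C x → C y → C (x + y))
    (hneg : ∀ {n : ℕ} {d : ℤ} (x : mQuilt.obj n d), C x → C (-x))
    (hact : ∀ {n : ℕ} {d : ℤ} (σ : Equiv.Perm (Fin n)) (x : mQuilt.obj n d), C x →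
      C (mQuilt.act σ x))
    (hcomp : ∀ {m n l : ℕ} (h : l + 1 = m + n) {p q r : ℤ} (hd : r = p + q) (a : Fin m)
      (x : mQuilt.obj m p) (y : mQuilt.obj n q), C x → C y → C (mQuilt.comp h hd a x y))
    {n : ℕ} {d : ℤ} (x : mQuilt.obj n d) : C x := by
  obtain ⟨x, rfl⟩ := exists_cls x
  induction x with
  | gen x => exact hι x
  | m => exact hm
  | one =>
    have := hι (Finsupp.single quiltOne 1)
    rwa [ι_quiltOne] at this
  | @zero n d =>
    have := hι (0 : Quilt.Mod n d)
    rwa [map_zero] at this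
  | neg x ih => exact hneg _ ih
  | add x y ih₁ ih₂ => exact hadd _ _ ih₁ ih₂
  | act σ x ih => exact hact σ _ ih
  | comp h hd a x y ih₁ ih₂ => exact hcomp h hd a _ _ ih₁ ih₂

theorem IsBoundary.unique {D D' : mQuilt.DegMap} (hD : IsBoundary D) (hD' : IsBoundary D') :
    D = D' := by
  funext n d
  refine AddMonoidHom.ext fun x => ?_
  induction x using obj_induction with
  | hι x => rw [hD.map_ι, hD'.map_ι]
  | hm => rw [hD.map_m, hD'.map_m]
  | hadd x y hx hy => rw [map_add, map_add, hx, hy]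
  | hneg x hx => rw [map_neg, map_neg, hx]
  | hact σ x hx => rw [hD.map_act, hD'.map_act, hx]
  | hcomp h hd a x y hx hy =>
    rw [hD.leibniz h hd (by omega) (by omega), hD'.leibniz h hd (by omega) (by omega), hx, hy]

theorem IsBoundary.sq_zero {D : mQuilt.DegMap} (hD : IsBoundary D) {n : ℕ} {d : ℤ}
    (x : mQuilt.obj n d) : D n (d - 1) (D n d x) = 0 := by
  induction x using obj_induction with
  | hι x =>
    rw [hD.map_ι, hD.map_ι]
    induction x using Finsupp.induction_linear with
    | zero => simp
    | add x y hx hy => rw [map_add, map_add, map_add, hx, hy, add_zero]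
    | single Q c =>
      have e : Finsupp.single Q c = c • Finsupp.single Q (1 : ℤ) := by simp
      rw [e, map_zsmul, map_zsmul, FunWord.bd_single, FunWord.bd_boundary, smul_zero, map_zero]
  | hm => rw [hD.map_m, map_zero]
  | hadd x y hx hy => rw [map_add, map_add, hx, hy, add_zero]
  | hneg x hx => rw [map_neg, map_neg, hx, neg_zero]
  | hact σ x hx => rw [hD.map_act, hD.map_act, hx, map_zero]
  | @hcomp m n l h p q r hd a x y hx hy =>
    rw [hD.leibniz h hd (show r - 1 = (p - 1) + q by omega) (show r - 1 = p + (q - 1) by omega),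
      map_add, map_zsmul,
      hD.leibniz h _ (show r - 1 - 1 = (p - 1 - 1) + q by omega)
        (show r - 1 - 1 = (p - 1) + (q - 1) by omega),
      hD.leibniz h _ (show r - 1 - 1 = (p - 1) + (q - 1) by omega)
        (show r - 1 - 1 = p + (q - 1 - 1) by omega), hx, hy, map_zero, map_zero,
      AddMonoidHom.zero_apply, negOnePow_eq_neg (a := p - 1) (b := p) ⟨-1, by ring⟩]
    simp

end MQuilt

/-! ### The adjoint action of an element of arity one -/

namespace GradedOperad

variable {O : GradedOperad} (A : O.obj 1 (-1))

theorem ad_apply {n : ℕ} {d : ℤ} (x : O.obj n d) :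
    ad A n d x = O.comp (show n + 1 = 1 + n by omega) (show d - 1 = -1 + d by omega) 0 A x -
      (d.negOnePow : ℤ) • ∑ a : Fin n, O.comp (show n + 1 = n + 1 from rfl)
        (show d - 1 = d + -1 by omega) a x A := by
  unfold ad
  rw [AddMonoidHom.sub_apply, AddMonoidHom.coe_smul, Pi.smul_apply, AddMonoidHom.finsetSum_apply]
  rfl

theorem blockIncl_one_left {n : ℕ} (h : n + 1 = 1 + n) (j : Fin n) : blockIncl h 0 j = j :=
  Fin.ext (by simp [blockIncl])

theorem blockIncl_one_right {n : ℕ} (h : n + 1 = n + 1) (a : Fin n) : blockIncl h a 0 = a :=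
  Fin.ext (by simp [blockIncl])

theorem blockProj_one_right {n : ℕ} (h : n + 1 = n + 1) (a k : Fin n) : blockProj h a k = k := by
  unfold blockProj
  split_ifs with h1 h2
  · rfl
  · exact Fin.ext (by omega)
  · exact Fin.ext (by simp)

/-- The adjoint action is equivariant: a permutation permutes the summands. -/
theorem ad_act {n : ℕ} {d : ℤ} (σ : Equiv.Perm (Fin n)) (x : O.obj n d) :
    ad A n d (O.act σ x) = O.act σ (ad A n d x) := by
  rw [ad_apply, ad_apply, map_sub, map_zsmul, map_sum]
  congr 1
  · conv_lhs => rw [← O.act_one A]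
    exact O.act_comp _ _ 0 1 σ σ (fun j => by rw [blockIncl_one_left, Equiv.Perm.one_apply,
      blockIncl_one_left]) (fun k => Subsingleton.elim _ _) A x
  · congr 1
    rw [← Equiv.sum_comp σ fun a => O.act σ (O.comp (show n + 1 = n + 1 from rfl)
        (show d - 1 = d + -1 by omega) a x A)]
    refine Finset.sum_congr rfl fun a _ => ?_
    conv_lhs => rw [← O.act_one A]
    exact O.act_comp _ _ a σ 1 σ (fun j => by
      rw [Subsingleton.elim j 0, blockIncl_one_right, Equiv.Perm.one_apply, blockIncl_one_right])
      (fun k => by rw [blockProj_one_right, blockProj_one_right]) x A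

/-- The composites of `x ∘ₐ y` with `A`: either `A` is inserted in `y`, or in another vertex
of `x`. -/
theorem sum_comp_comp {m n l : ℕ} (h : l + 1 = m + n) {p q r : ℤ} (hd : r = p + q) (a : Fin m)
    (x : O.obj m p) (y : O.obj n q) :
    ∑ k : Fin l, O.comp (show l + 1 = l + 1 from rfl) (show r - 1 = r + -1 by omega) k
        (O.comp h hd a x y) A =
      ∑ b : Fin n, O.comp h (show r - 1 = p + (q - 1) by omega) a x
        (O.comp (show n + 1 = n + 1 from rfl) (show q - 1 = q + -1 by omega) b y A) +
      ∑ c ∈ Finset.univ.erase a, (q.negOnePow : ℤ) •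
        O.comp h (show r - 1 = (p - 1) + q by omega) a
          (O.comp (show m + 1 = m + 1 from rfl) (show p - 1 = p + -1 by omega) c x A) y := by
  classical
  rw [← Finset.sum_filter_add_sum_filter_not Finset.univ fun k => blockProj h a k = a]
  congr 1
  · symm
    refine Finset.sum_bij (fun b _ => blockIncl h a b) ?_ ?_ ?_ ?_
    · intro b _
      simpa using FunWord.blockProj_blockIncl h a b
    · intro b _ b' _ e
      exact FunWord.blockIncl_injective h a e
    · intro k hk
      obtain ⟨j, hj⟩ := (FunWord.blockProj_eq_iff h a k).1 (by simpa using hk)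
      exact ⟨j, Finset.mem_univ _, hj⟩
    · intro b _
      exact (O.comp_assoc h rfl rfl h hd _ _ _ a b x y A).symm
  · refine Finset.sum_bij (fun k _ => blockProj h a k) ?_ ?_ ?_ ?_
    · intro k hk
      simpa using hk
    · intro k hk k' hk' e
      simp only [Finset.mem_filter, Finset.mem_univ, true_and] at hk hk'
      rw [Fin.ext_iff] at hk hk' e
      unfold blockProj at hk hk' e
      refine Fin.ext ?_
      split_ifs at hk hk' e <;> first
        | exact absurd rfl hk
        | exact absurd rfl hk'
        | simp only at e; omega
    · intro c hc
      have hc : c ≠ a := by simpa using hc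
      rcases lt_or_gt_of_ne hc with hlt | hlt
      · have e : blockProj h a ⟨c, by omega⟩ = c := by
          unfold blockProj
          rw [dif_pos (by exact hlt)]
        exact ⟨⟨c, by omega⟩, by simp [e, hc], e⟩
      · have hlt' : (a : ℕ) < c := hlt
        have e : blockProj h a ⟨c + n - 1, by omega⟩ = c := by
          unfold blockProj
          rw [dif_neg (by simp only; omega), dif_neg (by simp only; omega)]
          exact Fin.ext (by simp only; omega)
        exact ⟨⟨c + n - 1, by omega⟩, by simp [e, hc], e⟩
    · intro k hk
      simp only [Finset.mem_filter, Finset.mem_univ, true_and] at hk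
      unfold blockProj at hk ⊢
      split_ifs at hk ⊢ with h1 h2
      · rw [O.comp_comm rfl h h rfl _ (show r - 1 = (p - 1) + q by omega) hd
          (show r - 1 = r + -1 by omega) ⟨k, by omega⟩ a (by exact h1) a rfl k rfl x A y, smul_smul,
          negOnePow_mul, negOnePow_congr (b := 0) ⟨0, by ring⟩]
        simp
      · exact absurd rfl hk
      · have hne : (a : ℕ) < k + 1 - n := by
          have : (k : ℕ) + 1 - n ≠ a := fun e => hk (Fin.ext e)
          omega
        rw [O.comp_comm h rfl rfl h hd (show r - 1 = r + -1 by omega) (show p - 1 = p + -1 by omega)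
          (show r - 1 = (p - 1) + q by omega) a ⟨k + 1 - n, by omega⟩ (by exact hne) k
          (by simp only; omega) a rfl x y A, negOnePow_congr (a := q * -1) (b := q) ⟨-q, by ring⟩]

/-- The adjoint action of an element of degree `-1` is a derivation: inserting `A` at the vertex `a`
of `x` and composing with `y` cancels against `A` composed with `y`. -/
theorem ad_comp {m n l : ℕ} (h : l + 1 = m + n) {p q r : ℤ} (hd : r = p + q)
    (h₁ : r - 1 = (p - 1) + q) (h₂ : r - 1 = p + (q - 1)) (a : Fin m)
    (x : O.obj m p) (y : O.obj n q) :
    ad A l r (O.comp h hd a x y) = O.comp h h₁ a (ad A m p x) y +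
      (p.negOnePow : ℤ) • O.comp h h₂ a x (ad A n q y) := by
  have e1 : O.comp (show l + 1 = 1 + l by omega) (show r - 1 = -1 + r by omega) 0 A
      (O.comp h hd a x y) = O.comp h h₁ a
        (O.comp (show m + 1 = 1 + m by omega) (show p - 1 = -1 + p by omega) 0 A x) y := by
    rw [← O.comp_assoc (show m + 1 = 1 + m by omega) h h (show l + 1 = 1 + l by omega)
      (show p - 1 = -1 + p by omega) h₁ hd (show r - 1 = -1 + r by omega), blockIncl_one_left]
  have e2 : O.comp h h₁ a (O.comp (show m + 1 = m + 1 from rfl) (show p - 1 = p + -1 by omega) a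
      x A) y = O.comp h h₂ a x
        (O.comp (show n + 1 = 1 + n by omega) (show q - 1 = -1 + q by omega) 0 A y) := by
    have := O.comp_assoc (show m + 1 = m + 1 from rfl) h (show n + 1 = 1 + n by omega) h
      (show p - 1 = p + -1 by omega) h₁ (show q - 1 = -1 + q by omega) h₂ a 0 x A y
    rwa [blockIncl_one_right] at this
  rw [ad_apply, ad_apply, ad_apply, sum_comp_comp A h hd, map_sub, map_sub, map_zsmul, map_zsmul,
    map_sum, map_sum, AddMonoidHom.sub_apply, AddMonoidHom.coe_smul, Pi.smul_apply,
    AddMonoidHom.finsetSum_apply,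
    ← Finset.add_sum_erase Finset.univ
      (fun c => (O.comp h h₁ a) (O.comp (show m + 1 = m + 1 from rfl)
        (show p - 1 = p + -1 by omega) c x A) y) (Finset.mem_univ a), e1, e2]
  simp only [smul_add, smul_sub, smul_smul, ← Finset.smul_sum, negOnePow_mul]
  rw [negOnePow_congr (a := r + q) (b := p) ⟨q, by omega⟩, negOnePow_congr (a := r) (b := p + q)
    ⟨0, by omega⟩]
  abel

variable {A}

/-- A derivation annihilating `A` anticommutes with the adjoint action of `A`. -/
theorem IsDerivation.anticomm_ad {D : O.DegMap} (hD : IsDerivation D) (hA : D 1 (-1) A = 0)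
    {n : ℕ} {d : ℤ} (x : O.obj n d) :
    D n (d - 1) (ad A n d x) + ad A n (d - 1) (D n d x) = 0 := by
  rw [ad_apply, ad_apply, map_sub, map_zsmul, map_sum,
    hD.leibniz _ _ (show d - 1 - 1 = (-1 - 1) + d by omega)
      (show d - 1 - 1 = -1 + (d - 1) by omega), hA, map_zero, AddMonoidHom.zero_apply]
  simp only [hD.leibniz _ _ (show d - 1 - 1 = (d - 1) + -1 by omega)
    (show d - 1 - 1 = d + (-1 - 1) by omega), hA, map_zero, smul_zero, add_zero]
  rw [negOnePow_eq_neg (a := d - 1) (b := d) ⟨-1, by ring⟩]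
  simp

/-- The adjoint action of `A` has square zero if `A ∘ A = 0`. -/
theorem ad_ad (hA : O.comp (show 1 + 1 = 1 + 1 from rfl) (show (-1 - 1 : ℤ) = -1 + -1 from rfl) 0
    A A = 0) {n : ℕ} {d : ℤ} (x : O.obj n d) : ad A n (d - 1) (ad A n d x) = 0 := by
  have hAA : ad A 1 (-1) A = 0 := by
    rw [ad_apply, Fin.sum_univ_one, hA]; simp
  rw [ad_apply A x, map_sub, map_zsmul, map_sum,
    ad_comp A _ _ (show d - 1 - 1 = (-1 - 1) + d by omega) (show d - 1 - 1 = -1 + (d - 1) by omega),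
    hAA, map_zero, AddMonoidHom.zero_apply]
  simp only [ad_comp A _ _ (show d - 1 - 1 = (d - 1) + -1 by omega)
    (show d - 1 - 1 = d + (-1 - 1) by omega), hAA, map_zero, smul_zero, add_zero, zero_add]
  have e1 : O.comp (show n + 1 = 1 + n by omega) (show d - 1 - 1 = -1 + (d - 1) by omega) 0 A
      (O.comp (show n + 1 = 1 + n by omega) (show d - 1 = -1 + d by omega) 0 A x) = 0 := by
    have := O.comp_assoc (show 1 + 1 = 1 + 1 from rfl) (show n + 1 = 1 + n by omega)
      (show n + 1 = 1 + n by omega) (show n + 1 = 1 + n by omega)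
      (show (-1 - 1 : ℤ) = -1 + -1 from rfl) (show d - 1 - 1 = (-1 - 1) + d by omega)
      (show d - 1 = -1 + d by omega) (show d - 1 - 1 = -1 + (d - 1) by omega) 0 0 A A x
    rw [← this, hA, map_zero, AddMonoidHom.zero_apply]
  have e2 : ∀ a : Fin n, O.comp (show n + 1 = n + 1 from rfl)
      (show d - 1 - 1 = (d - 1) + -1 by omega) a
        (O.comp (show n + 1 = 1 + n by omega) (show d - 1 = -1 + d by omega) 0 A x) A =
      O.comp (show n + 1 = 1 + n by omega) (show d - 1 - 1 = -1 + (d - 1) by omega) 0 A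
        (O.comp (show n + 1 = n + 1 from rfl) (show d - 1 = d + -1 by omega) a x A) := by
    intro a
    rw [← O.comp_assoc (show n + 1 = 1 + n by omega) (show n + 1 = n + 1 from rfl)
      (show n + 1 = n + 1 from rfl) (show n + 1 = 1 + n by omega)
      (show d - 1 = -1 + d by omega) (show d - 1 - 1 = (d - 1) + -1 by omega), blockIncl_one_left]
  -- inserting `A` in two different vertices cancels by the Koszul sign, inserting `A` twice in the
  -- same vertex vanishes as `A ∘ A = 0`
  have e3 : ∑ a : Fin n, ∑ c : Fin n, O.comp (show n + 1 = n + 1 from rfl)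
      (show d - 1 - 1 = (d - 1) + -1 by omega) a
        (O.comp (show n + 1 = n + 1 from rfl) (show d - 1 = d + -1 by omega) c x A) A = 0 := by
    rw [← Finset.sum_product']
    have hdiag : ∀ a : Fin n, O.comp (show n + 1 = n + 1 from rfl)
      (show d - 1 - 1 = (d - 1) + -1 by omega) a
        (O.comp (show n + 1 = n + 1 from rfl) (show d - 1 = d + -1 by omega) a x A) A = 0 := by
      intro a
      have := O.comp_assoc (show n + 1 = n + 1 from rfl) (show n + 1 = n + 1 from rfl)
        (show 1 + 1 = 1 + 1 from rfl) (show n + 1 = n + 1 from rfl)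
        (show d - 1 = d + -1 by omega) (show d - 1 - 1 = (d - 1) + -1 by omega)
        (show (-1 - 1 : ℤ) = -1 + -1 from rfl) (show d - 1 - 1 = d + (-1 - 1) by omega) a 0 x A A
      rw [blockIncl_one_right] at this
      rw [this, hA, map_zero]
    have hoff : ∀ a c : Fin n, a < c → O.comp (show n + 1 = n + 1 from rfl)
      (show d - 1 - 1 = (d - 1) + -1 by omega) c
        (O.comp (show n + 1 = n + 1 from rfl) (show d - 1 = d + -1 by omega) a x A) A +
      O.comp (show n + 1 = n + 1 from rfl) (show d - 1 - 1 = (d - 1) + -1 by omega) a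
        (O.comp (show n + 1 = n + 1 from rfl) (show d - 1 = d + -1 by omega) c x A) A = 0 := by
      intro a c hac
      rw [O.comp_comm (show n + 1 = n + 1 from rfl) (show n + 1 = n + 1 from rfl)
        (show n + 1 = n + 1 from rfl) (show n + 1 = n + 1 from rfl)
        (show d - 1 = d + -1 by omega) (show d - 1 - 1 = (d - 1) + -1 by omega)
        (show d - 1 = d + -1 by omega) (show d - 1 - 1 = (d - 1) + -1 by omega) a c hac c rfl a rfl]
      simp
    refine Finset.sum_involution (fun c _ => (c.2, c.1)) ?_ ?_ ?_ ?_
    · rintro ⟨a, c⟩ -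
      rcases lt_trichotomy a c with hac | rfl | hac
      · rw [_root_.add_comm]; exact hoff a c hac
      · simp only [hdiag, add_zero]
      · exact hoff c a hac
    · rintro ⟨a, c⟩ - hne e
      simp only [Prod.mk.injEq] at e
      obtain ⟨rfl, -⟩ := e
      exact hne (hdiag c)
    · rintro ⟨a, c⟩ -
      simp
    · rintro ⟨a, c⟩ -
      rfl
  simp only [ad_apply A x, map_sub, map_zsmul, map_sum, AddMonoidHom.sub_apply,
    AddMonoidHom.coe_smul, Pi.smul_apply, AddMonoidHom.finsetSum_apply, e1, e2,
    Finset.sum_sub_distrib, ← Finset.smul_sum, e3]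
  simp

/-- If `D` is a derivation with square zero annihilating `A`, and `A ∘ A = 0`, then `D + ad A` is a
differential. -/
theorem IsDerivation.isDifferential_add_ad {D : O.DegMap} (hD : IsDerivation D)
    (hsq : ∀ {n : ℕ} {d : ℤ} (x : O.obj n d), D n (d - 1) (D n d x) = 0) (hDA : D 1 (-1) A = 0)
    (hA : O.comp (show 1 + 1 = 1 + 1 from rfl) (show (-1 - 1 : ℤ) = -1 + -1 from rfl) 0 A A = 0) :
    IsDifferential (D + ad A) where
  map_act := by
    intro n d σ x
    simp only [Pi.add_apply, AddMonoidHom.add_apply, hD.map_act, ad_act, map_add]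
  leibniz := by
    intro m n l h p q r hd h₁ h₂ a x y
    simp only [Pi.add_apply, AddMonoidHom.add_apply, hD.leibniz h hd h₁ h₂, ad_comp A h hd h₁ h₂,
      map_add, smul_add]
    abel
  sq_zero := by
    intro n d x
    simp only [Pi.add_apply, AddMonoidHom.add_apply, map_add, hsq, ad_ad hA, zero_add, add_zero]
    rw [_root_.add_comm]
    exact hD.anticomm_ad hDA x

end GradedOperad

/-! ### The element `Δ` -/

namespace FunWord

open Relation

/-- The word of the quilt `1 → 2` as a function, with letters numbered from `0`. -/
def wordTwo (k : ℕ) : Fin 2 := if k = 0 then 0 else 1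

theorem letters_quiltTwo : MQuilt.quiltTwo.1.word.letters = (List.range 2).map wordTwo := rfl

theorem not_caes_wordTwo (k : ℕ) : ¬ Caes 2 wordTwo k := by
  rintro ⟨y, h1, h2, h3⟩
  obtain rfl : y = 1 := by omega
  obtain rfl : k = 0 := by omega
  exact absurd h3 (by decide)

theorem inv_wordTwo (H : ℕ → ℕ) : inv 2 2 wordTwo wordTwo H = 0 :=
  Finset.sum_eq_zero fun _ _ => if_neg (not_caes_wordTwo _)

/-- The only path for two words of length two. -/
def pathTwo (a : Fin 2) (k : ℕ) : ℕ := if k ≤ a then 0 else 1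

theorem isPath_two_iff (a : Fin 2) (H : ℕ → ℕ) : IsPath a 2 2 wordTwo H ↔ H = pathTwo a := by
  constructor
  · intro hH
    funext k
    rcases Nat.lt_or_ge k 2 with hk | hk
    · have h0 := hH.zero
      have h2 := hH.last 2 le_rfl
      fin_cases a
      · have := hH.const 1 (by omega) (by decide)
        interval_cases k
        · simpa [pathTwo] using h0
        · simp only [pathTwo, Nat.reduceAdd] at this ⊢
          rw [← this, h2]; simp
      · have := hH.const 0 (by omega) (by decide)
        interval_cases k
        · simpa [pathTwo] using h0
        · simp only [pathTwo, Nat.reduceAdd] at this ⊢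
          rw [this, h0]; simp
    · rw [hH.last k hk]
      have := a.2
      rw [pathTwo, if_neg (by omega)]
  · rintro rfl
    refine ⟨by simp [pathTwo], fun x y hxy => ?_, fun x hx hne => ?_, fun x hx => ?_⟩
    · unfold pathTwo; split_ifs <;> omega
    · fin_cases a
      · interval_cases x
        · exact absurd rfl hne
        · rfl
      · interval_cases x
        · rfl
        · exact absurd rfl hne
    · have := a.2
      rw [pathTwo, if_neg (by omega)]

theorem map_emb_pathTwo (a : Fin 2) :
    (List.range (2 + 2 - 1)).map (emb (show 3 + 1 = 2 + 2 from rfl) a MQuilt.quiltTwo.1.word ∘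
      pword a 2 wordTwo wordTwo (pathTwo a)) = [0, 1, 2] := by
  have hH := (isPath_two_iff a _).2 rfl
  have e : ∀ x y, IsPt 2 (pathTwo a) x y →
      pword a 2 wordTwo wordTwo (pathTwo a) (x + y) = letter a wordTwo wordTwo x y :=
    fun x y hpt => hH.pword_eq wordTwo hpt
  obtain rfl | rfl : a = 0 ∨ a = 1 := by omega
  · have e0 := e 0 0 ⟨by omega, by decide, by decide⟩
    have e1 := e 0 1 ⟨by omega, by decide, by decide⟩
    have e2 := e 1 1 ⟨by omega, by decide, by decide⟩
    rw [letter_of_eq (show wordTwo 0 = 0 from rfl)] at e0 e1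
    rw [letter_of_ne (show wordTwo 1 ≠ 0 by decide)] at e2
    simp only [List.range, List.range.loop, List.map_cons, List.map_nil, Function.comp]
    rw [e0, e1, e2]
    rfl
  · have e0 := e 0 0 ⟨by omega, by decide, by decide⟩
    have e1 := e 1 0 ⟨by omega, by decide, by decide⟩
    have e2 := e 1 1 ⟨by omega, by decide, by decide⟩
    rw [letter_of_ne (show wordTwo 0 ≠ 1 by decide)] at e0
    rw [letter_of_eq (show wordTwo 1 = 1 from rfl)] at e1 e2
    simp only [List.range, List.range.loop, List.map_cons, List.map_nil, Function.comp]
    rw [e0, e1, e2]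
    rfl

/-- `U` is an extension of `1 → 2` by itself at `a`. -/
def IsExtTwo (a : Fin 2) (U : PlanarTree 3) : Prop :=
  PlanarTree.IsExt (show 3 + 1 = 2 + 2 from rfl) a PlanarTree.two PlanarTree.two U

open Classical in
theorem partialComp_two (a : Fin 2) :
    Quilt.partialComp (show 3 + 1 = 2 + 2 from rfl) (show (0 : ℤ) = 0 + 0 from rfl) a
      MQuilt.quiltTwo MQuilt.quiltTwo =
        ∑ U : PlanarTree 3 with IsExtTwo a U, quiltOf 0 U [0, 1, 2] := by
  rw [partialComp_eq _ _ _ letters_quiltTwo letters_quiltTwo]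
  refine Finset.sum_congr rfl fun U _ => ?_
  have hp : paths a 2 2 wordTwo = {pathTwo a} := by
    ext H
    rw [mem_paths, isPath_two_iff, Finset.mem_singleton]
  rw [pathSum, hp, Finset.sum_singleton, inv_wordTwo, pow_zero, one_smul, List.map_map,
    map_emb_pathTwo]

theorem exists_quilt_of_isExtTwo {a : Fin 2} {U : PlanarTree 3} (hU : IsExtTwo a U) :
    ∃ R : Quilt.OfDeg 3 0, R.1.tree = U ∧ R.1.word.letters = [0, 1, 2] := by
  have hH := (isPath_two_iff a _).2 rfl
  obtain ⟨X, hX⟩ := exists_sword (h := show 3 + 1 = 2 + 2 from rfl) letters_quiltTwo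
    letters_quiltTwo hH
  obtain ⟨R, rfl, hR⟩ := exists_quilt_of_isExt MQuilt.quiltTwo.1 MQuilt.quiltTwo.1
    (isExt_of_path letters_quiltTwo letters_quiltTwo hH hX) hU
  rw [map_emb_pathTwo] at hX
  exact ⟨⟨R, by rw [Quilt.deg, SWord.deg, hX]; rfl⟩, hR, hX⟩

/-- The trees with vertices `0, 1, 2` in which `1` is a child of `0` and `2` is a leaf. -/
theorem isExtTwo_zero_iff (U : PlanarTree 3) :
    IsExtTwo 0 U ↔ U.edge 0 1 ∧ ∀ w, ¬ U.edge 2 w := by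
  have hB : ∀ k : Fin 3, blockProj (show 3 + 1 = 2 + 2 from rfl) (0 : Fin 2) k =
    if k = 2 then 1 else 0 := by decide
  have hI : ∀ j : Fin 2, blockIncl (show 3 + 1 = 2 + 2 from rfl) (0 : Fin 2) j =
    if j = 0 then 0 else 1 := by decide
  unfold IsExtTwo PlanarTree.IsExt PlanarTree.two
  simp only [hB, hI]
  constructor
  · rintro ⟨h1, -, h3, -⟩
    refine ⟨by simpa using h1 0 1, fun w hw => ?_⟩
    simpa using h3 2 w hw
  · rintro ⟨h1, h2⟩
    have h10 : ¬ U.edge 1 0 := fun h => absurd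
      (U.antisymm 0 1 (ReflTransGen.single h1) (ReflTransGen.single h)) (by decide)
    have hl := fun u v => U.comparable u v
    refine ⟨?_, ?_, ?_, fun _ _ h => h.elim⟩
    · intro r s
      fin_cases r <;> fin_cases s <;> simp [h1, h10, U.edge_irrefl]
    · have hl : ¬ U.left 0 1 ∧ ¬ U.left 1 0 := by
        have := (U.comparable 0 1).not.2 fun h => h.1 (ReflTransGen.single h1)
        tauto
      intro r s
      fin_cases r <;> fin_cases s <;> simp [hl.1, hl.2, U.left_irrefl]
    · intro u w huw
      have hu : u ≠ 2 := by rintro rfl; exact h2 w huw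
      by_cases hw : w = 2
      · simp [hu, hw]
      · simp [hu, hw]

/-- The trees with vertices `0, 1, 2` in which `2` is a child of `1` and `0` is the root. -/
theorem isExtTwo_one_iff (U : PlanarTree 3) :
    IsExtTwo 1 U ↔ U.edge 1 2 ∧ ∀ u, ¬ U.edge u 0 := by
  have hB : ∀ k : Fin 3, blockProj (show 3 + 1 = 2 + 2 from rfl) (1 : Fin 2) k =
    if k = 0 then 0 else 1 := by decide
  have hI : ∀ j : Fin 2, blockIncl (show 3 + 1 = 2 + 2 from rfl) (1 : Fin 2) j =
    if j = 0 then 1 else 2 := by decide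
  unfold IsExtTwo PlanarTree.IsExt PlanarTree.two
  simp only [hB, hI]
  constructor
  · rintro ⟨h1, -, h3, -⟩
    refine ⟨by simpa using h1 0 1, fun w hw => ?_⟩
    simpa using h3 w 0 hw
  · rintro ⟨h1, h2⟩
    have h10 : ¬ U.edge 2 1 := fun h => absurd
      (U.antisymm 1 2 (ReflTransGen.single h1) (ReflTransGen.single h)) (by decide)
    refine ⟨?_, ?_, ?_, fun _ _ h => h.elim⟩
    · intro r s
      fin_cases r <;> fin_cases s <;> simp [h1, h10, U.edge_irrefl]
    · have hl : ¬ U.left 1 2 ∧ ¬ U.left 2 1 := by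
        have := (U.comparable 1 2).not.2 fun h => h.1 (ReflTransGen.single h1)
        tauto
      intro r s
      fin_cases r <;> fin_cases s <;> simp [hl.1, hl.2, U.left_irrefl]
    · intro u w huw
      have hw : w ≠ 0 := by rintro rfl; exact h2 u huw
      by_cases hu : u = 0
      · simp [hu, hw]
      · simp [hu, hw]

/-- A vertex without incoming edges is the root, and all other vertices have a parent. -/
theorem exists_parent {n : ℕ} (U : PlanarTree n) {r v : Fin n} (hr : ∀ u, ¬ U.edge u r)
    (hv : v ≠ r) : ∃ u, U.edge u v := by
  obtain ⟨r', -, hu⟩ := U.existsUnique_root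
  by_contra! hcon
  have key : ∀ w, (∀ u, ¬ U.edge u w) → w = r' := fun w hw => hu w fun u huw => by
    rcases ReflTransGen.cases_tail huw with h | ⟨z, -, hz⟩
    · exact h.symm
    · exact absurd hz (hw z)
  exact hv ((key v hcon).trans (key r hr).symm)

/-- The only extension at `1` is the chain `0 → 1 → 2`, which is also an extension at `0`. -/
theorem IsExtTwo.zero_of_one {U : PlanarTree 3} (h : IsExtTwo 1 U) : IsExtTwo 0 U := by
  rw [isExtTwo_one_iff] at h
  rw [isExtTwo_zero_iff]
  obtain ⟨h1, h2⟩ := h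
  have h21 : ¬ U.edge 2 1 := fun h => absurd
    (U.antisymm 1 2 (ReflTransGen.single h1) (ReflTransGen.single h)) (by decide)
  constructor
  · obtain ⟨u, hu⟩ := exists_parent U (v := 1) h2 (by decide)
    fin_cases u
    · exact hu
    · exact absurd hu (U.edge_irrefl _)
    · exact absurd hu h21
  · intro w hw
    fin_cases w
    · exact h2 _ hw
    · exact h21 hw
    · exact U.edge_irrefl _ hw

/-- The extensions at `0` that are not extensions at `1`: the trees with root `0` and two further
vertices, both children of the root. -/
theorem isExtTwo_zero_not_one_iff (U : PlanarTree 3) : IsExtTwo 0 U ∧ ¬ IsExtTwo 1 U ↔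
    U.edge 0 1 ∧ U.edge 0 2 ∧ (∀ w, ¬ U.edge 1 w) ∧ ∀ w, ¬ U.edge 2 w := by
  rw [isExtTwo_zero_iff, isExtTwo_one_iff]
  constructor
  · rintro ⟨⟨h1, h2⟩, h3⟩
    have h10 : ¬ U.edge 1 0 := fun h => absurd
      (U.antisymm 0 1 (ReflTransGen.single h1) (ReflTransGen.single h)) (by decide)
    have h0 : ∀ u, ¬ U.edge u 0 := by
      intro u hu
      fin_cases u
      · exact U.edge_irrefl _ hu
      · exact h10 hu
      · exact h2 _ hu
    have h12 : ¬ U.edge 1 2 := fun h => h3 ⟨h, h0⟩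
    refine ⟨h1, ?_, fun w hw => ?_, h2⟩
    · obtain ⟨u, hu⟩ := exists_parent U (v := 2) h0 (by decide)
      fin_cases u
      · exact hu
      · exact absurd hu h12
      · exact absurd hu (U.edge_irrefl _)
    · fin_cases w
      · exact h10 hw
      · exact U.edge_irrefl _ hw
      · exact h12 hw
  · rintro ⟨h1, h2, h3, h4⟩
    exact ⟨⟨h1, h4⟩, fun h => h3 _ h.1⟩

/-- Exchanging two leaves exchanges left and right. -/
theorem act_swap_ne {U : PlanarTree 3} (h₁ : ∀ w, ¬ U.edge 1 w) (h₂ : ∀ w, ¬ U.edge 2 w) :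
    U.act (Equiv.swap 1 2) ≠ U := by
  intro e
  have hrtg : ∀ {u v : Fin 3}, (∀ w, ¬ U.edge u w) → ReflTransGen U.edge u v → u = v := by
    intro u v hu huv
    rcases ReflTransGen.cases_head huv with h | ⟨z, hz, -⟩
    · exact h
    · exact absurd hz (hu z)
  have hl : U.left 1 2 ↔ U.left 2 1 := by
    conv_lhs => rw [← e]
    change U.left (Equiv.swap (1 : Fin 3) 2 1) (Equiv.swap (1 : Fin 3) 2 2) ↔ _
    rw [Equiv.swap_apply_left, Equiv.swap_apply_right]
  have := (U.comparable 1 2).2 ⟨fun h => absurd (hrtg h₁ h) (by decide),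
    fun h => absurd (hrtg h₂ h) (by decide)⟩
  have h12 : U.left 1 2 := this.elim id hl.2
  exact U.left_irrefl 1 (U.left_trans 1 2 1 h12 (hl.1 h12))

end FunWord

namespace MQuilt

open FunWord GradedOperad

/-- Insertion of `m` at the vertex `i`, and then at the vertex `j`. -/
def plugTwo (i : Fin 3) (j : Fin 2) : mQuilt.obj 3 0 →+ mQuilt.obj 1 (-1 - 1) :=
  ((mQuilt.comp (show 1 + 1 = 2 + 0 from rfl) (show (-1 - 1 : ℤ) = -1 + -1 from rfl) j).flip
    gm).comp
      ((mQuilt.comp (show 2 + 1 = 3 + 0 from rfl) (show (-1 : ℤ) = 0 + -1 from rfl) i).flip gm)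

theorem plugTwo_apply (i : Fin 3) (j : Fin 2) (x : mQuilt.obj 3 0) :
    plugTwo i j x =
      mQuilt.comp (show 1 + 1 = 2 + 0 from rfl) (show (-1 - 1 : ℤ) = -1 + -1 from rfl) j
        (mQuilt.comp (show 2 + 1 = 3 + 0 from rfl) (show (-1 : ℤ) = 0 + -1 from rfl) i x gm) gm :=
  rfl

theorem plugTwo_zero_one (x : mQuilt.obj 3 0) : plugTwo 0 1 x = -plugTwo 2 0 x := by
  rw [plugTwo_apply, plugTwo_apply, mQuilt.comp_comm (show 2 + 1 = 3 + 0 from rfl)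
    (show 1 + 1 = 2 + 0 from rfl) (show 2 + 1 = 3 + 0 from rfl) (show 1 + 1 = 2 + 0 from rfl)
    (show (-1 : ℤ) = 0 + -1 from rfl) (show (-1 - 1 : ℤ) = -1 + -1 from rfl)
    (show (-1 : ℤ) = 0 + -1 from rfl) (show (-1 - 1 : ℤ) = -1 + -1 from rfl)
    0 2 (by decide) 1 rfl 0 rfl]
  simp

theorem plugTwo_one_one (x : mQuilt.obj 3 0) : plugTwo 1 1 x = -plugTwo 2 1 x := by
  rw [plugTwo_apply, plugTwo_apply, mQuilt.comp_comm (show 2 + 1 = 3 + 0 from rfl)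
    (show 1 + 1 = 2 + 0 from rfl) (show 2 + 1 = 3 + 0 from rfl) (show 1 + 1 = 2 + 0 from rfl)
    (show (-1 : ℤ) = 0 + -1 from rfl) (show (-1 - 1 : ℤ) = -1 + -1 from rfl)
    (show (-1 : ℤ) = 0 + -1 from rfl) (show (-1 - 1 : ℤ) = -1 + -1 from rfl)
    1 2 (by decide) 1 rfl 1 rfl]
  simp

/-- The class of the quilt `(12, 1 → 2)`. -/
noncomputable def two : mQuilt.obj 2 0 := ι (Finsupp.single quiltTwo 1)

/-- The composite of `(12, 1 → 2)` and `m` at the vertex `i`. -/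
noncomputable def twoPlug (i : Fin 2) : mQuilt.obj 1 (-1) :=
  mQuilt.comp (show 1 + 1 = 2 + 0 from rfl) (show (-1 : ℤ) = 0 + -1 from rfl) i two gm

theorem Δ_eq : Δ = twoPlug 0 - twoPlug 1 := rfl

/-- The composite of `(12, 1 → 2)` with itself at the vertex `a`. -/
noncomputable def twoTwo (a : Fin 2) : mQuilt.obj 3 0 :=
  mQuilt.comp (show 3 + 1 = 2 + 2 from rfl) (show (0 : ℤ) = 0 + 0 from rfl) a two two

theorem two_comp_twoPlug (a i : Fin 2) :
    mQuilt.comp (show 2 + 1 = 2 + 1 from rfl) (show (-1 : ℤ) = 0 + -1 from rfl) a two (twoPlug i) =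
      mQuilt.comp (show 2 + 1 = 3 + 0 from rfl) (show (-1 : ℤ) = 0 + -1 from rfl)
        (blockIncl (show 3 + 1 = 2 + 2 from rfl) a i) (twoTwo a) gm :=
  (mQuilt.comp_assoc (show 3 + 1 = 2 + 2 from rfl) (show 2 + 1 = 3 + 0 from rfl)
    (show 1 + 1 = 2 + 0 from rfl) (show 2 + 1 = 2 + 1 from rfl) (show (0 : ℤ) = 0 + 0 from rfl)
    (show (-1 : ℤ) = 0 + -1 from rfl) (show (-1 : ℤ) = 0 + -1 from rfl)
    (show (-1 : ℤ) = 0 + -1 from rfl) a i two two gm).symm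

theorem twoPlug_zero_comp (i : Fin 2) :
    mQuilt.comp (show 1 + 1 = 1 + 1 from rfl) (show (-1 - 1 : ℤ) = -1 + -1 from rfl) 0
      (twoPlug 0) (twoPlug i) =
        -plugTwo (blockIncl (show 3 + 1 = 2 + 2 from rfl) 1 i) 0 (twoTwo 1) := by
  rw [plugTwo_apply, ← two_comp_twoPlug]
  conv_lhs => rw [twoPlug]
  rw [mQuilt.comp_comm (show 1 + 1 = 2 + 0 from rfl)
    (show 1 + 1 = 1 + 1 from rfl) (show 2 + 1 = 2 + 1 from rfl) (show 1 + 1 = 2 + 0 from rfl)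
    (show (-1 : ℤ) = 0 + -1 from rfl) (show (-1 - 1 : ℤ) = -1 + -1 from rfl)
    (show (-1 : ℤ) = 0 + -1 from rfl) (show (-1 - 1 : ℤ) = -1 + -1 from rfl)
    0 1 (by decide) 0 rfl 0 rfl]
  simp

theorem twoPlug_one_comp (i : Fin 2) :
    mQuilt.comp (show 1 + 1 = 1 + 1 from rfl) (show (-1 - 1 : ℤ) = -1 + -1 from rfl) 0
      (twoPlug 1) (twoPlug i) =
        -plugTwo (blockIncl (show 3 + 1 = 2 + 2 from rfl) 0 i) 1 (twoTwo 0) := by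
  rw [plugTwo_apply, ← two_comp_twoPlug, mQuilt.comp_comm (show 2 + 1 = 2 + 1 from rfl)
    (show 1 + 1 = 2 + 0 from rfl) (show 1 + 1 = 2 + 0 from rfl) (show 1 + 1 = 1 + 1 from rfl)
    (show (-1 : ℤ) = 0 + -1 from rfl) (show (-1 - 1 : ℤ) = -1 + -1 from rfl)
    (show (-1 : ℤ) = 0 + -1 from rfl) (show (-1 - 1 : ℤ) = -1 + -1 from rfl)
    0 1 (by decide) 1 rfl 0 rfl]
  simp [twoPlug]

theorem twoPlug_one_comp_gm :
    mQuilt.comp (show 0 + 1 = 1 + 0 from rfl) (show (-1 - 1 : ℤ) = -1 + -1 from rfl) 0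
      (twoPlug 1) gm = 0 := mk_eq Rel.m_assoc

/-- The vanishing of `(1 → 2) ∘ (m, m)`, inside the composite of `1 → 2` with itself at `a`. -/
theorem plugTwo_twoTwo (a : Fin 2) :
    plugTwo (blockIncl (show 3 + 1 = 2 + 2 from rfl) a 1)
      (blockIncl (show 2 + 1 = 2 + 1 from rfl) a 0) (twoTwo a) = 0 := by
  rw [plugTwo_apply, ← two_comp_twoPlug, mQuilt.comp_assoc (show 2 + 1 = 2 + 1 from rfl)
    (show 1 + 1 = 2 + 0 from rfl) (show 0 + 1 = 1 + 0 from rfl) (show 1 + 1 = 2 + 0 from rfl)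
    (show (-1 : ℤ) = 0 + -1 from rfl) (show (-1 - 1 : ℤ) = -1 + -1 from rfl)
    (show (-1 - 1 : ℤ) = -1 + -1 from rfl) (show (-1 - 1 : ℤ) = 0 + (-1 - 1) from rfl),
    twoPlug_one_comp_gm, map_zero]

/-- The class of the quilt with word `123` and the given tree. -/
noncomputable def treeCls (U : PlanarTree 3) : mQuilt.obj 3 0 := ι (quiltOf 0 U [0, 1, 2])

open Classical in
theorem twoTwo_eq (a : Fin 2) :
    twoTwo a = ∑ U : PlanarTree 3 with IsExtTwo a U, treeCls U := by
  rw [twoTwo, two, ← ι_partialComp, partialComp_two, map_sum]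
  rfl

/-- Exchanging the two leaves of a tree whose root has two children: since `m` may be moved freely
in the word, inserting it in one leaf is the same as inserting it in the other leaf of the
exchanged tree. -/
theorem treeCls_act_swap {U : PlanarTree 3} (hU : IsExtTwo 0 U)
    (hU' : IsExtTwo 0 (U.act (Equiv.swap 1 2))) :
    mQuilt.comp (show 2 + 1 = 3 + 0 from rfl) (show (-1 : ℤ) = 0 + -1 from rfl) 2
      (treeCls (U.act (Equiv.swap 1 2))) gm =
    mQuilt.comp (show 2 + 1 = 3 + 0 from rfl) (show (-1 : ℤ) = 0 + -1 from rfl) 1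
      (treeCls U) gm := by
  obtain ⟨R, hR1, hR2⟩ := exists_quilt_of_isExtTwo hU
  obtain ⟨R', hR1', hR2'⟩ := exists_quilt_of_isExtTwo hU'
  have e := plug_eq (show 2 + 1 = 3 + 0 from rfl) (show (-1 : ℤ) = 0 + -1 from rfl) R 1 hR1 hR2
  have e' := plug_eq (show 2 + 1 = 3 + 0 from rfl) (show (-1 : ℤ) = 0 + -1 from rfl) R' 2 hR1' hR2'
  unfold plug at e e'
  unfold treeCls
  rw [e, e', comp_gm_move _ _ R' 2 (quiltAct (Equiv.swap 1 2) R), ι_quiltAct]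
  · have := mQuilt.act_comp (show 2 + 1 = 3 + 0 from rfl) (show (-1 : ℤ) = 0 + -1 from rfl) 2
      (Equiv.swap 1 2) 1 1 (fun j => j.elim0) (by decide) (ι (Finsupp.single R 1)) gm
    rwa [mQuilt.act_one, mQuilt.act_one, Equiv.swap_apply_right] at this
  · rw [hR1']
    exact congrArg (PlanarTree.act _) hR1.symm
  · change _ = (R.1.word.letters.map (Equiv.swap 1 2).symm).filter _
    rw [hR2, hR2']
    decide

/-- The four terms of `Δ ∘ Δ` are composites of `(1 → 2) ∘ₐ (1 → 2)` with two copies of `m`. The two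
composites of `1 → 2` differ by the sum `x` over the trees with two leaves, which is treated by
exchanging the leaves. -/
theorem Δ_comp_Δ :
    mQuilt.comp (show 1 + 1 = 1 + 1 from rfl) (show (-1 - 1 : ℤ) = -1 + -1 from rfl) 0 Δ Δ = 0 := by
  classical
  set E : Finset (PlanarTree 3) :=
    Finset.univ.filter fun U => IsExtTwo 0 U ∧ ¬ IsExtTwo 1 U with hE
  set x := ∑ U ∈ E, treeCls U with hx
  have hsum : twoTwo 0 = twoTwo 1 + x := by
    rw [twoTwo_eq, twoTwo_eq, hx, hE, ← Finset.sum_filter_add_sum_filter_not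
      (Finset.univ.filter fun U => IsExtTwo 0 U) fun U => IsExtTwo 1 U, Finset.filter_filter,
      Finset.filter_filter]
    congr 2
    ext U
    simp only [Finset.mem_filter, Finset.mem_univ, true_and]
    exact ⟨fun h => h.2, fun h => ⟨h.zero_of_one, h⟩⟩
  have hswap : ∀ U ∈ E, U.act (Equiv.swap 1 2) ∈ E ∧
      (U.act (Equiv.swap 1 2)).act (Equiv.swap 1 2) = U ∧ U.act (Equiv.swap 1 2) ≠ U := by
    intro U hU
    simp only [hE, Finset.mem_filter, Finset.mem_univ, true_and, isExtTwo_zero_not_one_iff] at hU ⊢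
    obtain ⟨h1, h2, h3, h4⟩ := hU
    refine ⟨⟨?_, ?_, fun w hw => ?_, fun w hw => ?_⟩, ?_, act_swap_ne h3 h4⟩
    · change U.edge (Equiv.swap (1 : Fin 3) 2 0) (Equiv.swap (1 : Fin 3) 2 1)
      rwa [Equiv.swap_apply_left, show Equiv.swap (1 : Fin 3) 2 0 = 0 by decide]
    · change U.edge (Equiv.swap (1 : Fin 3) 2 0) (Equiv.swap (1 : Fin 3) 2 2)
      rwa [Equiv.swap_apply_right, show Equiv.swap (1 : Fin 3) 2 0 = 0 by decide]
    · change U.edge (Equiv.swap (1 : Fin 3) 2 1) _ at hw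
      rw [Equiv.swap_apply_left] at hw
      exact h4 _ hw
    · change U.edge (Equiv.swap (1 : Fin 3) 2 2) _ at hw
      rw [Equiv.swap_apply_right] at hw
      exact h3 _ hw
    · refine PlanarTree.ext ?_ ?_ <;>
      · funext u v
        simp [PlanarTree.act]
  have hplug : ∀ U ∈ E, ∀ j, plugTwo 2 j (treeCls (U.act (Equiv.swap 1 2))) =
      plugTwo 1 j (treeCls U) := by
    intro U hU j
    have h1 := (Finset.mem_filter.1 hU).2.1
    have h2 := (Finset.mem_filter.1 (hswap U hU).1).2.1
    rw [plugTwo_apply, plugTwo_apply, treeCls_act_swap h1 h2]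
  -- inserting `m` in the root and in one of the leaves does not depend on the leaf
  have h1 : plugTwo 1 0 x = plugTwo 2 0 x := by
    rw [hx, map_sum, map_sum]
    exact Finset.sum_bij (fun U _ => U.act (Equiv.swap 1 2)) (fun U hU => (hswap U hU).1)
      (fun U hU U' hU' e => by rw [← (hswap U hU).2.1, e, (hswap U' hU').2.1])
      (fun U hU => ⟨_, (hswap U hU).1, (hswap U hU).2.1⟩) fun U hU => (hplug U hU 0).symm
  -- the terms with `m` in both leaves cancel in pairs, as `m` has odd degree
  have h2 : plugTwo 2 1 x = 0 := by
    rw [hx, map_sum]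
    refine Finset.sum_involution (fun U _ => U.act (Equiv.swap 1 2)) (fun U hU => ?_)
      (fun U hU _ => (hswap U hU).2.2) (fun U hU => (hswap U hU).1) fun U hU => (hswap U hU).2.1
    rw [hplug U hU 1, plugTwo_one_one, add_neg_cancel]
  have h3 : plugTwo 1 0 (twoTwo 0) = 0 := plugTwo_twoTwo 0
  have h4 : plugTwo 2 1 (twoTwo 1) = 0 := plugTwo_twoTwo 1
  have e00 : _ = -plugTwo 1 0 (twoTwo 1) := twoPlug_zero_comp 0
  have e01 : _ = -plugTwo 2 0 (twoTwo 1) := twoPlug_zero_comp 1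
  have e10 : _ = -plugTwo 0 1 (twoTwo 0) := twoPlug_one_comp 0
  have e11 : _ = -plugTwo 1 1 (twoTwo 0) := twoPlug_one_comp 1
  rw [Δ_eq, map_sub, map_sub, AddMonoidHom.sub_apply, AddMonoidHom.sub_apply,
    e00, e01, e10, e11, plugTwo_zero_one, plugTwo_one_one]
  rw [hsum, map_add, h1] at h3
  rw [hsum, map_add, map_add, h2, h4, eq_neg_of_add_eq_zero_left h3]
  abel

theorem IsBoundary.map_Δ {D : mQuilt.DegMap} (hD : IsBoundary D) : D 1 (-1) Δ = 0 := by
  have h : ∀ i, D 1 (-1) (twoPlug i) = 0 := by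
    intro i
    rw [twoPlug, hD.leibniz _ _ (show (-1 - 1 : ℤ) = (0 - 1) + -1 from rfl)
      (show (-1 - 1 : ℤ) = 0 + (-1 - 1) from rfl), two, hD.map_quilt, hD.map_m, boundary_quiltTwo,
      map_zero, map_zero, map_zero, AddMonoidHom.zero_apply, smul_zero, add_zero]
  rw [Δ_eq, map_sub, h, h, sub_zero]

end MQuilt

theorem mainTheorem11 :
    ∃ D : mQuilt.DegMap,
      (MQuilt.IsBoundary D ∧ ∀ D' : mQuilt.DegMap, MQuilt.IsBoundary D' → D' = D) ∧
        GradedOperad.IsDifferential (D + GradedOperad.ad MQuilt.Δ) :=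
  have hD := MQuilt.isBoundary_boundary
  ⟨MQuilt.boundary, ⟨hD, fun _ hD' => hD'.unique hD⟩,
    hD.toIsDerivation.isDifferential_add_ad hD.sq_zero hD.map_Δ MQuilt.Δ_comp_Δ⟩
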